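/- **Setting.** $M$ players share $K$ arms, $1\le M\le K$, during $T\ge 1$ rounds. In round $t$ player $m$ pulls an arm $A^m(t)$ and receives $R^m(t)=Y^m_{A^m(t),t}$ if no other player pulls that arm in this round, and $R^m(t)=0$ if there is such a collision; she observes her own reward and her own collision indicator only. The variables $Y^m_{k,t}$ take values in $[0,1]$; for each $(m,k)$ they are identically distributed in $t$ with mean $\mu^m_k$, and the reward vectors $(Y^m_{k,t})_{m,k}$ of different rounds $t$ are independent. A matching is a one-to-one map $\pi:[M]\to[K]$, its utility is $U(\pi)=\sum_m\mu^m_{\pi(m)}$, $U^\star=\max_\pi U(\pi)$, $\Delta(\pi)=U^\star-U(\pi)$, and $\Delta=\min\{\Delta(\pi):\Delta(\pi)>0\}$. The regret is $R_T=TU^\star-\mathbb E\big[\sum_{t=1}^T\sum_{m=1}^M R^m(t)\big]$. For each edge $(m,k)\in[M]\times[K]$ for which this set is nonempty, let $\pi^{m,k}$ be a matching of maximum utility in $\{\pi:\pi(m)=k,\ U(\pi)<U^\star\}$. $\ln$ is the natural logarithm and $\lg$ the logarithm in base 2. **Algorithm (M-ETC-Elim with parameter $c\ge1$; input $K$ and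 $T$; all players run the same program).** *Initialization.* For $\lceil K\ln(K^2T)\rceil$ rounds, each player pulls independent uniformly random arms until she has no collision, then sticks to that arm (musical chairs). Then a player on arm $k$ pulls $k$ for $2k-2$ rounds, then the arms $k+1,\dots,K$ once each, then arm $1$ for $K-k$ rounds; her rank $R$ is $1$ plus the number of her collisions in the first of these three parts, and her value of $M$ is $1$ plus the number of her collisions in the first two parts. The player of rank $1$ is the leader, the others are followers; from now on players are labelled by rank. Player $i$ starts with communication arm $i$. A bit $1$ is sent by pulling the receiver's communication arm, a bit $0$ by pulling one's own; all other players stay on their communication arms. The followers send and receive in the order of their ranks. *Epochs.* Let $\delta=1/(M^2KT^2)$ and $\varepsilon_p=\sqrt{\ln(2/\delta)/2^{1+p^c}}$. The leader starts with the candidate edges $\mathcal E=[M]\times[K]$ and the estimates $\widetilde\mu=0$. In epoch $p=1,2,\dots$ she computes a matching $\pi_1$ of maximum estimated utility, and for each $(m,k)\in\mathcal E$ a matching of maximum estimated utility among those with $\pi(m)=k$, ties being broken by an arbitrary rule; if its estimated utility is below that of $\pi_1$ by more than $4M\varepsilon_p$, she removes $(m,k)$ from $\mathcal E$, otherwise she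 adds this matching to the set $\mathcal C$ of candidate matchings of this epoch. She sends to the followers the size of $\mathcal C$, then to each follower her arms in the matchings of $\mathcal C$ and the arms $\pi_1(1)$ and $\pi_1(m)$, the new communication arms of the leader and of this follower $m$. If $\mathcal C$ has exactly one element, all players pull their arms in it until the end. Otherwise, for each matching in $\mathcal C$ every player pulls her arm in it $2^{p^c}$ times; then each player computes the empirical mean of each arm over the exploration rounds of this epoch ($0$ if she did not pull it), each follower sends the $\lceil(p^c+1)/2\rceil$ most significant bits of her means to the leader, and these truncated values together with the leader's own means are the new estimates $\widetilde\mu$. An arm is sent with $\lceil\lg K\rceil$ bits and the size of $\mathcal C$ with $\lceil\lg(MK+1)\rceil$ bits. **Theorem.** Suppose that the maximum matching is unique and that there is a suboptimal matching (that is, $K\ge2$). Then for every $T\ge1$ the total reward is integrable and the regret of M-ETC-Elim with $c=1$ satisfies \begin{align*} R_T\le{}&2+MK\ln(e^2K^2T)+3M^2K\lg(K)\,\lg\!\left(\frac{64M^2\ln(2M^2KT^2)}{\Delta^2}\right)+MK\lg^2\!\left(\frac{64M^2\ln(2M^2KT^2)}{\Delta^2}\right)\\ &+\frac{4\sqrt2-2}{3-2\sqrt2}M^3K\lg(K)\sqrt{\ln(2M^2KT^2)}+\frac{2\sqrt2-1}{\sqrt2-1}\sum_{(m,k)}\frac{64M^2\ln(2M^2KT^2)}{\Delta(\pi^{m,k})},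 \end{align*} where the sum is over the edges $(m,k)\in[M]\times[K]$ for which $\pi^{m,k}$ exists. -/

import Mathlib

open MeasureTheory ProbabilityTheory

/-! ### The bandit model -/

/-- A matching of `M` players to `K` arms: a one-to-one map from players to arms. -/
abbrev Matching (M K : ℕ) : Type := Fin M ↪ Fin K

/-- Total weight `∑ m, w m (π m)` of a matching. For `w = μ` this is the utility `U(π)`. -/
def utility {M K : ℕ} (w : Fin M → Fin K → ℝ) (π : Matching M K) : ℝ := ∑ m, w m (π m)

/-- `U⋆`, the maximum attainable utility. -/
noncomputable def maxUtility {M K : ℕ} (μ : Fin M → Fin K → ℝ) : ℝ :=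
  ⨆ π : Matching M K, utility μ π

/-- `Δ(π) = U⋆ - U(π)`. -/
noncomputable def gap {M K : ℕ} (μ : Fin M → Fin K → ℝ) (π : Matching M K) : ℝ :=
  maxUtility μ - utility μ π

/-- `Δ`, the infimum of the positive gaps. It is used only when there is a positive gap. -/
noncomputable def minGap {M K : ℕ} (μ : Fin M → Fin K → ℝ) : ℝ :=
  sInf {x : ℝ | ∃ π : Matching M K, 0 < gap μ π ∧ x = gap μ π}

/-- The suboptimal matchings that assign arm `k` to player `m`. -/
def suboptimalThrough {M K : ℕ} (μ : Fin M → Fin K → ℝ) (m : Fin M) (k : Fin K) :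
    Set (Matching M K) :=
  {π | π m = k ∧ utility μ π < maxUtility μ}

/-- The probabilistic assumptions. Rounds are numbered from `0`. `Y t m k` is the reward
that player `m` gets from arm `k` in round `t` if she is alone on it, and `V t m` is the uniformly
random arm that player `m` can draw privately in round `t`. The reward vectors of different
rounds are independent; nothing is assumed about the dependence between the rewards of different
players and arms within one round. -/
structure IsBandit {Ω : Type*} [MeasurableSpace Ω] {M K : ℕ} (P : Measure Ω)
    (μ : Fin M → Fin K → ℝ) (Y : ℕ → Fin M → Fin K → Ω → ℝ) (V : ℕ → Fin M → Ω → Fin K) :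
    Prop where
  measurable_reward : ∀ t m k, Measurable (Y t m k)
  reward_mem : ∀ t m k ω, Y t m k ω ∈ Set.Icc (0 : ℝ) 1
  identDistrib : ∀ t m k, IdentDistrib (Y t m k) (Y 0 m k) P P
  mean : ∀ t m k, ∫ ω, Y t m k ω ∂P = μ m k
  indep_rounds : iIndepFun (fun (t : ℕ) (ω : Ω) (e : Fin M × Fin K) => Y t e.1 e.2 ω) P
  measurable_draw : ∀ t m, Measurable (V t m)
  uniform_draw : ∀ t m k, P {ω | V t m ω = k} = (K : ENNReal)⁻¹
  indep_draws : iIndepFun (fun (i : ℕ × Fin M) (ω : Ω) => V i.1 i.2 ω) P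
  indep_draws_rewards :
    IndepFun (fun (ω : Ω) (i : ℕ × Fin M) => V i.1 i.2 ω)
      (fun (ω : Ω) (i : ℕ × Fin M × Fin K) => Y i.1 i.2.1 i.2.2 ω) P

/-! ### Programs run by the players, and their joint execution -/

/-- A program of a single player that returns a value of type `α`. Its only interaction with the
world is to pull an arm (a chosen one, or a uniformly random one), which takes one round, and then
to observe the reward and the collision indicator (`true` for a collision) of that round. -/
inductive Prog (K : ℕ) (α : Type) : Type
  | ret (a : α) : Prog K α
  | pull (k : Fin K) (next : ℝ → Bool → Prog K α) : Prog K α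
  | pullUnif (next : Fin K → ℝ → Bool → Prog K α) : Prog K α

namespace Prog

/-- Run a program, then a second one that may use the returned value. -/
def bind {K : ℕ} {α β : Type} : Prog K α → (α → Prog K β) → Prog K β
  | ret a, f => f a
  | pull k next, f => pull k fun r c => bind (next r c) f
  | pullUnif next, f => pullUnif fun k r c => bind (next k r c) f

instance {K : ℕ} : Monad (Prog K) where
  pure := ret
  bind := bind

/-- The arm pulled in the current round, where `v` is the random arm drawn in this round.
A player whose program is over pulls the first arm. -/
def arm {K : ℕ} [NeZero K] (v : Fin K) : Prog K Unit → Fin K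
  | ret _ => 0
  | pull k _ => k
  | pullUnif _ => v

/-- The rest of the program after the current round, given the draw `v` and the observations. -/
def step {K : ℕ} (v : Fin K) (r : ℝ) (c : Bool) : Prog K Unit → Prog K Unit
  | ret a => ret a
  | pull _ next => next r c
  | pullUnif next => next v r c

/-- Pull the arms of a list one after the other, and return the observations. -/
def pullSeq {K : ℕ} : List (Fin K) → Prog K (List (ℝ × Bool))
  | [] => ret []
  | k :: l => pull k fun r c => bind (pullSeq l) fun obs => ret ((r, c) :: obs)

end Prog

/-- Does player `m` collide if the players pull the arms `a`? -/
def collision {M K : ℕ} (a : Fin M → Fin K) (m : Fin M) : Bool :=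
  decide (∃ n : Fin M, n ≠ m ∧ a n = a m)

/-- The reward of player `m` if the players pull the arms `a` and `y` are the potential rewards. -/
def reward {M K : ℕ} (y : Fin M → Fin K → ℝ) (a : Fin M → Fin K) (m : Fin M) : ℝ :=
  if collision a m then 0 else y m (a m)

/-- What remains to be executed by each player before round `t`, when all players run `prog` with
random draws `v` and potential rewards `y`. Each player uses her own observations only. -/
def remaining {M K : ℕ} [NeZero K] (prog : Prog K Unit) (v : ℕ → Fin M → Fin K)
    (y : ℕ → Fin M → Fin K → ℝ) : ℕ → Fin M → Prog K Unit
  | 0 => fun _ => prog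
  | t + 1 => fun m =>
      let a : Fin M → Fin K := fun n => (remaining prog v y t n).arm (v t n)
      (remaining prog v y t m).step (v t m) (reward (y t) a m) (collision a m)

/-- The arms `A^m(t)` pulled in round `t`. -/
def armsPulled {M K : ℕ} [NeZero K] (prog : Prog K Unit) (v : ℕ → Fin M → Fin K)
    (y : ℕ → Fin M → Fin K → ℝ) (t : ℕ) (m : Fin M) : Fin K :=
  (remaining prog v y t m).arm (v t m)

/-- The sum of the rewards of all players in the first `T` rounds. -/
def totalReward {M K : ℕ} [NeZero K] (prog : Prog K Unit) (T : ℕ) (v : ℕ → Fin M → Fin K)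
    (y : ℕ → Fin M → Fin K → ℝ) : ℝ :=
  ∑ t ∈ Finset.range T, ∑ m : Fin M, reward (y t) (armsPulled prog v y t) m

/-- The expected regret `R_T` when all players run `prog`. -/
noncomputable def regret {Ω : Type*} [MeasurableSpace Ω] {M K : ℕ} [NeZero K] (P : Measure Ω)
    (μ : Fin M → Fin K → ℝ) (Y : ℕ → Fin M → Fin K → Ω → ℝ) (V : ℕ → Fin M → Ω → Fin K)
    (prog : Prog K Unit) (T : ℕ) : ℝ :=
  T * maxUtility μ -
    ∫ ω, totalReward prog T (fun t m => V t m ω) (fun t m k => Y t m k ω) ∂P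

/-! ### Initialization -/

/-- Musical chairs for a given number of rounds: pull uniformly random arms until there is no
collision, and then stick to that arm. Returns the occupied arm, if any. -/
def musicalChairs {K : ℕ} : ℕ → Option (Fin K) → Prog K (Option (Fin K))
  | 0, k => .ret k
  | n + 1, none => .pullUnif fun i _ c => musicalChairs n (if c then none else some i)
  | n + 1, some k => .pull k fun _ _ => musicalChairs n (some k)

/-- Number of collisions in a list of observations. -/
def numCollisions (obs : List (ℝ × Bool)) : ℕ := obs.countP fun o => o.2

/-- Sequential hopping from the occupied arm `k`: wait on `k`, sweep through the arms above `k`,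
then pull the first arm. Returns the ranking `R` and the number of players `M`. As arms are numbered
from `0` here, the arm `k` of the usual numbering is `k - 1`. -/
def hopping {K : ℕ} [NeZero K] (k : Fin K) : Prog K (ℕ × ℕ) := do
  let wait ← Prog.pullSeq (List.replicate (2 * k.val) k)
  let sweep ← Prog.pullSeq ((List.finRange K).filter fun i => k < i)
  let _ ← Prog.pullSeq (List.replicate (K - 1 - k.val) (0 : Fin K))
  return (1 + numCollisions wait, 1 + numCollisions wait + numCollisions sweep)

/-- The initialization with failure probability `δ₀`; it returns `(R, M)`. A player who has not
found a free arm during musical chairs goes on with the first arm. -/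
noncomputable def init (K : ℕ) [NeZero K] (δ₀ : ℝ) : Prog K (ℕ × ℕ) := do
  let k ← musicalChairs ⌈(K : ℝ) * Real.log (K / δ₀)⌉₊ none
  hopping (k.getD 0)

/-! ### Communication -/

/-- Binary expansion with `b` digits, least significant digit first. -/
def toBits (b x : ℕ) : List Bool := (List.range b).map fun i => x.testBit i

/-- The number with a given binary expansion, least significant digit first. -/
def ofBits : List Bool → ℕ
  | [] => 0
  | d :: l => d.toNat + 2 * ofBits l

/-- The arms to pull in order to send numbers of `b` bits each to the player on arm `target`: pull
`target` for a one, and the own communication arm for a zero. -/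
def signal {K : ℕ} (own target : Fin K) (b : ℕ) (xs : List ℕ) : List (Fin K) :=
  (xs.flatMap (toBits b)).map fun d => if d then target else own

/-- Stay on the own communication arm for `n` rounds. -/
def idle {K : ℕ} (own : Fin K) (n : ℕ) : Prog K Unit := do
  let _ ← Prog.pullSeq (List.replicate n own)
  return ()

/-- Receive a given number of numbers of `b` bits each on the own communication arm. -/
def receive {K : ℕ} (own : Fin K) (b : ℕ) : ℕ → Prog K (List ℕ)
  | 0 => .ret []
  | n + 1 => do
      let obs ← Prog.pullSeq (List.replicate b own)
      let xs ← receive own b n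
      return ofBits (obs.map fun o => o.2) :: xs

/-- Number of bits used for an arm. -/
def armBits (K : ℕ) : ℕ := Nat.clog 2 K

/-- Number of bits used for the number of candidate matchings, which lies in `{0, …, MK}`. -/
def sizeBits (M K : ℕ) : ℕ := Nat.clog 2 (M * K + 1)

/-- Number of bits of a truncated mean in epoch `p`: `(p ^ c + 1) / 2`, rounded up. -/
def meanBits (c p : ℕ) : ℕ := (p ^ c + 2) / 2

/-! ### Quantities computed by the players -/

/-- `ε_p = √(ln (2 / δ) / 2 ^ (1 + p ^ c))`, where `δ = 1 / (M² K T²)`. -/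
noncomputable def epsilon (c M K T p : ℕ) : ℝ :=
  √(Real.log (2 / (1 / ((M : ℝ) ^ 2 * K * (T : ℝ) ^ 2))) / 2 ^ (1 + p ^ c))

/-- Mean reward of arm `k` when `arms` is the sequence of arms pulled and `obs` what was observed;
zero if arm `k` was not pulled. -/
noncomputable def empiricalMean {K : ℕ} (arms : List (Fin K)) (obs : List (ℝ × Bool))
    (k : Fin K) : ℝ :=
  let rs := ((arms.zip obs).filter fun o => o.1 = k).map fun o => o.2.1
  if rs.length = 0 then 0 else rs.sum / rs.length

/-- The `b` most significant bits of `x ∈ [0, 1]`, as an integer in `{0, …, 2 ^ b - 1}`. -/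
noncomputable def truncate (b : ℕ) (x : ℝ) : ℕ := min ⌊2 ^ b * x⌋₊ (2 ^ b - 1)

/-- A rule that picks an element of each nonempty set of matchings; used to break ties. -/
def TieBreak (K : ℕ) : Type := ∀ n : ℕ, n ≤ K → Finset (Matching n K) → Matching n K

/-- The rule does pick an element of the given set. -/
def TieBreak.Valid {K : ℕ} (tie : TieBreak K) : Prop :=
  ∀ (n : ℕ) (h : n ≤ K) (S : Finset (Matching n K)), S.Nonempty → tie n h S ∈ S

open scoped Classical in
/-- A matching of maximum weight among those that satisfy `p`. -/
noncomputable def argmaxMatching {K : ℕ} (tie : TieBreak K) {n : ℕ} (h : n ≤ K)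
    (w : Fin n → Fin K → ℝ) (p : Matching n K → Prop) : Matching n K :=
  tie n h (Finset.univ.filter fun π => p π ∧ ∀ σ, p σ → utility w σ ≤ utility w π)

/-! ### The algorithm -/

open scoped Classical in
/-- The epochs `p, p + 1, …` of the leader, who has rank `1` (index `0`), among `n + 1` players.
The first argument bounds the number of epochs. `E` is the set of candidate edges, `w` the matrix of
estimated means and `comm` the assignment of communication arms. -/
noncomputable def leaderEpochs {K : ℕ} [NeZero K] (tie : TieBreak K) (c T : ℕ) {n : ℕ}
    (h : n + 1 ≤ K) : ℕ → ℕ → Finset (Fin (n + 1) × Fin K) → (Fin (n + 1) → Fin K → ℝ) →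
      (Fin (n + 1) → Fin K) → Prog K Unit
  | 0, _, _, _, _ => .ret ()
  | fuel + 1, p, E, w, comm => do
      let best : Matching (n + 1) K := argmaxMatching tie h w fun _ => True
      let assoc : Fin (n + 1) × Fin K → Matching (n + 1) K :=
        fun e => argmaxMatching tie h w fun π => π e.1 = e.2
      let E' := E.filter fun e =>
        ∑ i, (w i (best i) - w i (assoc e i)) ≤ 4 * ((n + 1 : ℕ) : ℝ) * epsilon c (n + 1) K T p
      let C : List (Matching (n + 1) K) := (E'.image assoc).toList
      -- send the number of candidate matchings to each follower
      let _ ← Prog.pullSeq ((List.finRange n).flatMap fun i =>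
        signal (comm 0) (comm i.succ) (sizeBits (n + 1) K) [C.length])
      -- send to each follower her arms in the candidate matchings and the new communication arms
      let _ ← Prog.pullSeq ((List.finRange n).flatMap fun i =>
        signal (comm 0) (comm i.succ) (armBits K)
          (C.map (fun π => (π i.succ).val) ++ [(best 0).val, (best i.succ).val]))
      match C with
      | [π] => idle (π 0) T -- exploitation until the end of the game
      | _ => do
          let arms := C.flatMap fun π => List.replicate (2 ^ p ^ c) (π 0)
          let obs ← Prog.pullSeq arms
          let xs ← receive (best 0) (meanBits c p) (n * K)
          let w' : Fin (n + 1) → Fin K → ℝ :=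
            Fin.cons (empiricalMean arms obs)
              fun i k => (xs.getD (i.val * K + k.val) 0 : ℝ) / 2 ^ meanBits c p
          leaderEpochs tie c T h fuel (p + 1) E' w' best

/-- The epochs `p, p + 1, …` of the follower of rank `R` among `M` players. The first argument
bounds the number of epochs, and `own` is the communication arm of this follower. Messages to and from the followers come in the order of their ranks; a follower idles
during the messages of the others. -/
noncomputable def followerEpochs {K : ℕ} [NeZero K] (c T R M : ℕ) :
    ℕ → ℕ → Fin K → Prog K Unit
  | 0, _, _ => .ret ()
  | fuel + 1, p, own => do
      idle own ((R - 2) * sizeBits M K)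
      let s ← receive own (sizeBits M K) 1
      idle own ((M - R) * sizeBits M K)
      let size := s.getD 0 0
      idle own ((R - 2) * ((size + 2) * armBits K))
      let xs ← receive own (armBits K) (size + 2)
      idle own ((M - R) * ((size + 2) * armBits K))
      let msg : List (Fin K) := xs.map (Fin.ofNat K)
      let lead := msg.getD size 0
      let own' := msg.getD (size + 1) 0
      if size = 1 then
        idle (msg.getD 0 0) T -- exploitation until the end of the game
      else do
        let arms := (msg.take size).flatMap fun k => List.replicate (2 ^ p ^ c) k
        let obs ← Prog.pullSeq arms
        idle own' ((R - 2) * (K * meanBits c p))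
        let _ ← Prog.pullSeq (signal own' lead (meanBits c p)
          ((List.finRange K).map fun k => truncate (meanBits c p) (empiricalMean arms obs k)))
        idle own' ((M - R) * (K * meanBits c p))
        followerEpochs c T R M fuel (p + 1) own'

/-- M-ETC-Elim with parameter `c`, for `K` arms and horizon `T`; every player runs this program.
An epoch that does not start the exploitation takes at least one round, so `T` epochs are enough. The
player of rank `i` starts with the `i`-th arm as communication arm. -/
noncomputable def metcElim (K : ℕ) [NeZero K] (tie : TieBreak K) (c T : ℕ) : Prog K Unit := do
  let (R, M) ← init K (1 / ((K : ℝ) * T))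
  match M with
  | 0 => return ()
  | n + 1 =>
      if R = 1 then
        if h : n + 1 ≤ K then
          leaderEpochs tie c T h T 1 Finset.univ (fun _ _ => 0) (Fin.castLE h)
        else return () -- possible only if the initialization failed
      else followerEpochs c T R (n + 1) T 1 (Fin.ofNat K (R - 1))

/-! ### Algebra of programs -/

namespace Prog

variable {K : ℕ} {α β γ : Type}

/-! The regret is first reduced to a statement about a single run. Draws and rewards are
independent, so Fubini allows the draws to be fixed. The arms of round `t` then depend on earlier
rewards only, hence are independent of the rewards of round `t`, and the expected reward is the
expected sum of the means of the arms pulled without collision (`IndepRows.integral_totalReward`).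
The regret thus becomes a sum of `roundRegret` terms, each at most `M`. Both reductions need the
pulled arms to be measurable, which is what `MeasProg` provides.

Two events are then given up, and each costs at most 1. Musical chairs: while a player is unseated,
the others leave some arm free, and her draw hits it with probability `1/K`, independently of what
determines it; so all are seated except with probability at most `M/(K²T)` (`prob_chairsFail_le`).
Inaccurate exploration: the plan of an epoch, including the round in which its exploration starts,
is determined by the rewards before that round (`planAt_congr`). Given the plan, the explored
rewards are fresh, and Hoeffding with a union bound over the edges gives probability at most `MKδ`
per epoch (`prob_badEpoch_le`). A failure costs at most `TM`.

Outside these events the run is explicit. Every program is rewritten as a succession of phases whose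
pulls are fixed in advance and whose lengths are the same for all players (`remaining_phase`).
Communication arms are distinct and followers send in disjoint slots, so every bit arrives, and each
epoch starts in the state `epochProg` described by the leader's data
(`exists_remaining_eq_epochProg`, `epoch_announce`, `epoch_explore`).

The estimates used in epoch `p` compare matchings with the optimal one up to `4Mε_p`
(`accurate_blockEstimates`, `epsilon_step`). So optimal edges survive, the communication matching
has gap at most `4Mε_p`, every candidate has gap at most `8Mε_p`, and a lone candidate is optimal.
If the exploration goes on, then some positive gap is at most `8Mε_p`, which bounds `p + 1` by `lg
(64M²L/Δ²)`, where `L` is `logFactor` (`add_one_le_epochBound`).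

It remains to add up (`sum_roundRegret_epochs_le`). A communication round costs at most two rewards
plus the gap of the communication matching: the two rewards give the terms in the logarithm and its
square, the gaps give convergent series and the term `M³K lg K √L`. In exploration an edge is
charged `2^p · 8Mε_p`, proportional to `√2 ^ p`, and only while `8Mε_p` exceeds its own gap; this
geometric sum is of order `M²L` divided by that gap. -/

theorem bind_eq (q : Prog K α) (f : α → Prog K β) : q >>= f = bind q f := rfl

theorem pure_eq (a : α) : (pure a : Prog K α) = ret a := rfl

@[simp] theorem ret_bind (a : α) (f : α → Prog K β) : bind (ret a) f = f a := rfl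

theorem bind_assoc (q : Prog K α) (f : α → Prog K β) (g : β → Prog K γ) :
    bind (bind q f) g = bind q fun a => bind (f a) g := by
  induction q with
  | ret a => rfl
  | pull k next ih => simp only [bind, ih]
  | pullUnif next ih => simp only [bind, ih]

theorem pullSeq_nil_bind (f : List (ℝ × Bool) → Prog K β) : bind (pullSeq []) f = f [] := rfl

theorem pullSeq_cons_bind (k : Fin K) (l : List (Fin K)) (f : List (ℝ × Bool) → Prog K β) :
    bind (pullSeq (k :: l)) f =
      pull k fun r c => bind (pullSeq l) fun obs => f ((r, c) :: obs) := by
  simp only [pullSeq, bind, bind_assoc]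

/-- Two consecutive sequences of pulls are one sequence. -/
theorem pullSeq_append_bind (l₁ l₂ : List (Fin K))
    (f : List (ℝ × Bool) → List (ℝ × Bool) → Prog K β) :
    (bind (pullSeq l₁) fun o₁ => bind (pullSeq l₂) fun o₂ => f o₁ o₂) =
      bind (pullSeq (l₁ ++ l₂)) fun o => f (o.take l₁.length) (o.drop l₁.length) := by
  induction l₁ generalizing f with
  | nil => simp [pullSeq_nil_bind]
  | cons k l ih =>
    simp only [pullSeq_cons_bind, List.cons_append]
    congr 1
    funext r c
    rw [ih fun o₁ o₂ => f ((r, c) :: o₁) o₂]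
    rfl

end Prog

theorem idle_bind {K : ℕ} {β : Type} (own : Fin K) (N : ℕ) (f : Unit → Prog K β) :
    Prog.bind (idle own N) f = Prog.bind (Prog.pullSeq (List.replicate N own)) fun _ => f () := by
  simp only [idle, Prog.bind_eq, Prog.pure_eq, Prog.bind_assoc, Prog.ret_bind]

/-- Decode `count` numbers of `b` bits each. -/
def decode (b : ℕ) : ℕ → List Bool → List ℕ
  | 0, _ => []
  | n + 1, l => ofBits (l.take b) :: decode b n (l.drop b)

/-- A receiver does not react before the message is over, so her pulls form one sequence known in
advance. -/
theorem receive_eq {K : ℕ} (own : Fin K) (b N : ℕ) :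
    receive own b N = Prog.bind (Prog.pullSeq (List.replicate (N * b) own))
      fun o => Prog.ret (decode b N (o.map Prod.snd)) := by
  induction N with
  | zero => simp [receive, decode, Prog.pullSeq]
  | succ N ih =>
    simp only [receive, Prog.bind_eq, Prog.pure_eq, ih, Prog.bind_assoc, Prog.ret_bind]
    rw [Prog.pullSeq_append_bind (f := fun o₁ o₂ => Prog.ret
      (ofBits (o₁.map fun o => o.2) :: decode b N (o₂.map Prod.snd)))]
    simp only [List.replicate_append_replicate, List.length_replicate, decode, List.map_take,
      List.map_drop]
    rw [show b + N * b = (N + 1) * b by ring]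

theorem receive_bind {K : ℕ} {β : Type} (own : Fin K) (b N : ℕ) (f : List ℕ → Prog K β) :
    Prog.bind (receive own b N) f = Prog.bind (Prog.pullSeq (List.replicate (N * b) own))
      fun o => f (decode b N (o.map Prod.snd)) := by
  rw [receive_eq, Prog.bind_assoc]; rfl

/-! ### Coding -/

theorem ofBits_toBits {b x : ℕ} (h : x < 2 ^ b) : ofBits (toBits b x) = x := by
  induction b generalizing x with
  | zero => simp at h; simp [toBits, ofBits, h]
  | succ b ih =>
    have h2 : x / 2 < 2 ^ b := by rw [pow_succ] at h; omega
    have : toBits (b + 1) x = x.testBit 0 :: toBits b (x / 2) := by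
      simp only [toBits, List.range_succ_eq_map, List.map_cons, List.map_map]
      congr 1
      refine List.map_congr_left fun i _ => ?_
      simp [Nat.testBit_succ]
    rw [this, ofBits, ih h2, Nat.testBit_zero]
    rcases Nat.mod_two_eq_zero_or_one x with h0 | h0 <;> simp [h0] <;> omega

@[simp] theorem length_toBits (b x : ℕ) : (toBits b x).length = b := by simp [toBits]

theorem length_flatMap_toBits (b : ℕ) (xs : List ℕ) :
    (xs.flatMap (toBits b)).length = xs.length * b := by
  induction xs with
  | nil => simp
  | cons x xs ih => simp [ih]; ring

@[simp] theorem length_signal {K : ℕ} (own target : Fin K) (b : ℕ) (xs : List ℕ) :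
    (signal own target b xs).length = xs.length * b := by
  rw [signal, List.length_map, length_flatMap_toBits]

theorem decode_flatMap_toBits {b : ℕ} {xs : List ℕ} (h : ∀ x ∈ xs, x < 2 ^ b) :
    decode b xs.length (xs.flatMap (toBits b)) = xs := by
  induction xs with
  | nil => rfl
  | cons x xs ih =>
    simp only [List.length_cons, decode, List.flatMap_cons]
    rw [List.take_left' (length_toBits b x), List.drop_left' (length_toBits b x),
      ofBits_toBits (h x (by simp)), ih fun y hy => h y (by simp [hy])]

/-! ### Measurable families of programs -/

/-- In the first `N` rounds, the arms pulled by the programs of the family depend measurably on the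
parameter, the draws and the observations. -/
def MeasUpTo {K : ℕ} [NeZero K] : ∀ (_ : ℕ) {X : Type} [MeasurableSpace X]
    (_ : X → Prog K Unit), Prop
  | 0, _, _, _ => True
  | N + 1, X, _, q => (∀ v, Measurable fun x => (q x).arm v) ∧
      MeasUpTo N fun x : X × Fin K × ℝ × Bool => (q x.1).step x.2.1 x.2.2.1 x.2.2.2

/-- The arms pulled by the programs of the family depend measurably on the parameter, the draws and
the observations. -/
def MeasProg {K : ℕ} [NeZero K] {X : Type} [MeasurableSpace X] (q : X → Prog K Unit) : Prop :=
  ∀ N, MeasUpTo N q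

section MeasProg

variable {K : ℕ} [NeZero K] {X Z : Type} [MeasurableSpace X] [MeasurableSpace Z]

theorem MeasUpTo.comp {N : ℕ} {q : X → Prog K Unit} (h : MeasUpTo N q) {f : Z → X}
    (hf : Measurable f) : MeasUpTo N fun z => q (f z) := by
  induction N generalizing X Z with
  | zero => trivial
  | succ N ih =>
    refine ⟨fun v => (h.1 v).comp hf, ?_⟩
    exact ih h.2 (f := fun z : Z × Fin K × ℝ × Bool => (f z.1, z.2)) (by fun_prop)

theorem MeasProg.comp {q : X → Prog K Unit} (h : MeasProg q) {f : Z → X} (hf : Measurable f) :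
    MeasProg fun z => q (f z) := fun N => (h N).comp hf

theorem MeasProg.step {q : X → Prog K Unit} (h : MeasProg q) {v : X → Fin K} {r : X → ℝ}
    {c : X → Bool} (hv : Measurable v) (hr : Measurable r) (hc : Measurable c) :
    MeasProg fun x => (q x).step (v x) (r x) (c x) := fun N =>
  (h (N + 1)).2.comp (f := fun x => (x, v x, r x, c x)) (by fun_prop)

theorem MeasProg.arm {q : X → Prog K Unit} (h : MeasProg q) {v : X → Fin K} (hv : Measurable v) :
    Measurable fun x => (q x).arm (v x) := by
  have : Measurable fun p : X × Fin K => (q p.1).arm p.2 :=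
    measurable_from_prod_countable_left fun v => (h 1).1 v
  exact this.comp (measurable_id.prodMk hv)

theorem MeasUpTo.ret (N : ℕ) : MeasUpTo (K := K) N fun _ : X => Prog.ret () := by
  induction N generalizing X with
  | zero => trivial
  | succ N ih => exact ⟨fun v => by simp only [Prog.arm]; exact measurable_const, ih⟩

theorem MeasProg.ret : MeasProg (K := K) fun _ : X => Prog.ret () := MeasUpTo.ret

theorem MeasProg.pull (k : Fin K) {g : X → ℝ → Bool → Prog K Unit}
    (h : MeasProg fun x : X × ℝ × Bool => g x.1 x.2.1 x.2.2) :
    MeasProg fun x => Prog.pull k (g x)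
  | 0 => trivial
  | N + 1 => ⟨fun v => by simp only [Prog.arm]; exact measurable_const,
      (h N).comp (f := fun x : X × Fin K × ℝ × Bool => (x.1, x.2.2)) (by fun_prop)⟩

theorem MeasProg.pullUnif {g : X → Fin K → ℝ → Bool → Prog K Unit}
    (h : MeasProg fun x : X × Fin K × ℝ × Bool => g x.1 x.2.1 x.2.2.1 x.2.2.2) :
    MeasProg fun x => Prog.pullUnif (g x)
  | 0 => trivial
  | N + 1 => ⟨fun v => by simp only [Prog.arm]; exact measurable_const, h N⟩

/-- Measurability may be checked on the pieces of a countable measurable partition. -/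
theorem MeasUpTo.of_countable {D : Type} [Countable D] {N : ℕ} {q : X → Prog K Unit}
    (d : X → D) (hd : ∀ i, MeasurableSet {x | d x = i}) (q' : D → X → Prog K Unit)
    (hq : ∀ x, q x = q' (d x) x) (h : ∀ i, MeasUpTo N (q' i)) : MeasUpTo N q := by
  induction N generalizing X with
  | zero => trivial
  | succ N ih =>
    refine ⟨fun v => ?_, ?_⟩
    · refine measurable_to_countable' fun k => ?_
      have : (fun x => (q x).arm v) ⁻¹' {k} =
          ⋃ i, {x | d x = i} ∩ (fun x => (q' i x).arm v) ⁻¹' {k} := by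
        ext x; simp [hq x]
      rw [this]
      exact .iUnion fun i => (hd i).inter (((h i).1 v) (measurableSet_singleton k))
    · refine ih (fun x => d x.1) (fun i => measurable_fst (hd i))
        (fun i x => (q' i x.1).step x.2.1 x.2.2.1 x.2.2.2) (fun x => by rw [hq]) fun i => (h i).2

theorem MeasProg.of_countable {D : Type} [Countable D] {q : X → Prog K Unit}
    (d : X → D) (hd : ∀ i, MeasurableSet {x | d x = i}) (q' : D → X → Prog K Unit)
    (hq : ∀ x, q x = q' (d x) x) (h : ∀ i, MeasProg (q' i)) : MeasProg q := fun N =>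
  .of_countable d hd q' hq fun i => h i N

/-- The observations are indexed by `Fin l.length` so that they live in a product space, where
measurability is available, instead of a type of lists. -/
theorem MeasProg.bind_pullSeq (l : List (Fin K)) {f : X → List (ℝ × Bool) → Prog K Unit}
    (h : MeasProg fun x : X × (Fin l.length → ℝ × Bool) => f x.1 (List.ofFn x.2)) :
    MeasProg fun x => Prog.bind (Prog.pullSeq l) (f x) := by
  induction l generalizing X with
  | nil => exact h.comp (f := fun x => (x, Fin.elim0)) (by fun_prop)
  | cons k l ih =>
    simp only [Prog.pullSeq_cons_bind]
    refine MeasProg.pull k (ih (X := X × ℝ × Bool)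
      (f := fun x obs => f x.1 ((x.2.1, x.2.2) :: obs)) ?_)
    have hm : Measurable fun x : (X × ℝ × Bool) × (Fin l.length → ℝ × Bool) =>
        (x.1.1, (Fin.cons x.1.2 x.2 : Fin (l.length + 1) → ℝ × Bool)) := by
      refine (measurable_fst.comp measurable_fst).prodMk (measurable_pi_lambda _ fun i => ?_)
      refine Fin.cases ?_ (fun i => ?_) i
      · simp only [Fin.cons_zero]; fun_prop
      · simp only [Fin.cons_succ]; fun_prop
    have := h.comp hm
    simpa [List.ofFn_succ] using this

/-- The same for a continuation that depends on the collisions only. -/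
theorem MeasProg.bind_pullSeq_collisions (l : List (Fin K)) {f : X → List Bool → Prog K Unit}
    (h : ∀ c, MeasProg fun x => f x c) :
    MeasProg fun x => Prog.bind (Prog.pullSeq l) fun o => f x (o.map Prod.snd) := by
  refine .bind_pullSeq l (.of_countable (D := Fin l.length → Bool) (fun x i => (x.2 i).2)
    (fun i => ?_) (fun c x => f x.1 (List.ofFn c)) (fun x => ?_) fun c => (h _).comp measurable_fst)
  · exact (measurable_pi_lambda _ fun j => measurable_snd.comp
      ((measurable_pi_apply j).comp measurable_snd)) (measurableSet_singleton i)
  · simp only [List.map_ofFn]; rfl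

/-- The same for a continuation that ignores the observations. -/
theorem MeasProg.bind_pullSeq_const (l : List (Fin K)) {f : X → Prog K Unit}
    (h : MeasProg f) : MeasProg fun x => Prog.bind (Prog.pullSeq l) fun _ => f x :=
  .bind_pullSeq l (h.comp measurable_fst)

theorem MeasProg.bind_musicalChairs (n : ℕ) (o : Option (Fin K))
    {f : Option (Fin K) → Prog K Unit}
    (h : ∀ o, MeasProg fun _ : X => f o) :
    MeasProg fun _ : X => Prog.bind (musicalChairs n o) f := by
  induction n generalizing X o with
  | zero => exact h o
  | succ n ih =>
    have h' : ∀ {X' : Type} [MeasurableSpace X'] (g : X' → X) (_ : Measurable g) (o),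
      MeasProg fun _ : X' => f o := fun g hg o => (h o).comp hg
    cases o with
    | none =>
      simp only [musicalChairs, Prog.bind]
      -- The continuation ignores the reward; it depends on the drawn arm and the collision bit,
      -- hence on finitely many values.
      refine .pullUnif (.of_countable (D := Fin K × Bool) (fun x => (x.2.1, x.2.2.2)) (fun i => ?_)
        (fun d _ => Prog.bind (musicalChairs n (if d.2 then none else some d.1)) f)
        (fun x => rfl) fun d => ih _ (h' _ measurable_fst))
      exact (show Measurable fun x : X × Fin K × ℝ × Bool => (x.2.1, x.2.2.2) by fun_prop)
        (measurableSet_singleton i)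
    | some k =>
      simp only [musicalChairs, Prog.bind]
      exact .pull k (ih _ (h' _ measurable_fst))

end MeasProg

/-! ### Measurability of runs in the draws and rewards -/

section Execution

variable {M K : ℕ}

theorem measurable_collision {X : Type*} [MeasurableSpace X] {a : X → Fin M → Fin K}
    (ha : Measurable a) (m : Fin M) : Measurable fun x => collision (a x) m :=
  (measurable_of_countable fun a : Fin M → Fin K => collision a m).comp ha

theorem measurable_reward {X : Type*} [MeasurableSpace X] {y : X → Fin M → Fin K → ℝ}
    {a : X → Fin M → Fin K} (hy : Measurable y) (ha : Measurable a) (m : Fin M) :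
    Measurable fun x => reward (y x) (a x) m := by
  have : Measurable fun p : (Fin M → Fin K → ℝ) × (Fin M → Fin K) => reward p.1 p.2 m := by
    refine measurable_from_prod_countable_left fun a => ?_
    simp only [reward]
    cases collision a m
    · simp only [Bool.false_eq_true, if_false]; fun_prop
    · simp only [if_true]; exact measurable_const
  exact this.comp (hy.prodMk ha)

variable [NeZero K]

/-- The space of all draws and potential rewards. -/
abbrev Table (M K : ℕ) : Type := (ℕ → Fin M → Fin K) × (ℕ → Fin M → Fin K → ℝ)

theorem MeasProg.remaining {prog : Prog K Unit} (h : MeasProg fun _ : Table M K => prog)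
    (t : ℕ) (m : Fin M) : MeasProg fun x : Table M K => remaining prog x.1 x.2 t m := by
  induction t generalizing m with
  | zero => exact h
  | succ t ih =>
    have ha : Measurable fun x : Table M K => fun n =>
        (_root_.remaining prog x.1 x.2 t n).arm (x.1 t n) :=
      measurable_pi_lambda _ fun n => (ih n).arm (by fun_prop)
    exact (ih m).step (by fun_prop) (measurable_reward (by fun_prop) ha m)
      (measurable_collision ha m)

theorem measurable_armsPulled {prog : Prog K Unit} (h : MeasProg fun _ : Table M K => prog)
    (t : ℕ) : Measurable fun x : Table M K => armsPulled prog x.1 x.2 t :=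
  measurable_pi_lambda _ fun m => (MeasProg.remaining h t m).arm (by fun_prop)

theorem measurable_totalReward {prog : Prog K Unit} (h : MeasProg fun _ : Table M K => prog)
    (T : ℕ) : Measurable fun x : Table M K => totalReward prog T x.1 x.2 :=
  Finset.measurable_sum _ fun t _ => Finset.measurable_sum _ fun m _ =>
    measurable_reward (by fun_prop) (measurable_armsPulled h t) m

end Execution

/-! ### Normal forms of the epochs -/

/-- What the leader decides at the beginning of an epoch: the remaining candidate edges, the candidate
matchings and the matching of maximum estimated utility. -/
abbrev Plan (n K : ℕ) : Type :=
  Finset (Fin (n + 1) × Fin K) × List (Matching (n + 1) K) × Matching (n + 1) K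

open scoped Classical in
/-- The plan that is computed from the matchings `best` and `assoc`. -/
noncomputable def planOf {n K : ℕ} (ε : ℝ) (E : Finset (Fin (n + 1) × Fin K))
    (best : Matching (n + 1) K) (assoc : Fin (n + 1) × Fin K → Matching (n + 1) K)
    (w : Fin (n + 1) → Fin K → ℝ) : Plan n K :=
  let E' := E.filter fun e =>
    ∑ i, (w i (best i) - w i (assoc e i)) ≤ 4 * ((n + 1 : ℕ) : ℝ) * ε
  (E', (E'.image assoc).toList, best)

/-- The plan of epoch `p` with candidate edges `E` and estimates `w`. -/
noncomputable def epochPlan {n K : ℕ} (tie : TieBreak K) (c T : ℕ) (h : n + 1 ≤ K) (p : ℕ)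
    (E : Finset (Fin (n + 1) × Fin K)) (w : Fin (n + 1) → Fin K → ℝ) : Plan n K :=
  planOf (epsilon c (n + 1) K T p) E (argmaxMatching tie h w fun _ => True)
    (fun e => argmaxMatching tie h w fun π => π e.1 = e.2) w

/-- The arms pulled by the leader to send the number of candidate matchings. -/
def sizeSignal {n K : ℕ} (d : Plan n K) (comm : Fin (n + 1) → Fin K) : List (Fin K) :=
  (List.finRange n).flatMap fun i =>
    signal (comm 0) (comm i.succ) (sizeBits (n + 1) K) [d.2.1.length]

/-- The numbers sent by the leader to follower `i`. -/
def planMessage {n K : ℕ} (d : Plan n K) (i : Fin n) : List ℕ :=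
  d.2.1.map (fun π => (π i.succ).val) ++ [(d.2.2 0).val, (d.2.2 i.succ).val]

/-- The arms pulled by the leader to send the candidate matchings. -/
def planSignal {n K : ℕ} (d : Plan n K) (comm : Fin (n + 1) → Fin K) : List (Fin K) :=
  (List.finRange n).flatMap fun i => signal (comm 0) (comm i.succ) (armBits K) (planMessage d i)

/-- The arms pulled by player `i` during the exploration. -/
def exploreArms {n K : ℕ} (c p : ℕ) (C : List (Matching (n + 1) K)) (i : Fin (n + 1)) :
    List (Fin K) :=
  C.flatMap fun π => List.replicate (2 ^ p ^ c) (π i)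

/-- The estimates of the leader after receiving the list `xs`. -/
noncomputable def newEstimates {n K : ℕ} (c p : ℕ) (arms : List (Fin K)) (obs : List (ℝ × Bool))
    (xs : List ℕ) : Fin (n + 1) → Fin K → ℝ :=
  Fin.cons (empiricalMean arms obs)
    fun i k => (xs.getD (i.val * K + k.val) 0 : ℝ) / 2 ^ meanBits c p

section

variable {K : ℕ} [NeZero K]

/-- The real-valued estimates enter the announcements only through the plan `d`, an element of a
countable type. This form serves both measurability and execution. -/
theorem leaderEpochs_exploit (tie : TieBreak K) (c T : ℕ) {n : ℕ} (h : n + 1 ≤ K) (fuel p : ℕ)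
    (E : Finset (Fin (n + 1) × Fin K)) (w : Fin (n + 1) → Fin K → ℝ) (comm : Fin (n + 1) → Fin K)
    {d : Plan n K} (hd : epochPlan tie c T h p E w = d) {π : Matching (n + 1) K}
    (hC : d.2.1 = [π]) :
    leaderEpochs tie c T h (fuel + 1) p E w comm =
      Prog.bind (Prog.pullSeq (sizeSignal d comm)) fun _ =>
      Prog.bind (Prog.pullSeq (planSignal d comm)) fun _ =>
      Prog.bind (Prog.pullSeq (List.replicate T (π 0))) fun _ => Prog.ret () := by
  subst hd
  rw [leaderEpochs]
  change Prog.bind (Prog.pullSeq (sizeSignal (epochPlan tie c T h p E w) comm)) (fun _ =>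
      Prog.bind (Prog.pullSeq (planSignal (epochPlan tie c T h p E w) comm)) fun _ => _) = _
  congr 1; funext _; congr 1; funext _
  change (match (epochPlan tie c T h p E w).2.1 with
    | [π] => idle (π 0) T
    | _ => _) = _
  rw [hC]
  rfl

/-- The condition is `≠ 1` because an empty list of candidates would be explored as well; this never
happens when the estimates are accurate. -/
theorem leaderEpochs_explore (tie : TieBreak K) (c T : ℕ) {n : ℕ} (h : n + 1 ≤ K) (fuel p : ℕ)
    (E : Finset (Fin (n + 1) × Fin K)) (w : Fin (n + 1) → Fin K → ℝ) (comm : Fin (n + 1) → Fin K)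
    {d : Plan n K} (hd : epochPlan tie c T h p E w = d) (hC : d.2.1.length ≠ 1) :
    leaderEpochs tie c T h (fuel + 1) p E w comm =
      Prog.bind (Prog.pullSeq (sizeSignal d comm)) fun _ =>
      Prog.bind (Prog.pullSeq (planSignal d comm)) fun _ =>
      Prog.bind (Prog.pullSeq (exploreArms c p d.2.1 0)) fun obs =>
      Prog.bind (Prog.pullSeq (List.replicate (n * K * meanBits c p) (d.2.2 0))) fun o =>
      leaderEpochs tie c T h fuel (p + 1) d.1
        (newEstimates c p (exploreArms c p d.2.1 0) obs
          (decode (meanBits c p) (n * K) (o.map Prod.snd))) d.2.2 := by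
  subst hd
  rw [leaderEpochs]
  change Prog.bind (Prog.pullSeq (sizeSignal (epochPlan tie c T h p E w) comm)) (fun _ =>
      Prog.bind (Prog.pullSeq (planSignal (epochPlan tie c T h p E w) comm)) fun _ => _) = _
  congr 1; funext _; congr 1; funext _
  change (match (epochPlan tie c T h p E w).2.1 with
    | [π] => idle (π 0) T
    | _ => Prog.bind (Prog.pullSeq (exploreArms c p (epochPlan tie c T h p E w).2.1 0)) fun obs =>
      Prog.bind (receive ((epochPlan tie c T h p E w).2.2 0) (meanBits c p) (n * K)) fun xs =>
      leaderEpochs tie c T h fuel (p + 1) (epochPlan tie c T h p E w).1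
        (newEstimates c p (exploreArms c p (epochPlan tie c T h p E w).2.1 0) obs xs)
          (epochPlan tie c T h p E w).2.2) = _
  split
  · next hπ => rw [hπ] at hC; simp at hC
  · congr 1; funext obs
    rw [receive_bind]

omit [NeZero K] in
/-- A player who stays on her arm, receives numbers, and stays on her arm again. -/
theorem idle_receive_idle_bind {β : Type} (own : Fin K) (a b N e : ℕ) (f : List ℕ → Prog K β) :
    (Prog.bind (idle own a) fun _ => Prog.bind (receive own b N) fun xs =>
      Prog.bind (idle own e) fun _ => f xs) =
    Prog.bind (Prog.pullSeq (List.replicate (a + (N * b + e)) own)) fun o =>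
      f (decode b N (((o.map Prod.snd).drop a).take (N * b))) := by
  simp only [idle_bind, receive_bind]
  simp_rw [Prog.pullSeq_append_bind
    (f := fun o₁ _ => f (decode b N (o₁.map Prod.snd)))]
  rw [Prog.pullSeq_append_bind (l₁ := List.replicate a own)
    (f := fun _ o => f (decode b N ((o.take (List.replicate (N * b) own).length).map Prod.snd)))]
  simp only [List.replicate_append_replicate, List.length_replicate, List.map_take, List.map_drop]

/-- The numbers received by the follower of rank `R`. -/
def heard (R b N : ℕ) (o : List Bool) : List ℕ :=
  decode b N ((o.drop ((R - 2) * (N * b))).take (N * b))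

/-- The arms pulled by the follower of rank `R` to send her means. -/
noncomputable def meanSignal (c p R M : ℕ) (own lead : Fin K) (arms : List (Fin K))
    (obs : List (ℝ × Bool)) : List (Fin K) :=
  List.replicate ((R - 2) * (K * meanBits c p)) own ++
    (signal own lead (meanBits c p)
      ((List.finRange K).map fun k => truncate (meanBits c p) (empiricalMean arms obs k)) ++
    List.replicate ((M - R) * (K * meanBits c p)) own)

/-- The end of an epoch of a follower who has received the plan of the leader. -/
noncomputable def followerAfterPlan (c T R M fuel p size : ℕ) (xs : List ℕ) : Prog K Unit :=
  let msg : List (Fin K) := xs.map (Fin.ofNat K)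
  if size = 1 then
    Prog.bind (Prog.pullSeq (List.replicate T (msg.getD 0 0))) fun _ => Prog.ret ()
  else
    let arms := (msg.take size).flatMap fun k => List.replicate (2 ^ p ^ c) k
    Prog.bind (Prog.pullSeq arms) fun obs =>
    Prog.bind (Prog.pullSeq
      (meanSignal c p R M (msg.getD (size + 1) 0) (msg.getD size 0) arms obs)) fun _ =>
    followerEpochs c T R M fuel (p + 1) (msg.getD (size + 1) 0)

/-- Idling during the messages of others and receiving one's own are the same pulls. Fused, they
take a number of rounds that does not depend on the rank (`idle_length`), which keeps the players in
step. -/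
theorem followerEpochs_succ (c T R M fuel p : ℕ) (own : Fin K) :
    followerEpochs c T R M (fuel + 1) p own =
      Prog.bind (Prog.pullSeq (List.replicate ((R - 2) * sizeBits M K + (1 * sizeBits M K +
        (M - R) * sizeBits M K)) own)) fun o =>
      let size := (heard R (sizeBits M K) 1 (o.map Prod.snd)).getD 0 0
      Prog.bind (Prog.pullSeq (List.replicate ((R - 2) * ((size + 2) * armBits K) +
        ((size + 2) * armBits K + (M - R) * ((size + 2) * armBits K))) own)) fun o =>
      followerAfterPlan c T R M fuel p size (heard R (armBits K) (size + 2) (o.map Prod.snd)) := by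
  rw [followerEpochs]
  simp only [Prog.bind_eq]
  rw [idle_receive_idle_bind]
  simp only [heard, one_mul]
  congr 1; funext o
  rw [idle_receive_idle_bind]
  congr 1; funext o
  simp only [followerAfterPlan]
  split_ifs
  · rfl
  · congr 1; funext obs
    simp only [idle_bind, meanSignal]
    rw [← Prog.pullSeq_append_bind (l₁ := List.replicate _ _) (f := fun _ _ => followerEpochs ..)]
    congr 1; funext _
    rw [← Prog.pullSeq_append_bind (f := fun _ _ => followerEpochs ..)]

/-! ### Measurability of the algorithm -/

/-! ### Measurability of the leader's decisions -/

section plan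

variable {n : ℕ}

omit [NeZero K] in
-- The tie-breaking rule is arbitrary, but it only sees the set of maximizers, and this set takes
-- finitely many values, each on a measurable set of weights.
theorem measurableSet_argmaxMatching (tie : TieBreak K) {n : ℕ} (h : n ≤ K)
    (p : Matching n K → Prop) (π : Matching n K) :
    MeasurableSet {w : Fin n → Fin K → ℝ | argmaxMatching tie h w p = π} := by
  classical
  have hu : ∀ σ : Matching n K, Measurable fun w : Fin n → Fin K → ℝ => utility w σ := by
    intro σ; unfold utility; fun_prop
  let S : (Fin n → Fin K → ℝ) → Finset (Matching n K) := fun w =>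
    Finset.univ.filter fun π => p π ∧ ∀ σ, p σ → utility w σ ≤ utility w π
  have hS : ∀ A, MeasurableSet {w | S w = A} := by
    intro A
    have : {w | S w = A} = ⋂ π, {w | (p π ∧ ∀ σ, p σ → utility w σ ≤ utility w π) ↔ π ∈ A} := by
      ext w; simp [S, Finset.ext_iff]
    rw [this]
    refine .iInter fun π => ?_
    refine measurableSet_setOfPred.2 (.iff (.and measurable_const (.forall fun σ =>
      .imp measurable_const (measurableSet_setOfPred.1 ?_))) measurable_const)
    exact measurableSet_le (hu σ) (hu π)
  have : {w : Fin n → Fin K → ℝ | argmaxMatching tie h w p = π} =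
      ⋃ A : Finset (Matching n K), {w | S w = A} ∩ {_w | tie n h A = π} := by
    ext w
    simp only [Set.mem_ofPred_eq, Set.mem_iUnion, Set.mem_inter_iff, exists_eq_left']
    unfold argmaxMatching
    convert Iff.rfl
  rw [this]
  exact .iUnion fun A => (hS A).inter (.const _)

omit [NeZero K] in
theorem measurableSet_planOf (ε : ℝ) (E : Finset (Fin (n + 1) × Fin K))
    (best : Matching (n + 1) K) (assoc : Fin (n + 1) × Fin K → Matching (n + 1) K) (d : Plan n K) :
    MeasurableSet {w : Fin (n + 1) → Fin K → ℝ | planOf ε E best assoc w = d} := by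
  classical
  have hE : ∀ A : Finset (Fin (n + 1) × Fin K), MeasurableSet {w : Fin (n + 1) → Fin K → ℝ |
      (E.filter fun e => ∑ i, (w i (best i) - w i (assoc e i)) ≤ 4 * ((n + 1 : ℕ) : ℝ) * ε) =
        A} := by
    intro A
    simp only [Finset.ext_iff, Finset.mem_filter]
    refine measurableSet_setOfPred.2 (.forall fun e =>
      .iff (.and measurable_const (measurableSet_setOfPred.1 ?_)) measurable_const)
    exact measurableSet_le (by fun_prop) measurable_const
  have : {w : Fin (n + 1) → Fin K → ℝ | planOf ε E best assoc w = d} =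
      ⋃ A : Finset (Fin (n + 1) × Fin K), {w : Fin (n + 1) → Fin K → ℝ |
      (E.filter fun e => ∑ i, (w i (best i) - w i (assoc e i)) ≤ 4 * ((n + 1 : ℕ) : ℝ) * ε) =
        A} ∩ {_w | (A, (A.image assoc).toList, best) = d} := by
    ext w
    simp only [Set.mem_ofPred_eq, Set.mem_iUnion, Set.mem_inter_iff, exists_eq_left']
    unfold planOf
    convert Iff.rfl
  rw [this]
  exact .iUnion fun A => (hE A).inter (.const _)

omit [NeZero K] in
-- With the finitely many possible maximizers frozen, the plan is decided by linear inequalities in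
-- the estimates.
theorem measurableSet_epochPlan (tie : TieBreak K) (c T : ℕ) (h : n + 1 ≤ K) (p : ℕ)
    (E : Finset (Fin (n + 1) × Fin K)) (d : Plan n K) :
    MeasurableSet {w | epochPlan tie c T h p E w = d} := by
  have : {w | epochPlan tie c T h p E w = d} =
      ⋃ best, ⋃ assoc : Fin (n + 1) × Fin K → Matching (n + 1) K,
        {w | argmaxMatching tie h w (fun _ => True) = best} ∩
        (⋂ e, {w | argmaxMatching tie h w (fun π => π e.1 = e.2) = assoc e}) ∩
        {w | planOf (epsilon c (n + 1) K T p) E best assoc w = d} := by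
    ext w
    simp only [Set.mem_ofPred_eq, Set.mem_iUnion, Set.mem_inter_iff, Set.mem_iInter]
    constructor
    · exact fun hw => ⟨_, _, ⟨rfl, fun _ => rfl⟩, hw⟩
    · rintro ⟨b, a, ⟨rfl, ha⟩, rfl⟩
      obtain rfl := funext ha
      rfl
  rw [this]
  exact .iUnion fun b => .iUnion fun a => ((measurableSet_argmaxMatching ..).inter
    (.iInter fun e => measurableSet_argmaxMatching ..)).inter (measurableSet_planOf ..)

end plan

omit [NeZero K] in
-- A sum indexed by rounds replaces the filtered list; measurability and the link with Hoeffding's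
-- inequality are read off from it.
theorem empiricalMean_ofFn (arms : List (Fin K)) (o : Fin arms.length → ℝ × Bool) (k : Fin K) :
    empiricalMean arms (List.ofFn o) k =
      if arms.count k = 0 then 0
      else (∑ j : Fin arms.length, if arms[j] = k then (o j).1 else 0) / arms.count k := by
  have h1 : ∀ (arms : List (Fin K)) (o : Fin arms.length → ℝ × Bool),
      (((arms.zip (List.ofFn o)).filter fun o => o.1 = k).map fun o => o.2.1).length =
        arms.count k := by
    intro arms
    induction arms with
    | nil => intro o; rfl
    | cons a arms ih =>
      intro o
      have := ih fun j => o j.succ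
      simp only [List.length_map] at this ⊢
      rw [List.ofFn_succ, List.zip_cons_cons, List.filter_cons, List.count_cons]
      by_cases ha : a = k <;> simp [ha, this]
  have h2 : ∀ (arms : List (Fin K)) (o : Fin arms.length → ℝ × Bool),
      (((arms.zip (List.ofFn o)).filter fun o => o.1 = k).map fun o => o.2.1).sum =
        ∑ j : Fin arms.length, if arms[j] = k then (o j).1 else 0 := by
    intro arms
    induction arms with
    | nil => intro o; rfl
    | cons a arms ih =>
      intro o
      have := ih fun j => o j.succ
      rw [List.ofFn_succ, List.zip_cons_cons, List.filter_cons]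
      refine Eq.trans ?_ (Fin.sum_univ_succ (n := arms.length) _).symm
      by_cases ha : a = k <;> simpa [ha] using this
  simp only [empiricalMean, h1, h2]

omit [NeZero K] in
theorem measurable_empiricalMean (arms : List (Fin K)) (k : Fin K) :
    Measurable fun o : Fin arms.length → ℝ × Bool => empiricalMean arms (List.ofFn o) k := by
  simp only [empiricalMean_ofFn]
  split_ifs
  · exact measurable_const
  · refine Measurable.div_const (Finset.measurable_sum _ fun j _ => ?_) _
    split_ifs <;> fun_prop

theorem measurable_truncate (b : ℕ) : Measurable (truncate b) :=
  (measurable_of_countable fun x : ℕ => min x (2 ^ b - 1)).comp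
    (Nat.measurable_floor.comp (measurable_const.mul measurable_id))

omit [NeZero K] in
theorem measurable_newEstimates {n : ℕ} (c p : ℕ) (arms : List (Fin K)) (xs : List ℕ) :
    Measurable fun o : Fin arms.length → ℝ × Bool =>
      (newEstimates c p arms (List.ofFn o) xs : Fin (n + 1) → Fin K → ℝ) := by
  refine measurable_pi_lambda _ fun i => measurable_pi_lambda _ fun k => ?_
  refine Fin.cases ?_ (fun i => ?_) i
  · simpa only [newEstimates, Fin.cons_zero] using measurable_empiricalMean arms k
  · simp only [newEstimates, Fin.cons_succ]; exact measurable_const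

theorem MeasProg.leaderEpochs (tie : TieBreak K) (c T : ℕ) {n : ℕ} (h : n + 1 ≤ K) (fuel p : ℕ)
    (E : Finset (Fin (n + 1) × Fin K)) (comm : Fin (n + 1) → Fin K) {X : Type} [MeasurableSpace X]
    {w : X → Fin (n + 1) → Fin K → ℝ} (hw : Measurable w) :
    MeasProg fun x => leaderEpochs tie c T h fuel p E (w x) comm := by
  induction fuel generalizing p E comm X with
  | zero => exact .ret
  | succ fuel ih =>
    -- Once the plan is fixed, nothing before the exploration depends on `x`; real-valued data come
    -- back only through the new estimates, to which the induction hypothesis applies with a larger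
    -- parameter space.
    let q' : Plan n K → X → Prog K Unit := fun d _ =>
      match d.2.1 with
      | [π] => Prog.bind (Prog.pullSeq (sizeSignal d comm)) fun _ =>
          Prog.bind (Prog.pullSeq (planSignal d comm)) fun _ =>
          Prog.bind (Prog.pullSeq (List.replicate T (π 0))) fun _ => Prog.ret ()
      | _ => Prog.bind (Prog.pullSeq (sizeSignal d comm)) fun _ =>
          Prog.bind (Prog.pullSeq (planSignal d comm)) fun _ =>
          Prog.bind (Prog.pullSeq (exploreArms c p d.2.1 0)) fun obs =>
          Prog.bind (Prog.pullSeq (List.replicate (n * K * meanBits c p) (d.2.2 0))) fun o =>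
          _root_.leaderEpochs tie c T h fuel (p + 1) d.1
            (newEstimates c p (exploreArms c p d.2.1 0) obs
              (decode (meanBits c p) (n * K) (o.map Prod.snd))) d.2.2
    refine .of_countable (fun x => epochPlan tie c T h p E (w x))
      (fun d => hw (measurableSet_epochPlan tie c T h p E d)) q' (fun x => ?_) fun d => ?_
    · simp only [q']
      split
      · next hd => exact leaderEpochs_exploit tie c T h fuel p E (w x) comm rfl hd
      · next hd => exact leaderEpochs_explore tie c T h fuel p E (w x) comm rfl fun h1 =>
          (List.length_eq_one_iff.1 h1).elim hd
    · simp only [q']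
      split
      · exact .bind_pullSeq_const _ (.bind_pullSeq_const _ (.bind_pullSeq_const _ .ret))
      · refine .bind_pullSeq_const _ (.bind_pullSeq_const _ (.bind_pullSeq _ ?_))
        refine .bind_pullSeq_collisions _ (X := X × (Fin _ → ℝ × Bool)) (f := fun x o => _root_.leaderEpochs tie c T h fuel
          (p + 1) d.1 (newEstimates c p (exploreArms c p d.2.1 0) (List.ofFn x.2)
            (decode (meanBits c p) (n * K) o)) d.2.2) fun o => ih _ _ _ ?_
        exact (measurable_newEstimates c p _ _).comp measurable_snd

theorem MeasProg.followerEpochs (c T R M : ℕ) (fuel p : ℕ) (own : Fin K) {X : Type}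
    [MeasurableSpace X] : MeasProg fun _ : X => followerEpochs c T R M fuel p own := by
  induction fuel generalizing p own X with
  | zero => exact .ret
  | succ fuel ih =>
    simp only [followerEpochs_succ]
    refine .bind_pullSeq_collisions _ (f := fun _ o => Prog.bind (Prog.pullSeq (List.replicate
      ((R - 2) * (((heard R (sizeBits M K) 1 o).getD 0 0 + 2) * armBits K) +
        (((heard R (sizeBits M K) 1 o).getD 0 0 + 2) * armBits K +
        (M - R) * (((heard R (sizeBits M K) 1 o).getD 0 0 + 2) * armBits K))) own)) fun o' =>
      followerAfterPlan c T R M fuel p ((heard R (sizeBits M K) 1 o).getD 0 0)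
        (heard R (armBits K) ((heard R (sizeBits M K) 1 o).getD 0 0 + 2) (o'.map Prod.snd)))
      fun o => ?_
    generalize (heard R (sizeBits M K) 1 o).getD 0 0 = size
    refine .bind_pullSeq_collisions _ (f := fun _ o' => followerAfterPlan c T R M fuel p size
      (heard R (armBits K) (size + 2) o')) fun o' => ?_
    generalize heard R (armBits K) (size + 2) o' = xs
    simp only [followerAfterPlan]
    split_ifs
    · exact .bind_pullSeq_const _ .ret
    · generalize ((List.map (Fin.ofNat K) xs).take size).flatMap
        (fun k => List.replicate (2 ^ p ^ c) k) = arms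
      refine MeasProg.bind_pullSeq (X := X) arms (f := fun _ obs => Prog.bind (Prog.pullSeq
        (meanSignal c p R M ((List.map (Fin.ofNat K) xs).getD (size + 1) 0)
          ((List.map (Fin.ofNat K) xs).getD size 0) arms obs)) fun _ =>
        _root_.followerEpochs c T R M fuel (p + 1)
          ((List.map (Fin.ofNat K) xs).getD (size + 1) 0)) ?_
      -- The rewards seen by a follower influence her later pulls only through her truncated means,
      -- which take countably many values.
      refine .of_countable (D := Fin K → ℕ)
        (fun (x : X × (Fin arms.length → ℝ × Bool)) k => truncate (meanBits c p) (empiricalMean arms (List.ofFn x.2) k)) (fun i => ?_)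
        (fun f _ => Prog.bind (Prog.pullSeq (List.replicate ((R - 2) * (K * meanBits c p))
          ((List.map (Fin.ofNat K) xs).getD (size + 1) 0) ++
          (signal ((List.map (Fin.ofNat K) xs).getD (size + 1) 0)
            ((List.map (Fin.ofNat K) xs).getD size 0) (meanBits c p)
            ((List.finRange K).map f) ++ List.replicate ((M - R) * (K * meanBits c p))
              ((List.map (Fin.ofNat K) xs).getD (size + 1) 0)))) fun _ =>
          _root_.followerEpochs c T R M fuel (p + 1) ((List.map (Fin.ofNat K) xs).getD (size + 1) 0))
        (fun x => rfl) fun f => .bind_pullSeq_const _ (ih _ _)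
      have : Measurable fun x : X × (Fin arms.length → ℝ × Bool) => fun k : Fin K =>
          truncate (meanBits c p) (empiricalMean arms (List.ofFn x.2) k) :=
        measurable_pi_lambda _ fun k => (measurable_truncate _).comp
          ((measurable_empiricalMean arms k).comp measurable_snd)
      exact this (measurableSet_singleton i)

/-- What a player does after the initialization. -/
noncomputable def afterInit (tie : TieBreak K) (c T R : ℕ) : ℕ → Prog K Unit
  | 0 => Prog.ret ()
  | n + 1 =>
      if R = 1 then
        if h : n + 1 ≤ K then
          leaderEpochs tie c T h T 1 Finset.univ (fun _ _ => 0) (Fin.castLE h)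
        else Prog.ret ()
      else followerEpochs c T R (n + 1) T 1 (Fin.ofNat K (R - 1))

theorem MeasProg.afterInit (tie : TieBreak K) (c T R M : ℕ) {X : Type} [MeasurableSpace X] :
    MeasProg fun _ : X => afterInit tie c T R M := by
  cases M with
  | zero => exact .ret
  | succ n =>
    simp only [_root_.afterInit]
    split_ifs with h1 h2
    · exact MeasProg.leaderEpochs (X := X) tie c T h2 T 1 _ _ measurable_const
    · exact .ret
    · exact MeasProg.followerEpochs c T R (n + 1) T 1 (Fin.ofNat K (R - 1))

/-- The number of rounds of musical chairs. -/
noncomputable def chairRounds (K T : ℕ) : ℕ :=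
  ⌈(K : ℝ) * Real.log (K / (1 / ((K : ℝ) * T)))⌉₊

/-- The arms pulled during sequential hopping. -/
def hopArms (k : Fin K) : List (Fin K) :=
  List.replicate (2 * k.val) k ++ (((List.finRange K).filter fun i => k < i) ++
    List.replicate (K - 1 - k.val) (0 : Fin K))

/-- Number of arms above `k`. -/
def armsAbove (k : Fin K) : ℕ := ((List.finRange K).filter fun i => k < i).length

/-- The three parts of sequential hopping become one sequence, whose length is the same for every
starting arm (`length_hopArms`); the parts survive as segments in which collisions are counted. -/
theorem metcElim_eq (tie : TieBreak K) (c T : ℕ) :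
    metcElim K tie c T = Prog.bind (musicalChairs (chairRounds K T) none) fun k =>
      Prog.bind (Prog.pullSeq (hopArms (k.getD 0))) fun o =>
        afterInit tie c T (1 + numCollisions (o.take (2 * (k.getD 0).val)))
          (1 + numCollisions (o.take (2 * (k.getD 0).val)) +
            numCollisions ((o.drop (2 * (k.getD 0).val)).take (armsAbove (k.getD 0)))) := by
  have h : metcElim K tie c T = Prog.bind (init K (1 / ((K : ℝ) * T)))
      fun RM => afterInit tie c T RM.1 RM.2 := by
    unfold metcElim
    rw [Prog.bind_eq]
    congr 1
  rw [h, init, Prog.bind_eq, Prog.bind_assoc]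
  congr 1; funext k
  generalize k.getD 0 = k
  simp only [hopping, Prog.bind_eq, Prog.pure_eq, Prog.bind_assoc, Prog.ret_bind, hopArms]
  simp_rw [fun a => Prog.pullSeq_append_bind ((List.finRange K).filter fun i => k < i)
    (List.replicate (K - 1 - k.val) (0 : Fin K))
    (fun o₁ _ => afterInit tie c T (1 + a) (1 + a + numCollisions o₁))]
  rw [Prog.pullSeq_append_bind (l₁ := List.replicate (2 * k.val) k)
    (f := fun o₁ o₂ => afterInit tie c T (1 + numCollisions o₁) (1 + numCollisions o₁ +
      numCollisions (o₂.take ((List.finRange K).filter fun i => k < i).length)))]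
  simp only [List.length_replicate, armsAbove]

theorem MeasProg.metcElim (tie : TieBreak K) (c T : ℕ) {X : Type} [MeasurableSpace X] :
    MeasProg fun _ : X => metcElim K tie c T := by
  simp only [metcElim_eq]
  refine .bind_musicalChairs _ _ fun k => ?_
  refine .bind_pullSeq _ (.of_countable (D := (Fin (hopArms (k.getD 0)).length → Bool))
    (fun x i => (x.2 i).2)
    (fun i => ?_) (fun c' _ => (_root_.afterInit tie c T
      (1 + (((List.ofFn c').take (2 * (k.getD 0).val)).countP id))
      (1 + (((List.ofFn c').take (2 * (k.getD 0).val)).countP id) +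
        ((((List.ofFn c').drop (2 * (k.getD 0).val)).take (armsAbove (k.getD 0))).countP id))))
      (fun x => ?_) fun c' => .afterInit tie c T _ _)
  · exact (measurable_pi_lambda _ fun j => measurable_snd.comp
      ((measurable_pi_apply j).comp measurable_snd)) (measurableSet_singleton i)
  · have : ∀ l : List (ℝ × Bool), numCollisions l = (l.map Prod.snd).countP id := by
      intro l; rw [List.countP_map]; rfl
    simp only [this, List.map_take, List.map_drop, List.map_ofFn]
    rfl

end

/-! ### Independent rounds -/

/-- A random table of potential rewards in `[0, 1]` with independent rows of mean `μ`. -/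
structure IndepRows {Ω : Type*} [MeasurableSpace Ω] {M K : ℕ} (P : Measure Ω)
    (μ : Fin M → Fin K → ℝ) (Z : Ω → ℕ → Fin M → Fin K → ℝ) : Prop where
  measurable : Measurable Z
  mem : ∀ ω t m k, Z ω t m k ∈ Set.Icc (0 : ℝ) 1
  mean : ∀ t m k, ∫ ω, Z ω t m k ∂P = μ m k
  indep : iIndepFun (fun t ω => Z ω t) P

namespace IndepRows

variable {Ω : Type*} [MeasurableSpace Ω] {M K : ℕ} {P : Measure Ω} [IsProbabilityMeasure P]
  {μ : Fin M → Fin K → ℝ} {Z : Ω → ℕ → Fin M → Fin K → ℝ}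

omit [IsProbabilityMeasure P] in
theorem measurable_entry (h : IndepRows P μ Z) (t : ℕ) (m : Fin M) (k : Fin K) :
    Measurable fun ω => Z ω t m k := by
  have := h.measurable
  fun_prop

theorem integrable_entry (h : IndepRows P μ Z) (t : ℕ) (m : Fin M) (k : Fin K) :
    Integrable (fun ω => Z ω t m k) P :=
  Integrable.of_mem_Icc 0 1 (h.measurable_entry t m k).aemeasurable (.of_forall fun ω => h.mem ω t m k)

theorem mean_mem (h : IndepRows P μ Z) (m : Fin M) (k : Fin K) : μ m k ∈ Set.Icc (0 : ℝ) 1 := by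
  rw [← h.mean 0 m k]
  refine ⟨integral_nonneg fun ω => (h.mem ω 0 m k).1, ?_⟩
  calc ∫ ω, Z ω 0 m k ∂P ≤ ∫ _, (1 : ℝ) ∂P :=
        integral_mono (h.integrable_entry 0 m k) (integrable_const 1) fun ω => (h.mem ω 0 m k).2
    _ = 1 := by simp

omit [IsProbabilityMeasure P] in
/-- Relabelling the players. -/
theorem relabel (h : IndepRows P μ Z) (ρ : Fin M ≃ Fin M) :
    IndepRows P (fun i => μ (ρ.symm i)) fun ω t i => Z ω t (ρ.symm i) where
  measurable := by
    have := h.measurable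
    fun_prop
  mem ω t i k := h.mem ω t _ k
  mean t i k := h.mean t _ k
  indep := h.indep.comp (fun _ z i => z (ρ.symm i)) fun _ => by fun_prop

omit [IsProbabilityMeasure P] in
/-- What is determined by the rounds before `s` is independent of the following rounds. -/
theorem indepFun_past_future (h : IndepRows P μ Z) {α β : Type*} [MeasurableSpace α]
    [MeasurableSpace β] (s N : ℕ) {f : (ℕ → Fin M → Fin K → ℝ) → α} (hf : Measurable f)
    (hdep : ∀ z z', (∀ t < s, z t = z' t) → f z = f z')
    {g : (ℕ → Fin M → Fin K → ℝ) → β} (hg : Measurable g)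
    (hdepg : ∀ z z', (∀ t, s ≤ t → t < s + N → z t = z' t) → g z = g z') :
    IndepFun (fun ω => f (Z ω)) (fun ω => g (Z ω)) P := by
  classical
  have hdisj : Disjoint (Finset.range s) (Finset.Ico s (s + N)) := by
    rw [Finset.disjoint_left]; intro a ha hb; simp at ha hb; omega
  have key := h.indep.indepFun_finset _ _ hdisj fun t => by
    have := h.measurable; fun_prop
  -- Independence is available for the restrictions to two disjoint finite sets of rounds. Extension
  -- by zero evaluates `f` and `g` on restrictions, without effect by `hdep` and `hdepg`.
  let ext (S : Finset ℕ) (x : S → Fin M → Fin K → ℝ) : ℕ → Fin M → Fin K → ℝ :=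
    fun t => if ht : t ∈ S then x ⟨t, ht⟩ else 0
  have hext : ∀ S, Measurable (ext S) := fun S => measurable_pi_lambda _ fun t => by
    simp only [ext]; split_ifs
    · fun_prop
    · exact measurable_const
  have := key.comp (hf.comp (hext _)) (hg.comp (hext _))
  refine this.congr (.of_forall fun ω => ?_) (.of_forall fun ω => ?_)
  · refine hdep _ _ fun t ht => ?_
    simp [ext, ht]
  · refine hdepg _ _ fun t ht ht' => ?_
    simp [ext, ht, ht']

/-- **Hoeffding's inequality**, two-sided, for the mean over a set of rounds. -/
theorem hoeffding (h : IndepRows P μ Z) (m : Fin M) (k : Fin K) (S : Finset ℕ) (hS : S.Nonempty)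
    {ε : ℝ} (hε : 0 ≤ ε) :
    P.real {ω | ε < |(∑ t ∈ S, Z ω t m k) / S.card - μ m k|} ≤
      2 * Real.exp (-(2 * S.card * ε ^ 2)) := by
  have hn : (0 : ℝ) < S.card := by exact_mod_cast hS.card_pos
  have hind : iIndepFun (fun t ω => Z ω t m k - μ m k) P :=
    h.indep.comp (fun _ z => z m k - μ m k) fun _ => by fun_prop
  -- A variable with values in `[0, 1]` has variance proxy `1/4`, whence the exponent `2 |S| ε²`.
  have hsub : ∀ t ∈ S, HasSubgaussianMGF (fun ω => Z ω t m k - μ m k) ((‖(1 : ℝ) - 0‖₊ / 2) ^ 2) P := by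
    intro t _
    have := hasSubgaussianMGF_of_mem_Icc (μ := P) (h.measurable_entry t m k).aemeasurable
      (.of_forall fun ω => h.mem ω t m k)
    rwa [h.mean] at this
  have hind' : iIndepFun (fun t => -fun ω => Z ω t m k - μ m k) P :=
    hind.comp (fun _ x => -x) fun _ => measurable_neg
  have h1 := HasSubgaussianMGF.measure_sum_ge_le_of_iIndepFun hind hsub
    (ε := S.card * ε) (by positivity)
  have h2 := HasSubgaussianMGF.measure_sum_ge_le_of_iIndepFun hind' (fun t ht => (hsub t ht).neg)
    (ε := S.card * ε) (by positivity)
  have hexp : -((S.card : ℝ) * ε) ^ 2 / (2 * ((∑ _t ∈ S, (‖(1 : ℝ) - 0‖₊ / 2) ^ 2 : NNReal) : ℝ)) =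
      -(2 * S.card * ε ^ 2) := by
    simp
    field_simp
  rw [hexp] at h1 h2
  rw [two_mul]
  refine le_trans ?_ (add_le_add h1 h2)
  refine le_trans (measureReal_mono ?_) (measureReal_union_le _ _)
  intro ω hω
  simp only [Set.mem_ofPred_eq, Set.mem_union, Pi.neg_apply, Finset.sum_neg_distrib] at hω ⊢
  have he : ∑ t ∈ S, (Z ω t m k - μ m k) = S.card * ((∑ t ∈ S, Z ω t m k) / S.card - μ m k) := by
    rw [Finset.sum_sub_distrib, Finset.sum_const, nsmul_eq_mul]; field_simp
  rw [he]
  rcases lt_abs.1 hω with h' | h'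
  · left; gcongr
  · right; rw [← mul_neg]; gcongr

end IndepRows

/-! ### The reward of a program is the sum of the means of the arms that it pulls -/

/-- Causality of the execution; with independent rounds it makes the arms of round `t` independent
of the rewards of round `t`. -/
theorem remaining_congr {M K : ℕ} [NeZero K] (prog : Prog K Unit) (v : ℕ → Fin M → Fin K)
    {y y' : ℕ → Fin M → Fin K → ℝ} {t : ℕ} (h : ∀ s < t, y s = y' s) :
    remaining prog v y t = remaining prog v y' t := by
  induction t with
  | zero => rfl
  | succ t ih =>
    have h1 := ih fun s hs => h s (by omega)
    funext m
    simp only [remaining, h1, h t (by omega)]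

theorem armsPulled_congr {M K : ℕ} [NeZero K] (prog : Prog K Unit) (v : ℕ → Fin M → Fin K)
    {y y' : ℕ → Fin M → Fin K → ℝ} {t : ℕ} (h : ∀ s < t, y s = y' s) :
    armsPulled prog v y t = armsPulled prog v y' t := by
  funext m; simp only [armsPulled, remaining_congr prog v h]

/-- The sum over the rounds of the means of the arms that are pulled without a collision. -/
def meanReward {M K : ℕ} [NeZero K] (prog : Prog K Unit) (T : ℕ) (μ : Fin M → Fin K → ℝ)
    (v : ℕ → Fin M → Fin K) (y : ℕ → Fin M → Fin K → ℝ) : ℝ :=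
  ∑ t ∈ Finset.range T, ∑ m : Fin M, reward μ (armsPulled prog v y t) m

theorem reward_mem {M K : ℕ} {y : Fin M → Fin K → ℝ} (hy : ∀ m k, y m k ∈ Set.Icc (0 : ℝ) 1)
    (a : Fin M → Fin K) (m : Fin M) : reward y a m ∈ Set.Icc (0 : ℝ) 1 := by
  unfold reward
  split_ifs
  · simp
  · exact hy _ _

theorem totalReward_mem {M K : ℕ} [NeZero K] (prog : Prog K Unit) (T : ℕ)
    (v : ℕ → Fin M → Fin K) {y : ℕ → Fin M → Fin K → ℝ}
    (hy : ∀ t m k, y t m k ∈ Set.Icc (0 : ℝ) 1) :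
    totalReward prog T v y ∈ Set.Icc (0 : ℝ) (T * M) := by
  constructor
  · exact Finset.sum_nonneg fun t _ => Finset.sum_nonneg fun m _ => (reward_mem (hy t) _ m).1
  · calc totalReward prog T v y ≤ ∑ t ∈ Finset.range T, ∑ m : Fin M, (1 : ℝ) :=
          Finset.sum_le_sum fun t _ => Finset.sum_le_sum fun m _ => (reward_mem (hy t) _ m).2
      _ = T * M := by simp

namespace IndepRows

variable {Ω : Type*} [MeasurableSpace Ω] {M K : ℕ} [NeZero K] {P : Measure Ω}
  [IsProbabilityMeasure P] {μ : Fin M → Fin K → ℝ} {Z : Ω → ℕ → Fin M → Fin K → ℝ}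

omit [NeZero K] [IsProbabilityMeasure P] in
theorem integral_reward (h : IndepRows P μ Z) (t : ℕ) (a : Fin M → Fin K) (m : Fin M) :
    ∫ ω, reward (Z ω t) a m ∂P = reward μ a m := by
  unfold reward
  split_ifs
  · simp
  · exact h.mean t m _

omit [IsProbabilityMeasure P] in
theorem measurable_arms (h : IndepRows P μ Z) {prog : Prog K Unit}
    (hp : MeasProg fun _ : Table M K => prog) (v : ℕ → Fin M → Fin K) (t : ℕ) :
    Measurable fun ω => armsPulled prog v (Z ω) t :=
  (measurable_armsPulled hp t).comp (measurable_const.prodMk h.measurable)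

omit [NeZero K] in
theorem integrable_reward (h : IndepRows P μ Z) {A : Ω → Fin M → Fin K} (hA : Measurable A)
    (t : ℕ) (m : Fin M) : Integrable (fun ω => reward (Z ω t) (A ω) m) P :=
  Integrable.of_mem_Icc 0 1 (measurable_reward (by have := h.measurable; fun_prop) hA m).aemeasurable
    (.of_forall fun ω => reward_mem (h.mem ω t) _ m)

theorem integrable_meanReward (h : IndepRows P μ Z) {prog : Prog K Unit}
    (hp : MeasProg fun _ : Table M K => prog) (T : ℕ) (v : ℕ → Fin M → Fin K) :
    Integrable (fun ω => meanReward prog T μ v (Z ω)) P :=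
  integrable_finsetSum _ fun t _ => integrable_finsetSum _ fun m _ =>
    Integrable.of_mem_Icc 0 1
      (measurable_reward measurable_const (h.measurable_arms hp v t) m).aemeasurable
      (.of_forall fun _ => reward_mem h.mean_mem _ m)

/-- The arms of round `t` are a function of the past and the reward vector of round `t` is
independent of it. The vector is handled as a whole, so dependence between its entries is harmless.
-/
theorem integral_totalReward (h : IndepRows P μ Z) {prog : Prog K Unit}
    (hp : MeasProg fun _ : Table M K => prog) (T : ℕ) (v : ℕ → Fin M → Fin K) :
    ∫ ω, totalReward prog T v (Z ω) ∂P = ∫ ω, meanReward prog T μ v (Z ω) ∂P := by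
  have hA := h.measurable_arms hp v
  unfold totalReward meanReward
  rw [integral_finsetSum _ fun t _ => integrable_finsetSum _ fun m _ =>
      h.integrable_reward (hA t) t m,
    integral_finsetSum _ fun t _ => integrable_finsetSum _ fun m _ =>
      Integrable.of_mem_Icc 0 1 (measurable_reward measurable_const (hA t) m).aemeasurable
      (.of_forall fun _ => reward_mem h.mean_mem _ m)]
  refine Finset.sum_congr rfl fun t _ => ?_
  rw [integral_finsetSum _ fun m _ => h.integrable_reward (hA t) t m,
    integral_finsetSum _ fun m _ => Integrable.of_mem_Icc 0 1
      (measurable_reward measurable_const (hA t) m).aemeasurable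
      (.of_forall fun _ => reward_mem h.mean_mem _ m)]
  refine Finset.sum_congr rfl fun m _ => ?_
  classical
  -- Decomposition over the finitely many arm profiles: the indicator of a profile belongs to the
  -- past, and the reward of a fixed profile to round `t`.
  let I : (Fin M → Fin K) → Ω → ℝ := fun a ω => if armsPulled prog v (Z ω) t = a then 1 else 0
  have hI : ∀ a, Measurable (I a) := fun a =>
    (measurable_of_countable fun b : Fin M → Fin K => if b = a then (1 : ℝ) else 0).comp (hA t)
  have hIi : ∀ a, Integrable (I a) P := fun a => Integrable.of_mem_Icc 0 1 (hI a).aemeasurable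
    (.of_forall fun ω => by simp only [I]; split_ifs <;> simp)
  have h1 : ∀ (y : Ω → Fin M → Fin K → ℝ) ω, reward (y ω) (armsPulled prog v (Z ω) t) m =
      ∑ a, I a ω * reward (y ω) a m := by
    intro y ω; simp [I]
  have hr : ∀ a, Measurable fun ω => reward (Z ω t) a m := fun a =>
    measurable_reward (by have := h.measurable; fun_prop) measurable_const m
  have hind : ∀ a, IndepFun (I a) (fun ω => reward (Z ω t) a m) P := fun a => by
    have := h.indepFun_past_future t 1 (f := fun z => armsPulled prog v z t)
      ((measurable_armsPulled hp t).comp (measurable_const.prodMk measurable_id))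
      (fun z z' hz => armsPulled_congr prog v hz) (g := fun z => reward (z t) a m)
      (measurable_reward (by fun_prop) measurable_const m)
      (fun z z' hz => by simp only [hz t le_rfl (by omega)])
    exact this.comp (φ := fun b => if b = a then (1 : ℝ) else 0) (ψ := id)
      (measurable_of_countable _) measurable_id
  simp_rw [h1 (fun ω => Z ω t), h1 (fun _ => μ)]
  rw [integral_finsetSum, integral_finsetSum]
  · refine Finset.sum_congr rfl fun a _ => ?_
    rw [(hind a).integral_fun_mul_eq_mul_integral (hI a).aestronglyMeasurable
      (hr a).aestronglyMeasurable, h.integral_reward, integral_mul_const]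
  · exact fun a _ => (hIi a).mul_const _
  · exact fun a _ => (hind a).integrable_mul (hIi a) (h.integrable_reward measurable_const t m)

end IndepRows

/-! ### Execution of sequences of pulls -/

section Phase

variable {M K : ℕ}

/-- Collisions and rewards are equivariant under permutations of the players, so a run may be
described by ranks. -/
theorem collision_comp (ρ : Fin M ≃ Fin M) (a : Fin M → Fin K) (m : Fin M) :
    collision (fun n => a (ρ n)) m = collision a (ρ m) := by
  unfold collision
  congr 1
  rw [eq_iff_iff]
  constructor
  · rintro ⟨n, hn, h⟩; exact ⟨ρ n, ρ.injective.ne hn, h⟩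
  · rintro ⟨n, hn, h⟩
    exact ⟨ρ.symm n, fun h' => hn (by rw [← h', Equiv.apply_symm_apply]), by simpa using h⟩

theorem reward_comp (ρ : Fin M ≃ Fin M) (y : Fin M → Fin K → ℝ) (a : Fin M → Fin K) (m : Fin M) :
    reward y (fun n => a (ρ n)) m = reward (fun i => y (ρ.symm i)) a (ρ m) := by
  simp only [reward, collision_comp, Equiv.symm_apply_apply]

variable [NeZero K]

/-- The arms pulled in round `j` of a phase in which player `i` pulls the arms `L i`. -/
def phaseArms (L : Fin M → List (Fin K)) (j : ℕ) (i : Fin M) : Fin K := (L i).getD j 0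

/-- The observations of player `i` in a phase of `N` rounds starting in round `t`. -/
def phaseObs (z : ℕ → Fin M → Fin K → ℝ) (L : Fin M → List (Fin K)) (t N : ℕ) (i : Fin M) :
    List (ℝ × Bool) :=
  (List.range N).map fun j => (reward (z (t + j)) (phaseArms L j) i, collision (phaseArms L j) i)

/-- Within a phase the pulls are fixed and the observations are handed over only at its end, so
phases of equal length keep the players synchronized. The permutation `ρ` translates players into
ranks, which index everything that follows. -/
theorem remaining_phase {prog : Prog K Unit} {v : ℕ → Fin M → Fin K}
    {y : ℕ → Fin M → Fin K → ℝ} (ρ : Fin M ≃ Fin M) {t N : ℕ} {L : Fin M → List (Fin K)}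
    (hL : ∀ i, (L i).length = N) {k : Fin M → List (ℝ × Bool) → Prog K Unit}
    (h : ∀ m, remaining prog v y t m = Prog.bind (Prog.pullSeq (L (ρ m))) (k (ρ m))) :
    (∀ j < N, armsPulled prog v y (t + j) = fun m => phaseArms L j (ρ m)) ∧
      ∀ m, remaining prog v y (t + N) m =
        k (ρ m) (phaseObs (fun t i => y t (ρ.symm i)) L t N (ρ m)) := by
  induction N generalizing t L k with
  | zero =>
    refine ⟨fun j hj => absurd hj (by omega), fun m => ?_⟩
    rw [add_zero, h m, List.length_eq_zero_iff.1 (hL _)]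
    rfl
  | succ N ih =>
    have h0 : armsPulled prog v y t = fun m => phaseArms L 0 (ρ m) := by
      funext m
      obtain ⟨a, l, hl⟩ := List.exists_cons_of_length_eq_add_one (hL (ρ m))
      simp [armsPulled, h m, hl, Prog.pullSeq_cons_bind, Prog.arm, phaseArms]
    have h1 : ∀ m, remaining prog v y (t + 1) m =
        Prog.bind (Prog.pullSeq ((L (ρ m)).tail)) fun obs => k (ρ m)
          ((reward (fun i => y t (ρ.symm i)) (phaseArms L 0) (ρ m),
            collision (phaseArms L 0) (ρ m)) :: obs) := by
      intro m
      have : (fun n => (remaining prog v y t n).arm (v t n)) = fun m => phaseArms L 0 (ρ m) := h0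
      simp only [remaining, this, collision_comp, reward_comp]
      obtain ⟨a, l, hl⟩ := List.exists_cons_of_length_eq_add_one (hL (ρ m))
      simp only [h m, hl, Prog.pullSeq_cons_bind, Prog.step, List.tail_cons]
    obtain ⟨h2, h3⟩ := ih (t := t + 1) (L := fun i => (L i).tail)
      (k := fun i obs => k i ((reward (fun i => y t (ρ.symm i)) (phaseArms L 0) i,
            collision (phaseArms L 0) i) :: obs)) (fun i => by simp [hL]) h1
    have hs : ∀ j, phaseArms (fun i => (L i).tail) j = phaseArms L (j + 1) := by
      intro j; funext i
      obtain ⟨a, l, hl⟩ := List.exists_cons_of_length_eq_add_one (hL i)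
      simp [phaseArms, hl]
    refine ⟨fun j hj => ?_, fun m => ?_⟩
    · rcases j with _ | j
      · exact h0
      · rw [show t + (j + 1) = t + 1 + j by ring, h2 j (by omega), hs]
    · rw [show t + (N + 1) = t + 1 + N by ring, h3 m]
      simp only [phaseObs, List.range_succ_eq_map, List.map_cons, List.map_map, add_zero]
      congr 2
      refine List.map_congr_left fun j _ => ?_
      simp only [Function.comp, hs, Nat.succ_eq_add_one]
      rw [show t + 1 + j = t + (j + 1) by ring]

end Phase

/-! ### Blocks of lists -/

section Blocks

theorem drop_take_flatMap_finRange {α : Type*} {n B : ℕ} {g : Fin n → List α}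
    (hg : ∀ i, (g i).length = B) (i : Fin n) :
    ((((List.finRange n).flatMap g).drop (i.val * B)).take B) = g i := by
  induction n with
  | zero => exact i.elim0
  | succ n ih =>
    rw [List.finRange_succ, List.flatMap_cons, List.flatMap_map]
    refine Fin.cases ?_ (fun i => ?_) i
    · simp [← hg 0]
    · rw [Fin.val_succ, Nat.succ_mul, add_comm, ← List.drop_drop, List.drop_left' (hg 0)]
      exact ih (fun i => hg i.succ) i

theorem length_flatMap_finRange {α : Type*} {n B : ℕ} {g : Fin n → List α}
    (hg : ∀ i, (g i).length = B) : ((List.finRange n).flatMap g).length = n * B := by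
  simp [List.length_flatMap, hg]

theorem getElem?_flatMap_finRange {α : Type*} {n B : ℕ} {g : Fin n → List α}
    (hg : ∀ i, (g i).length = B) (i : Fin n) {r : ℕ} (hr : r < B) :
    ((List.finRange n).flatMap g)[i.val * B + r]? = (g i)[r]? := by
  rw [← drop_take_flatMap_finRange hg i, List.getElem?_take_of_lt hr, List.getElem?_drop]

theorem map_range_getD {α β : Type*} (l : List α) (a : α) (f : α → β) :
    ((List.range l.length).map fun j => f (l.getD j a)) = l.map f := by
  refine List.ext_getElem (by simp) fun j h1 h2 => ?_
  simp only [List.length_map] at h2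
  simp [h2]

/-- What the sender of slot `i` sends in the course of `n` slots. -/
def slot {n : ℕ} (B : ℕ) (i : Fin n) (s : List Bool) : List Bool :=
  List.replicate (i.val * B) false ++ (s ++ List.replicate ((n - 1 - i.val) * B) false)

theorem slot_getD {n B : ℕ} {s : List Bool} (hs : s.length = B) (i : Fin n) (q : ℕ) {r : ℕ}
    (hr : r < B) : (slot B i s).getD (q * B + r) false = if i.val = q then s.getD r false else false := by
  rcases lt_trichotomy i.val q with h | h | h
  · have h1 : (i.val + 1) * B ≤ q * B := Nat.mul_le_mul_right B h
    rw [Nat.succ_mul] at h1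
    rw [slot, List.getD_append_right _ _ _ _ (by simp; omega), List.getD_append_right _ _ _ _
      (by simp [hs]; omega), if_neg (by omega)]
    simp only [List.getD_eq_getElem?_getD, List.getElem?_replicate]
    split_ifs <;> rfl
  · subst h
    rw [slot, List.getD_append_right _ _ _ _ (by simp), List.getD_append _ _ _ _ (by simp [hs, hr])]
    simp
  · have h1 : (q + 1) * B ≤ i.val * B := Nat.mul_le_mul_right B h
    rw [Nat.succ_mul] at h1
    rw [slot, List.getD_append _ _ _ _ (by simp; omega), if_neg (by omega)]
    simp only [List.getD_eq_getElem?_getD, List.getElem?_replicate]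
    split_ifs <;> rfl

theorem exists_slot {n B j : ℕ} (hj : j < n * B) : ∃ (q : Fin n) (r : ℕ), r < B ∧ j = q * B + r := by
  have hB : 0 < B := Nat.pos_of_ne_zero (by rintro rfl; simp at hj)
  have h := Nat.div_add_mod j B
  refine ⟨⟨j / B, (Nat.div_lt_iff_lt_mul hB).2 hj⟩, j % B, Nat.mod_lt _ hB, ?_⟩
  rw [mul_comm]; exact h.symm

/-- If only one sender is active at a time, then their superposition is the concatenation. -/
theorem superposition {n B : ℕ} {s : Fin n → List Bool} (hs : ∀ i, (s i).length = B) :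
    ((List.range (n * B)).map fun j => decide (∃ i : Fin n, (slot B i (s i)).getD j false = true)) =
      (List.finRange n).flatMap s := by
  refine List.ext_getElem? fun j => ?_
  by_cases hj : j < n * B
  swap
  · rw [List.getElem?_eq_none (by simpa using hj),
      List.getElem?_eq_none (by rw [length_flatMap_finRange hs]; omega)]
  obtain ⟨q, r, hr, rfl⟩ := exists_slot hj
  rw [getElem?_flatMap_finRange hs q hr, List.getElem?_map, List.getElem?_range hj]
  simp only [slot_getD (hs _) _ _ hr, Option.map_some]
  have hr' : r < (s q).length := by rw [hs]; exact hr
  rw [List.getElem?_eq_getElem hr']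
  simp [hr', ← Fin.ext_iff]

end Blocks

/-! ### Execution of one epoch -/

section Epoch

variable {n K : ℕ} [NeZero K]

/-- The programs of the players, by rank, at the beginning of an epoch. -/
noncomputable def epochProg (tie : TieBreak K) (c T : ℕ) (h : n + 1 ≤ K) (fuel p : ℕ)
    (E : Finset (Fin (n + 1) × Fin K)) (w : Fin (n + 1) → Fin K → ℝ) (comm : Fin (n + 1) → Fin K) :
    Fin (n + 1) → Prog K Unit :=
  Fin.cons (leaderEpochs tie c T h fuel p E w comm) fun i =>
    followerEpochs c T (i.val + 2) (n + 1) fuel p (comm i.succ)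

/-- The arms pulled in a phase in which the leader sends and the followers listen. -/
def listenArms (S : List (Fin K)) (comm : Fin (n + 1) → Fin K) : Fin (n + 1) → List (Fin K) :=
  Fin.cons S fun i => List.replicate S.length (comm i.succ)

omit [NeZero K] in
theorem length_listenArms (S : List (Fin K)) (comm : Fin (n + 1) → Fin K) (i : Fin (n + 1)) :
    (listenArms S comm i).length = S.length := by
  refine Fin.cases ?_ (fun i => ?_) i <;> simp [listenArms]

theorem phaseArms_listenArms {S : List (Fin K)} {comm : Fin (n + 1) → Fin K} {j : ℕ}
    (hj : j < S.length) :
    phaseArms (listenArms S comm) j = Function.update comm 0 (S.getD j 0) := by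
  funext i
  refine Fin.cases ?_ (fun i => ?_) i
  · simp [phaseArms, listenArms]
  · rw [Function.update_of_ne (Fin.succ_ne_zero i)]
    simp [phaseArms, listenArms, hj]

omit [NeZero K] in
-- The followers sit on distinct arms, so only the leader can hit one of them.
theorem collision_update {comm : Fin (n + 1) → Fin K} (hc : Function.Injective comm) (a : Fin K)
    (i : Fin n) : collision (Function.update comm 0 a) i.succ = decide (a = comm i.succ) := by
  unfold collision
  congr 1
  rw [eq_iff_iff, Function.update_of_ne (Fin.succ_ne_zero i)]
  constructor
  · rintro ⟨m, hm, h⟩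
    by_cases h0 : m = 0
    · subst h0; simpa using h
    · rw [Function.update_of_ne h0] at h
      exact absurd (hc h) hm
  · intro h
    exact ⟨0, (Fin.succ_ne_zero i).symm, by simpa using h⟩

theorem collisions_listenArms (z : ℕ → Fin (n + 1) → Fin K → ℝ) (S : List (Fin K))
    {comm : Fin (n + 1) → Fin K} (hc : Function.Injective comm) (t : ℕ) (i : Fin n) :
    (phaseObs z (listenArms S comm) t S.length i.succ).map Prod.snd =
      S.map fun a => decide (a = comm i.succ) := by
  rw [← map_range_getD S 0, phaseObs, List.map_map]
  refine List.map_congr_left fun j hj => ?_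
  simp only [Function.comp]
  rw [phaseArms_listenArms (List.mem_range.1 hj), collision_update hc]

omit [NeZero K] in
theorem map_signal {own target : Fin K} (h : own ≠ target) (b : ℕ) (xs : List ℕ) :
    (signal own target b xs).map (fun a => decide (a = target)) = xs.flatMap (toBits b) := by
  rw [signal, List.map_map]
  conv_rhs => rw [← List.map_id (xs.flatMap (toBits b))]
  refine List.map_congr_left fun d _ => ?_
  cases d <;> simp [h]

omit [NeZero K] in
/-- A follower understands the message that the leader sends to her. -/
theorem heard_signal {comm : Fin (n + 1) → Fin K} (hc : Function.Injective comm) {b N : ℕ}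
    {msg : Fin n → List ℕ} (hN : ∀ i, (msg i).length = N) (i : Fin n)
    (hb : ∀ x ∈ msg i, x < 2 ^ b) :
    heard (i.val + 2) b N (((List.finRange n).flatMap fun i' =>
      signal (comm 0) (comm i'.succ) b (msg i')).map fun a => decide (a = comm i.succ)) =
      msg i := by
  rw [heard, List.map_flatMap, Nat.add_sub_cancel,
    drop_take_flatMap_finRange (fun i' => by rw [List.length_map, length_signal, hN]) i,
    map_signal (hc.ne (Fin.succ_ne_zero i).symm), ← hN i]
  exact decode_flatMap_toBits hb

/-- The slots before a follower's own, her own, and those after it make up all `n` slots. -/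
theorem idle_length (i : Fin n) (x : ℕ) :
    (i.val + 2 - 2) * x + (x + (n + 1 - (i.val + 2)) * x) = n * x := by
  rw [show n * x = (i.val + 1 + (n - (i.val + 1))) * x by congr 1; omega,
    show n + 1 - (i.val + 2) = n - (i.val + 1) by omega, Nat.add_sub_cancel]
  ring

omit [NeZero K] in
theorem length_sizeSignal (d : Plan n K) (comm : Fin (n + 1) → Fin K) :
    (sizeSignal d comm).length = n * sizeBits (n + 1) K := by
  refine length_flatMap_finRange fun i => ?_
  simp

omit [NeZero K] in
theorem length_planMessage (d : Plan n K) (i : Fin n) :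
    (planMessage d i).length = d.2.1.length + 2 := by simp [planMessage]

omit [NeZero K] in
theorem length_planSignal (d : Plan n K) (comm : Fin (n + 1) → Fin K) :
    (planSignal d comm).length = n * ((d.2.1.length + 2) * armBits K) := by
  refine length_flatMap_finRange fun i => ?_
  rw [length_signal, length_planMessage]

omit [NeZero K] in
theorem lt_two_pow_armBits (k : Fin K) : k.val < 2 ^ armBits K :=
  k.isLt.trans_le (Nat.le_pow_clog one_lt_two K)

omit [NeZero K] in
theorem planMessage_lt (d : Plan n K) (i : Fin n) {x : ℕ} (hx : x ∈ planMessage d i) :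
    x < 2 ^ armBits K := by
  simp only [planMessage, List.mem_append, List.mem_map, List.mem_cons, List.not_mem_nil,
    or_false] at hx
  rcases hx with ⟨π, _, rfl⟩ | rfl | rfl <;> exact lt_two_pow_armBits _

omit [NeZero K] in
theorem length_epochPlan_le (tie : TieBreak K) (c T : ℕ) (h : n + 1 ≤ K) (p : ℕ)
    (E : Finset (Fin (n + 1) × Fin K)) (w : Fin (n + 1) → Fin K → ℝ) :
    (epochPlan tie c T h p E w).2.1.length ≤ (n + 1) * K := by
  simp only [epochPlan, planOf, Finset.length_toList]
  refine Finset.card_image_le.trans ((Finset.card_le_univ _).trans ?_)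
  simp

theorem map_ofNat_planMessage (d : Plan n K) (i : Fin n) :
    (planMessage d i).map (Fin.ofNat K) =
      d.2.1.map (fun π => π i.succ) ++ [d.2.2 0, d.2.2 i.succ] := by
  simp [planMessage]

/-- The first two phases of an epoch. -/
theorem epoch_announce {prog : Prog K Unit} {v : ℕ → Fin (n + 1) → Fin K}
    {y : ℕ → Fin (n + 1) → Fin K → ℝ} (ρ : Fin (n + 1) ≃ Fin (n + 1)) {t fuel p c T : ℕ}
    {comm : Fin (n + 1) → Fin K} (hc : Function.Injective comm) {d : Plan n K}
    (hd : d.2.1.length ≤ (n + 1) * K) {lead : Prog K Unit}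
    {Q : Fin (n + 1) → Prog K Unit}
    (hQ0 : Q 0 = Prog.bind (Prog.pullSeq (sizeSignal d comm)) fun _ =>
      Prog.bind (Prog.pullSeq (planSignal d comm)) fun _ => lead)
    (hQ : ∀ i : Fin n, Q i.succ =
      followerEpochs c T (i.val + 2) (n + 1) (fuel + 1) p (comm i.succ))
    (h : ∀ m, remaining prog v y t m = Q (ρ m)) :
    (∀ j < n * sizeBits (n + 1) K + n * ((d.2.1.length + 2) * armBits K), ∃ a i',
      a = Function.update comm 0 (comm i') ∧ armsPulled prog v y (t + j) = fun m => a (ρ m)) ∧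
    ∀ m, remaining prog v y
        (t + (n * sizeBits (n + 1) K + n * ((d.2.1.length + 2) * armBits K))) m =
      (Fin.cons lead fun i => followerAfterPlan c T (i.val + 2) (n + 1) fuel p d.2.1.length
        (planMessage d i) : Fin (n + 1) → Prog K Unit) (ρ m) := by
  -- Whatever is sent, the leader only pulls communication arms, and her own for a zero. So each
  -- round is one bit to one player, with `i' = 0` standing for silence.
  have hmem : ∀ (b : ℕ) (msg : Fin n → List ℕ) (j : ℕ) (hj : j < ((List.finRange n).flatMap fun i' =>
      signal (comm 0) (comm i'.succ) b (msg i')).length), ∃ i', ((List.finRange n).flatMap fun i' =>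
      signal (comm 0) (comm i'.succ) b (msg i')).getD j 0 = comm i' := by
    intro b msg j hj
    have := List.getElem_mem hj
    rw [← List.getD_eq_getElem (d := 0)] at this
    obtain ⟨i, _, he⟩ := List.mem_flatMap.1 this
    obtain ⟨e, _, he⟩ := List.mem_map.1 he
    rw [← he]
    cases e
    · exact ⟨0, rfl⟩
    · exact ⟨i.succ, rfl⟩
  -- the size of the set of candidate matchings
  obtain ⟨hA1, hA2⟩ := remaining_phase ρ (t := t) (N := (sizeSignal d comm).length)
    (L := listenArms (sizeSignal d comm) comm) (length_listenArms _ _)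
    (k := Fin.cons (fun _ => Prog.bind (Prog.pullSeq (planSignal d comm)) fun _ => lead) fun i o =>
      let size := (heard (i.val + 2) (sizeBits (n + 1) K) 1 (o.map Prod.snd)).getD 0 0
      Prog.bind (Prog.pullSeq (List.replicate ((i.val + 2 - 2) * ((size + 2) * armBits K) +
        ((size + 2) * armBits K + (n + 1 - (i.val + 2)) * ((size + 2) * armBits K)))
          (comm i.succ))) fun o =>
      followerAfterPlan c T (i.val + 2) (n + 1) fuel p size
        (heard (i.val + 2) (armBits K) (size + 2) (o.map Prod.snd)))
    (by
      intro m
      rw [h m]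
      generalize ρ m = i
      refine Fin.cases ?_ (fun i => ?_) i
      · simpa [listenArms] using hQ0
      · rw [hQ, followerEpochs_succ]
        simp only [one_mul, idle_length, listenArms, Fin.cons_succ, length_sizeSignal])
  -- the candidate matchings and the new communication arms
  have hsize : ∀ i : Fin n, (heard (i.val + 2) (sizeBits (n + 1) K) 1
      ((phaseObs (fun t i => y t (ρ.symm i)) (listenArms (sizeSignal d comm) comm) t
        (sizeSignal d comm).length i.succ).map Prod.snd)).getD 0 0 = d.2.1.length := by
    intro i
    rw [collisions_listenArms _ _ hc, sizeSignal,
      heard_signal hc (N := 1) (msg := fun _ => [d.2.1.length]) (fun _ => rfl) i]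
    · rfl
    · intro x hx
      rw [List.mem_singleton] at hx
      subst hx
      exact (Nat.lt_succ_of_le hd).trans_le (Nat.le_pow_clog one_lt_two _)
  obtain ⟨hB1, hB2⟩ := remaining_phase ρ (t := t + (sizeSignal d comm).length)
    (N := (planSignal d comm).length)
    (L := listenArms (planSignal d comm) comm) (length_listenArms _ _)
    (k := Fin.cons (fun _ => lead) fun i o =>
      followerAfterPlan c T (i.val + 2) (n + 1) fuel p d.2.1.length
        (heard (i.val + 2) (armBits K) (d.2.1.length + 2) (o.map Prod.snd)))
    (by
      intro m
      rw [hA2 m]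
      generalize ρ m = i
      refine Fin.cases ?_ (fun i => ?_) i
      · simp [listenArms]
      · simp only [Fin.cons_succ, hsize, idle_length]
        simp only [listenArms, Fin.cons_succ, length_planSignal])
  rw [length_sizeSignal] at hA1 hB1 hB2
  rw [length_planSignal] at hB1 hB2
  refine ⟨fun j hj => ?_, fun m => ?_⟩
  · by_cases hj' : j < n * sizeBits (n + 1) K
    · have hl : j < (sizeSignal d comm).length := by rwa [length_sizeSignal]
      obtain ⟨i', hi'⟩ := hmem _ _ _ hl
      refine ⟨_, i', rfl, ?_⟩
      rw [hA1 j hj', phaseArms_listenArms hl, ← hi']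
      rfl
    · obtain ⟨j, rfl⟩ := Nat.exists_eq_add_of_le (not_lt.1 hj')
      have hl : j < (planSignal d comm).length := by rw [length_planSignal]; omega
      obtain ⟨i', hi'⟩ := hmem _ _ _ hl
      refine ⟨_, i', rfl, ?_⟩
      rw [← add_assoc, hB1 j (by omega), phaseArms_listenArms hl, ← hi']
      rfl
  · rw [← add_assoc, hB2 m]
    generalize ρ m = i
    refine Fin.cases rfl (fun i => ?_) i
    simp only [Fin.cons_succ]
    rw [← length_planSignal d comm, collisions_listenArms _ _ hc, planSignal,
      heard_signal hc (length_planMessage d) i fun x => planMessage_lt d i]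

/-- The exploitation phase. -/
theorem epoch_exploit {prog : Prog K Unit} {v : ℕ → Fin (n + 1) → Fin K}
    {y : ℕ → Fin (n + 1) → Fin K → ℝ} (ρ : Fin (n + 1) ≃ Fin (n + 1)) {t fuel p c T : ℕ}
    {d : Plan n K} {π : Matching (n + 1) K} (hd : d.2.1 = [π])
    (h : ∀ m, remaining prog v y t m = (Fin.cons (Prog.bind
      (Prog.pullSeq (List.replicate T (π 0))) fun _ => Prog.ret ()) fun i =>
      followerAfterPlan c T (i.val + 2) (n + 1) fuel p d.2.1.length
        (planMessage d i) : Fin (n + 1) → Prog K Unit) (ρ m)) {j : ℕ} (hj : j < T) :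
    armsPulled prog v y (t + j) = fun m => π (ρ m) := by
  obtain ⟨h1, -⟩ := remaining_phase ρ (t := t) (N := T) (L := fun i => List.replicate T (π i))
    (fun i => by simp) (k := fun _ _ => Prog.ret ()) (by
      intro m
      rw [h m]
      generalize ρ m = i
      refine Fin.cases rfl (fun i => ?_) i
      simp only [Fin.cons_succ, followerAfterPlan, map_ofNat_planMessage]
      simp [hd])
  rw [h1 j hj]
  funext m
  simp [phaseArms, hj]

/-- What player `i` observes when the matchings of `C` are explored from round `s` on. -/
def blockObs (z : ℕ → Fin (n + 1) → Fin K → ℝ) (s c p : ℕ) (C : List (Matching (n + 1) K))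
    (i : Fin (n + 1)) : List (ℝ × Bool) :=
  (List.range (C.length * 2 ^ p ^ c)).map fun j =>
    (z (s + j) i ((exploreArms c p C i).getD j 0), false)

/-- The empirical means of player `i` when the matchings of `C` are explored from round `s` on. -/
noncomputable def blockMean (z : ℕ → Fin (n + 1) → Fin K → ℝ) (s c p : ℕ)
    (C : List (Matching (n + 1) K)) (i : Fin (n + 1)) (k : Fin K) : ℝ :=
  empiricalMean (exploreArms c p C i) (blockObs z s c p C i) k

/-- The estimates of the leader after an exploration that starts in round `s`. -/
noncomputable def blockEstimates (z : ℕ → Fin (n + 1) → Fin K → ℝ) (s c p : ℕ)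
    (C : List (Matching (n + 1) K)) : Fin (n + 1) → Fin K → ℝ :=
  Fin.cons (blockMean z s c p C 0) fun i k =>
    (truncate (meanBits c p) (blockMean z s c p C i.succ k) : ℝ) / 2 ^ meanBits c p

omit [NeZero K] in
theorem exploreArms_eq_map (c p : ℕ) (C : List (Matching (n + 1) K)) (i : Fin (n + 1)) :
    exploreArms c p C i = (C.flatMap fun π => List.replicate (2 ^ p ^ c) π).map fun π => π i := by
  simp [exploreArms, List.map_flatMap]

omit [NeZero K] in
theorem length_exploreArms (c p : ℕ) (C : List (Matching (n + 1) K)) (i : Fin (n + 1)) :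
    (exploreArms c p C i).length = C.length * 2 ^ p ^ c := by
  simp [exploreArms, List.length_flatMap]

theorem exploreArms_getD (c p : ℕ) (C : List (Matching (n + 1) K)) {j : ℕ}
    (hj : j < (C.flatMap fun π => List.replicate (2 ^ p ^ c) π).length) (i : Fin (n + 1)) :
    (exploreArms c p C i).getD j 0 =
      (C.flatMap fun π => List.replicate (2 ^ p ^ c) π)[j] i := by
  rw [exploreArms_eq_map, List.getD_eq_getElem _ _ (by simpa using hj), List.getElem_map]

omit [NeZero K] in
theorem collision_of_injective {M : ℕ} {a : Fin M → Fin K} (ha : Function.Injective a) (m : Fin M) :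
    collision a m = false := by
  simp only [collision, decide_eq_false_iff_not, not_exists, not_and]
  exact fun n hn h => hn (ha h)

theorem phaseArms_exploreArms (c p : ℕ) (C : List (Matching (n + 1) K)) {j : ℕ}
    (hj : j < (C.flatMap fun π => List.replicate (2 ^ p ^ c) π).length) :
    phaseArms (exploreArms c p C) j = (C.flatMap fun π => List.replicate (2 ^ p ^ c) π)[j] :=
  funext fun i => exploreArms_getD c p C hj i

theorem phaseObs_exploreArms (z : ℕ → Fin (n + 1) → Fin K → ℝ) (s c p : ℕ)
    (C : List (Matching (n + 1) K)) (i : Fin (n + 1)) :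
    phaseObs z (exploreArms c p C) s (C.length * 2 ^ p ^ c) i = blockObs z s c p C i := by
  refine List.map_congr_left fun j hj => ?_
  have hj' : j < (C.flatMap fun π => List.replicate (2 ^ p ^ c) π).length := by
    rw [List.mem_range] at hj
    simpa [List.length_flatMap] using hj
  rw [phaseArms_exploreArms c p C hj', exploreArms_getD c p C hj']
  simp only [reward]
  rw [collision_of_injective (Function.Embedding.injective _)]
  rfl

/-- The bits that follower `i` sends. -/
noncomputable def meanMessage (c p : ℕ) (arms : List (Fin K)) (obs : List (ℝ × Bool)) : List ℕ :=
  (List.finRange K).map fun k => truncate (meanBits c p) (empiricalMean arms obs k)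

omit [NeZero K] in
theorem length_meanMessage (c p : ℕ) (arms : List (Fin K)) (obs : List (ℝ × Bool)) :
    (meanMessage c p arms obs).length = K := by simp [meanMessage]

theorem truncate_lt (b : ℕ) (x : ℝ) : truncate b x < 2 ^ b := by
  have := Nat.one_le_two_pow (n := b)
  unfold truncate
  omega

/-- The exploration and the report of the followers. -/
theorem epoch_explore {prog : Prog K Unit} {v : ℕ → Fin (n + 1) → Fin K}
    {y : ℕ → Fin (n + 1) → Fin K → ℝ} (ρ : Fin (n + 1) ≃ Fin (n + 1)) {s fuel p c T : ℕ}
    (hK : n + 1 ≤ K) (tie : TieBreak K) {d : Plan n K} (hd : d.2.1.length ≠ 1)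
    (h : ∀ m, remaining prog v y s m = (Fin.cons
      (Prog.bind (Prog.pullSeq (exploreArms c p d.2.1 0)) fun obs =>
        Prog.bind (Prog.pullSeq (List.replicate (n * K * meanBits c p) (d.2.2 0))) fun o =>
        leaderEpochs tie c T hK fuel (p + 1) d.1
          (newEstimates c p (exploreArms c p d.2.1 0) obs
            (decode (meanBits c p) (n * K) (o.map Prod.snd))) d.2.2) fun i =>
      followerAfterPlan c T (i.val + 2) (n + 1) fuel p d.2.1.length
        (planMessage d i) : Fin (n + 1) → Prog K Unit) (ρ m)) :
    (∀ j < d.2.1.length * 2 ^ p ^ c, ∃ (hj : j < (d.2.1.flatMap fun π =>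
        List.replicate (2 ^ p ^ c) π).length), armsPulled prog v y (s + j) =
        fun m => (d.2.1.flatMap fun π => List.replicate (2 ^ p ^ c) π)[j] (ρ m)) ∧
    (∀ j < n * (K * meanBits c p), ∃ a i i', a = Function.update d.2.2 i (d.2.2 i') ∧
      armsPulled prog v y (s + d.2.1.length * 2 ^ p ^ c + j) = fun m => a (ρ m)) ∧
    ∀ m, remaining prog v y (s + d.2.1.length * 2 ^ p ^ c + n * (K * meanBits c p)) m =
      epochProg tie c T hK fuel (p + 1) d.1
        (blockEstimates (fun t i => y t (ρ.symm i)) s c p d.2.1) d.2.2 (ρ m) := by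
  set C := d.2.1 with hCdef
  set b := meanBits c p with hb
  set z : ℕ → Fin (n + 1) → Fin K → ℝ := fun t i => y t (ρ.symm i) with hz
  let arms : Fin (n + 1) → List (Fin K) := exploreArms c p C
  let obs : Fin (n + 1) → List (ℝ × Bool) := blockObs z s c p C
  obtain ⟨hC1, hC2⟩ := remaining_phase ρ (t := s) (N := C.length * 2 ^ p ^ c)
    (L := arms) (length_exploreArms c p C)
    (k := Fin.cons (fun obs =>
        Prog.bind (Prog.pullSeq (List.replicate (n * K * b) (d.2.2 0))) fun o =>
        leaderEpochs tie c T hK fuel (p + 1) d.1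
          (newEstimates c p (exploreArms c p C 0) obs
            (decode b (n * K) (o.map Prod.snd))) d.2.2) fun i obs =>
      Prog.bind (Prog.pullSeq (meanSignal c p (i.val + 2) (n + 1) (d.2.2 i.succ) (d.2.2 0)
        (arms i.succ) obs)) fun _ =>
      followerEpochs c T (i.val + 2) (n + 1) fuel (p + 1) (d.2.2 i.succ))
    (by
      intro m
      rw [h m]
      generalize ρ m = i
      refine Fin.cases rfl (fun i => ?_) i
      simp only [Fin.cons_succ, followerAfterPlan, map_ofNat_planMessage, if_neg hd]
      have h1 : (C.map (fun π : Matching (n + 1) K => π i.succ) ++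
          [d.2.2 0, d.2.2 i.succ]).getD (C.length + 1) 0 = d.2.2 i.succ := by
        rw [List.getD_append_right _ _ _ _ (by simp)]; simp
      have h2 : (C.map (fun π : Matching (n + 1) K => π i.succ) ++
          [d.2.2 0, d.2.2 i.succ]).getD C.length 0 = d.2.2 0 := by
        rw [List.getD_append_right _ _ _ _ (by simp)]; simp
      have h3 : (C.map (fun π : Matching (n + 1) K => π i.succ) ++
          [d.2.2 0, d.2.2 i.succ]).take C.length = C.map (fun π => π i.succ) :=
        List.take_left' (by simp)
      simp only [← hCdef, h1, h2, h3, List.flatMap_map, arms, exploreArms])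
  let bits : Fin n → List Bool := fun i =>
    (meanMessage c p (arms i.succ) (obs i.succ)).flatMap (toBits b)
  have hbits : ∀ i, (bits i).length = K * b := fun i => by
    simp only [bits, length_flatMap_toBits, length_meanMessage]
  let L : Fin (n + 1) → List (Fin K) := Fin.cons (List.replicate (n * (K * b)) (d.2.2 0)) fun i =>
    (slot (K * b) i (bits i)).map fun e => if e then d.2.2 0 else d.2.2 i.succ
  have hL : ∀ i, (L i).length = n * (K * b) := by
    intro i
    refine Fin.cases ?_ (fun i => ?_) i
    · simp [L]
    · simp only [L, Fin.cons_succ, List.length_map, slot, List.length_append, List.length_replicate,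
        hbits]
      have := idle_length i (K * b)
      rwa [Nat.add_sub_cancel, show n + 1 - (i.val + 2) = n - 1 - i.val by omega] at this
  have hL' : ∀ i : Fin n, meanSignal c p (i.val + 2) (n + 1) (d.2.2 i.succ) (d.2.2 0)
      (arms i.succ) (obs i.succ) = L i.succ := by
    intro i
    simp only [meanSignal, L, Fin.cons_succ, slot, List.map_append, List.map_replicate,
      Bool.false_eq_true, if_false, Nat.add_sub_cancel, ← hb, signal, bits, meanMessage]
    rw [show n + 1 - (i.val + 2) = n - 1 - i.val by omega]
  obtain ⟨hD1, hD2⟩ := remaining_phase ρ (t := s + C.length * 2 ^ p ^ c) (N := n * (K * b))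
    (L := L) hL
    (k := Fin.cons (fun o => leaderEpochs tie c T hK fuel (p + 1) d.1
          (newEstimates c p (arms 0) (obs 0)
            (decode b (n * K) (o.map Prod.snd))) d.2.2) fun i _ =>
      followerEpochs c T (i.val + 2) (n + 1) fuel (p + 1) (d.2.2 i.succ))
    (by
      intro m
      rw [hC2 m, phaseObs_exploreArms]
      generalize ρ m = i
      refine Fin.cases ?_ (fun i => ?_) i
      · simp only [Fin.cons_zero, L, mul_assoc]; rfl
      · simp only [Fin.cons_succ]; rw [← hL' i])
  have hget : ∀ j < n * (K * b), ∀ i : Fin n, phaseArms L j i.succ =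
      if (slot (K * b) i (bits i)).getD j false then d.2.2 0 else d.2.2 i.succ := by
    intro j hj i
    have h1 := hL i.succ
    simp only [L, Fin.cons_succ, List.length_map] at h1
    simp only [phaseArms, L, Fin.cons_succ]
    rw [List.getD_eq_getElem _ _ (by rw [List.length_map, h1]; exact hj), List.getElem_map,
      List.getD_eq_getElem _ _ (by rw [h1]; exact hj)]
  have hget0 : ∀ j < n * (K * b), phaseArms L j 0 = d.2.2 0 := by
    intro j hj; simp [phaseArms, L, hj]
  refine ⟨fun j hj => ?_, fun j hj => ?_, fun m => ?_⟩
  · have hj' : j < (C.flatMap fun π => List.replicate (2 ^ p ^ c) π).length := by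
      simpa [List.length_flatMap] using hj
    refine ⟨hj', ?_⟩
    rw [hC1 j hj]
    funext m
    exact exploreArms_getD c p C hj' _
  · rw [hD1 j hj]
    -- In slot `q` only follower `q` can be away from her communication arm, and then she is on the
    -- leader's.
    obtain ⟨q, r, hr, rfl⟩ := exists_slot hj
    refine ⟨_, q.succ, if (bits q).getD r false then 0 else q.succ, ?_, rfl⟩
    funext i
    refine Fin.cases ?_ (fun i => ?_) i
    · rw [hget0 _ hj, Function.update_of_ne (Fin.succ_ne_zero q).symm]
    · rw [hget _ hj, slot_getD (hbits i) _ _ hr]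
      by_cases hi : i = q
      · subst hi
        simp only [if_true, Function.update_self]
        split_ifs <;> rfl
      · rw [Function.update_of_ne (by simpa using hi),
          if_neg (show ¬i.val = q.val from fun h => hi (Fin.ext h)),
          if_neg Bool.false_ne_true]
  · rw [hD2 m]
    generalize ρ m = i
    refine Fin.cases ?_ (fun i => rfl) i
    simp only [Fin.cons_zero, epochProg]
    congr 1
    -- The leader hears the disjunction of the bits of all followers; as the slots are disjoint,
    -- this is the concatenation of the messages (`superposition`).
    have hsnd : (phaseObs z L (s + C.length * 2 ^ p ^ c) (n * (K * b)) 0).map Prod.snd =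
        ((List.finRange n).flatMap fun i =>
          meanMessage c p (arms i.succ) (obs i.succ)).flatMap (toBits b) := by
      rw [List.flatMap_assoc, ← superposition hbits, phaseObs, List.map_map]
      refine List.map_congr_left fun j hj => ?_
      rw [List.mem_range] at hj
      simp only [Function.comp, collision, hget0 j hj]
      congr 1
      rw [eq_iff_iff]
      constructor
      · rintro ⟨i, hi, h⟩
        obtain ⟨i, rfl⟩ := Fin.exists_succ_eq.2 hi
        refine ⟨i, ?_⟩
        rw [hget j hj] at h
        by_contra hne
        rw [if_neg hne] at h
        exact Fin.succ_ne_zero i (d.2.2.injective h)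
      · rintro ⟨i, hi⟩
        exact ⟨i.succ, Fin.succ_ne_zero i, by rw [hget j hj, if_pos hi]⟩
    have hlen : ((List.finRange n).flatMap fun i =>
        meanMessage c p (arms i.succ) (obs i.succ)).length = n * K :=
      length_flatMap_finRange fun i => length_meanMessage ..
    rw [hsnd]
    nth_rewrite 1 [← hlen]
    rw [decode_flatMap_toBits]
    · funext i k
      refine Fin.cases rfl (fun i => ?_) i
      simp only [newEstimates, blockEstimates, Fin.cons_succ]
      congr 2
      rw [List.getD_eq_getElem?_getD, getElem?_flatMap_finRange
        (fun i => length_meanMessage ..) i k.isLt]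
      simp [meanMessage, blockMean, arms, obs]
    · intro x hx
      simp only [List.mem_flatMap, meanMessage, List.mem_map] at hx
      obtain ⟨_, _, _, _, rfl⟩ := hx
      exact truncate_lt _ _

end Epoch

/-! ### Execution of the initialization -/

section Hopping

variable {K : ℕ} [NeZero K]

omit [NeZero K] in
theorem filter_lt_finRange (k : Fin K) :
    ((List.finRange K).filter fun i => k < i) = (List.finRange K).drop (k.val + 1) := by
  conv_lhs => rw [← List.take_append_drop (k.val + 1) (List.finRange K)]
  rw [List.filter_append, List.filter_eq_nil_iff.2, List.filter_eq_self.2, List.nil_append]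
  · intro a ha
    obtain ⟨i, hi, rfl⟩ := List.mem_drop_iff_getElem.1 ha
    simp only [List.getElem_finRange, decide_eq_true_eq, Fin.lt_def, Fin.val_cast]
    omega
  · intro a ha
    obtain ⟨i, hi, rfl⟩ := List.mem_take_iff_getElem.1 ha
    simp only [List.getElem_finRange, decide_eq_true_eq, Fin.lt_def, Fin.val_cast]
    omega

omit [NeZero K] in
theorem armsAbove_eq (k : Fin K) : armsAbove k = K - 1 - k.val := by
  rw [armsAbove, filter_lt_finRange, List.length_drop, List.length_finRange]; omega

theorem length_hopArms (k : Fin K) : (hopArms k).length = 2 * K - 2 := by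
  have := armsAbove_eq k
  rw [armsAbove] at this
  simp only [hopArms, List.length_append, List.length_replicate, this]
  omega

/-- A hopper waits, sweeps at unit speed, or is parked on arm `0`. This closed form turns meetings
into linear arithmetic. -/
theorem hopArms_getD (k : Fin K) (j : ℕ) : ((hopArms k).getD j 0).val =
    if j < 2 * k.val then k.val else if j < K - 1 + k.val then j - k.val + 1 else 0 := by
  have h1 := armsAbove_eq k
  rw [armsAbove] at h1
  have h2 := k.isLt
  split_ifs with h h'
  · rw [hopArms, List.getD_append _ _ _ _ (by simpa using h)]
    simp [h]
  · rw [hopArms, List.getD_append_right _ _ _ _ (by simpa using h), List.length_replicate,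
      List.getD_append _ _ _ _ (by omega), filter_lt_finRange, List.getD_eq_getElem _ _ (by simp; omega)]
    simp
    omega
  · rw [hopArms, List.getD_append_right _ _ _ _ (by simpa using h), List.length_replicate,
      List.getD_append_right _ _ _ _ (by omega), List.getD_eq_getElem?_getD,
      List.getElem?_replicate]
    split_ifs <;> rfl

theorem numCollisions_phaseObs {M : ℕ} (z : ℕ → Fin M → Fin K → ℝ) (L : Fin M → List (Fin K))
    (t N a l : ℕ) (h : a + l ≤ N) (m : Fin M) :
    numCollisions (((phaseObs z L t N m).drop a).take l) =
      ((Finset.Ico a (a + l)).filter fun j => collision (phaseArms L j) m = true).card := by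
  have h1 : (((List.range N).drop a).take l) = List.range' a l := by
    refine List.ext_getElem (by simp; omega) fun j h1 h2 => ?_
    simp
  rw [phaseObs, numCollisions, ← List.map_drop, ← List.map_take, h1, List.countP_map,
    List.countP_eq_length_filter, ← List.toFinset_card_of_nodup (List.Nodup.filter _ List.nodup_range')]
  congr 1
  ext j
  simp [List.mem_range'_1]

/-- Number of players on arms below that of player `m`. -/
def rankOf {M : ℕ} (k : Fin M → Fin K) (m : Fin M) : ℕ := (Finset.univ.filter fun n => k n < k m).card

/-- A player from arm `a` sweeps over a higher arm `b` in round `a + b - 1`, while its owner still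
waits there. Waiting players never meet each other, and parked players are on arm `0`, where nobody
waits. So the collisions of the waiting period count the players below. -/
theorem wait_collisions {M : ℕ} {k : Fin M → Fin K} (hk : Function.Injective k) (m : Fin M) :
    ((Finset.Ico 0 (0 + 2 * (k m).val)).filter fun j =>
      collision (phaseArms (fun n => hopArms (k n)) j) m = true).card = rankOf k m := by
  symm
  refine Finset.card_bij (fun n _ => (k n).val + (k m).val - 1) ?_ ?_ ?_
  · intro n hn
    simp only [Finset.mem_filter, Finset.mem_univ, true_and, Fin.lt_def] at hn
    have := (k m).isLt
    simp only [Finset.mem_filter, Finset.mem_Ico, collision, decide_eq_true_eq]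
    refine ⟨by omega, n, fun h => by simp [h] at hn, Fin.ext ?_⟩
    rw [phaseArms, phaseArms, hopArms_getD, hopArms_getD]
    rw [if_neg (by omega), if_pos (by omega), if_pos (by omega)]
    omega
  · intro n hn n' hn' h
    simp only [Finset.mem_filter, Finset.mem_univ, true_and, Fin.lt_def] at hn hn'
    exact hk (Fin.ext (by omega))
  · intro j hj
    simp only [Finset.mem_filter, Finset.mem_Ico, collision, decide_eq_true_eq] at hj
    obtain ⟨⟨-, hj⟩, n, hn, h⟩ := hj
    have h := congrArg Fin.val h
    rw [phaseArms, phaseArms, hopArms_getD, hopArms_getD] at h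
    rw [if_pos (by omega : j < 2 * (k m).val)] at h
    have hne : (k n).val ≠ (k m).val := fun h => hn (hk (Fin.ext h))
    have := (k m).isLt
    split_ifs at h
    · exact absurd h hne
    · refine ⟨n, ?_, by omega⟩
      simp only [Finset.mem_filter, Finset.mem_univ, true_and, Fin.lt_def]
      omega
    · omega

/-- The same meetings seen from the lower player. Two sweepers keep the distance of their starting
arms and a sweeper is never on arm `0`, so a sweep collides only with waiting players. -/
theorem sweep_collisions {M : ℕ} {k : Fin M → Fin K} (hk : Function.Injective k) (m : Fin M) :
    ((Finset.Ico (2 * (k m).val) (2 * (k m).val + (K - 1 - (k m).val))).filter fun j =>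
      collision (phaseArms (fun n => hopArms (k n)) j) m = true).card =
      (Finset.univ.filter fun n => k m < k n).card := by
  symm
  refine Finset.card_bij (fun n _ => (k n).val + (k m).val - 1) ?_ ?_ ?_
  · intro n hn
    simp only [Finset.mem_filter, Finset.mem_univ, true_and, Fin.lt_def] at hn
    have := (k n).isLt
    simp only [Finset.mem_filter, Finset.mem_Ico, collision, decide_eq_true_eq]
    refine ⟨by omega, n, fun h => by simp [h] at hn, Fin.ext ?_⟩
    rw [phaseArms, phaseArms, hopArms_getD, hopArms_getD]
    rw [if_pos (by omega), if_neg (by omega), if_pos (by omega)]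
    omega
  · intro n hn n' hn' h
    simp only [Finset.mem_filter, Finset.mem_univ, true_and, Fin.lt_def] at hn hn'
    exact hk (Fin.ext (by omega))
  · intro j hj
    simp only [Finset.mem_filter, Finset.mem_Ico, collision, decide_eq_true_eq] at hj
    obtain ⟨hj, n, hn, h⟩ := hj
    have h := congrArg Fin.val h
    have := (k m).isLt
    rw [phaseArms, phaseArms, hopArms_getD, hopArms_getD] at h
    rw [if_neg (by omega : ¬ j < 2 * (k m).val), if_pos (by omega : j < K - 1 + (k m).val)] at h
    have hne : (k n).val ≠ (k m).val := fun h => hn (hk (Fin.ext h))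
    split_ifs at h
    · refine ⟨n, ?_, by omega⟩
      simp only [Finset.mem_filter, Finset.mem_univ, true_and, Fin.lt_def]
      omega
    · omega

omit [NeZero K] in
theorem rankOf_add_above {M : ℕ} {k : Fin M → Fin K} (hk : Function.Injective k) (m : Fin M) :
    1 + rankOf k m + (Finset.univ.filter fun n => k m < k n).card = M := by
  have h1 : (Finset.univ : Finset (Fin M)) = {m} ∪ (Finset.univ.filter fun n => k n < k m) ∪
      (Finset.univ.filter fun n => k m < k n) := by
    ext n
    simp only [Finset.mem_univ, Finset.mem_union, Finset.mem_singleton, Finset.mem_filter, true_and,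
      true_iff]
    rcases lt_trichotomy (k n) (k m) with h | h | h
    · tauto
    · exact .inl (.inl (hk h))
    · tauto
  have h2 := congrArg Finset.card h1
  rw [Finset.card_union_of_disjoint, Finset.card_union_of_disjoint, Finset.card_singleton,
    Finset.card_univ, Fintype.card_fin] at h2
  · exact h2.symm
  · rw [Finset.disjoint_singleton_left]; simp
  · rw [Finset.disjoint_left]
    intro n hn hn'
    simp only [Finset.mem_union, Finset.mem_singleton, Finset.mem_filter, Finset.mem_univ,
      true_and] at hn hn'
    rcases hn with rfl | hn
    · exact lt_irrefl _ hn'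
    · exact lt_asymm hn hn'

omit [NeZero K] in
/-- The ranks are a permutation of the players. -/
theorem exists_rank_equiv {M : ℕ} {k : Fin M → Fin K} (hk : Function.Injective k) :
    ∃ ρ : Fin M ≃ Fin M, ∀ m, (ρ m).val = rankOf k m := by
  have hlt : ∀ m, rankOf k m < M := fun m => by have := rankOf_add_above hk m; omega
  have hmono : ∀ m m', k m < k m' → rankOf k m < rankOf k m' := by
    intro m m' h
    refine Finset.card_lt_card ⟨fun n hn => ?_, fun hs => ?_⟩
    · simp only [Finset.mem_filter, Finset.mem_univ, true_and] at hn ⊢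
      exact hn.trans h
    · have : m ∈ Finset.univ.filter fun n => k n < k m := hs (by simpa using h)
      simp at this
  have hinj : Function.Injective fun m => (⟨rankOf k m, hlt m⟩ : Fin M) := by
    intro m m' h
    have h := congrArg Fin.val h
    simp only at h
    rcases lt_trichotomy (k m) (k m') with h' | h' | h'
    · exact absurd h (hmono _ _ h').ne
    · exact hk h'
    · exact absurd h (hmono _ _ h').ne'
  exact ⟨Equiv.ofBijective _ (Finite.injective_iff_bijective.1 hinj), fun m => rfl⟩

/-- If the players occupy different arms before sequential hopping, then they know their ranks and
their number after it. -/
theorem remaining_hopping {n : ℕ} (hK : n + 1 ≤ K) {prog : Prog K Unit}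
    {v : ℕ → Fin (n + 1) → Fin K} {y : ℕ → Fin (n + 1) → Fin K → ℝ} {t : ℕ} (tie : TieBreak K)
    (c T : ℕ) {k : Fin (n + 1) → Fin K} (hk : Function.Injective k)
    {ρ : Fin (n + 1) ≃ Fin (n + 1)} (hρ : ∀ m, (ρ m).val = rankOf k m)
    (h : ∀ m, remaining prog v y t m = Prog.bind (Prog.pullSeq (hopArms (k m))) fun o =>
        afterInit tie c T (1 + numCollisions (o.take (2 * (k m).val)))
          (1 + numCollisions (o.take (2 * (k m).val)) +
            numCollisions ((o.drop (2 * (k m).val)).take (armsAbove (k m)))))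
    (m : Fin (n + 1)) : remaining prog v y (t + (2 * K - 2)) m =
      epochProg tie c T hK T 1 Finset.univ (fun _ _ => 0) (Fin.castLE hK) (ρ m) := by
  obtain ⟨-, h1⟩ := remaining_phase (Equiv.refl _) (t := t) (N := 2 * K - 2)
    (L := fun m => hopArms (k m)) (fun m => length_hopArms _)
    (k := fun m o => afterInit tie c T (1 + numCollisions (o.take (2 * (k m).val)))
          (1 + numCollisions (o.take (2 * (k m).val)) +
            numCollisions ((o.drop (2 * (k m).val)).take (armsAbove (k m))))) h
  have hkm := (k m).isLt
  have hw := numCollisions_phaseObs y (fun m => hopArms (k m)) t (2 * K - 2) 0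
    (2 * (k m).val) (by omega) m
  have hs := numCollisions_phaseObs y (fun m => hopArms (k m)) t (2 * K - 2)
    (2 * (k m).val) (K - 1 - (k m).val) (by omega) m
  rw [wait_collisions hk, List.drop_zero] at hw
  rw [sweep_collisions hk] at hs
  rw [h1 m]
  simp only [Equiv.refl_apply, Equiv.refl_symm, armsAbove_eq, hw, hs]
  rw [rankOf_add_above hk, ← hρ m]
  generalize ρ m = i
  simp only [afterInit, epochProg]
  refine Fin.cases ?_ (fun i => ?_) i
  · simp [hK]
  · rw [if_neg (by simp), Fin.cons_succ]
    have : 1 + (i.succ : Fin (n + 1)).val = i.val + 2 := by simp; omega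
    rw [this]
    congr 1
    refine Fin.ext ?_
    have := i.isLt
    simp only [Fin.val_ofNat, Fin.val_castLE, Fin.val_succ]
    rw [Nat.mod_eq_of_lt (by omega)]
    omega

end Hopping

/-! ### Musical chairs -/

section Chairs

variable {M K : ℕ}

/-- The arms that are occupied after `t` rounds of musical chairs. -/
def chairs (v : ℕ → Fin M → Fin K) : ℕ → Fin M → Option (Fin K)
  | 0, _ => none
  | t + 1, m => (chairs v t m).elim
      (if collision (fun n => (chairs v t n).getD (v t n)) m then none else some (v t m)) some

variable [NeZero K]

theorem remaining_musicalChairs {N : ℕ} {f : Option (Fin K) → Prog K Unit}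
    (v : ℕ → Fin M → Fin K) (y : ℕ → Fin M → Fin K → ℝ) (m : Fin M) :
    remaining (Prog.bind (musicalChairs N none) f) v y N m = f (chairs v N m) := by
  have key : ∀ t l, t + l = N → ∀ m, remaining (Prog.bind (musicalChairs N none) f) v y t m =
      Prog.bind (musicalChairs l (chairs v t m)) f := by
    intro t
    induction t with
    | zero => rintro l hl m; rw [← hl, zero_add]; rfl
    | succ t ih =>
      intro l hl m
      have h1 := ih (l + 1) (by omega)
      have harm : (fun n => (remaining (Prog.bind (musicalChairs N none) f) v y t n).arm (v t n)) =
          fun n => (chairs v t n).getD (v t n) := by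
        funext n
        rw [h1 n]
        cases chairs v t n <;> rfl
      simp only [remaining, harm]
      rw [h1 m]
      simp only [chairs]
      rcases hc : chairs v t m with _ | k
      · simp only [musicalChairs, Prog.bind, Prog.step, Option.elim]
      · simp only [musicalChairs, Prog.bind, Prog.step, Option.elim]
  exact key N 0 (by simp) m

omit [NeZero K] in
-- A player sits down only in a round without collision, and a seated player keeps pulling her arm,
-- so nobody can join her.
theorem chairs_injective (v : ℕ → Fin M → Fin K) (t : ℕ) {m m' : Fin M} {k : Fin K}
    (h : chairs v t m = some k) (h' : chairs v t m' = some k) : m = m' := by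
  have harm : ∀ t m k, chairs v (t + 1) m = some k → (chairs v t m).getD (v t m) = k := by
    intro t m k h
    simp only [chairs] at h
    rcases hc : chairs v t m with _ | k' <;> simp only [hc, Option.elim] at h ⊢
    · split_ifs at h; exact Option.some.inj h
    · exact Option.some.inj h
  have hcol : ∀ t m k, chairs v (t + 1) m = some k → chairs v t m = none →
      collision (fun n => (chairs v t n).getD (v t n)) m = false := by
    intro t m k h h'
    simp only [chairs, h', Option.elim] at h
    split_ifs at h with h1
    simpa using h1
  induction t with
  | zero => simp [chairs] at h
  | succ t ih =>
    have ha := harm t m k h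
    have ha' := harm t m' k h'
    have hcase : ∀ m m', chairs v (t + 1) m = some k → chairs v (t + 1) m' = some k →
        chairs v t m = none → m = m' := by
      intro m m' h h' h0
      have := hcol t m k h h0
      simp only [collision, decide_eq_false_iff_not, not_exists, not_and] at this
      by_contra hne
      exact this m' (Ne.symm hne) ((harm t m' k h').trans (harm t m k h).symm)
    rcases hc : chairs v t m with _ | k1
    · exact hcase m m' h h' hc
    · rcases hc' : chairs v t m' with _ | k2
      · exact (hcase m' m h' h hc').symm
      · rw [hc] at ha
        rw [hc'] at ha'
        simp only [Option.getD_some] at ha ha'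
        subst ha ha'
        exact ih hc hc'

omit [NeZero K] in
theorem chairs_congr {v v' : ℕ → Fin M → Fin K} {t : ℕ} (h : ∀ s < t, v s = v' s) :
    chairs v t = chairs v' t := by
  induction t with
  | zero => rfl
  | succ t ih =>
    funext m
    simp only [chairs, ih fun s hs => h s (by omega), h t (by omega)]

end Chairs

/-! ### The probability that musical chairs fails -/

section ChairsProbability

variable {Ω : Type*} [MeasurableSpace Ω] {M K : ℕ} [NeZero K] {P : Measure Ω}
  [IsProbabilityMeasure P] {V : ℕ → Fin M → Ω → Fin K}

open scoped Classical in
/-- An arm that is not in the given set, if there is one. -/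
noncomputable def freeArm (S : Finset (Fin K)) : Fin K :=
  if h : ∃ k, k ∉ S then h.choose else 0

theorem freeArm_notMem {S : Finset (Fin K)} (h : S.card < K) : freeArm S ∉ S := by
  have : ∃ k, k ∉ S := by
    by_contra! hall
    have : S = Finset.univ := Finset.eq_univ_iff_forall.2 hall
    simp [this] at h
  rw [freeArm, dif_pos this]
  exact this.choose_spec

/-- The arms pulled by the players other than `m` in round `t` of musical chairs. -/
noncomputable def otherArms (v : ℕ → Fin M → Fin K) (t : ℕ) (m : Fin M) : Finset (Fin K) :=
  (Finset.univ.erase m).image fun n => (chairs v t n).getD (v t n)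

/-- As `M ≤ K`, the other players leave an arm free, and drawing it seats the player. Singling out
one free arm makes the probability of this way of success exactly `1/K`. -/
theorem chairs_succ_eq_none (hMK : M ≤ K) {v : ℕ → Fin M → Fin K} {t : ℕ} {m : Fin M}
    (h : chairs v (t + 1) m = none) :
    chairs v t m = none ∧ v t m ≠ freeArm (otherArms v t m) := by
  have h0 : chairs v t m = none := by
    rcases hc : chairs v t m with _ | k
    · rfl
    · simp [chairs, hc] at h
  refine ⟨h0, fun heq => ?_⟩
  have hcard : (otherArms v t m).card < K := by
    refine Finset.card_image_le.trans_lt ?_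
    rw [Finset.card_erase_of_mem (Finset.mem_univ _), Finset.card_univ, Fintype.card_fin]
    have := m.isLt
    omega
  have hfree := freeArm_notMem hcard
  rw [← heq] at hfree
  have : collision (fun n => (chairs v t n).getD (v t n)) m = false := by
    simp only [collision, decide_eq_false_iff_not, not_exists, not_and]
    intro n hn h
    refine hfree (Finset.mem_image.2 ⟨n, by simp [hn], ?_⟩)
    rw [h, h0]; rfl
  simp [chairs, h0, this] at h

omit [IsProbabilityMeasure P] in
-- The chosen free arm is determined by the earlier draws and by the other players' draws of round
-- `t`, all independent of `V t m`; one sums over its value.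
theorem chairs_none_inter (hm : ∀ t m, Measurable (V t m))
    (hu : ∀ t m k, P {ω | V t m ω = k} = (K : ENNReal)⁻¹)
    (hind : iIndepFun (fun (i : ℕ × Fin M) (ω : Ω) => V i.1 i.2 ω) P) (t : ℕ) (m : Fin M) :
    P {ω | chairs (fun t m => V t m ω) t m = none ∧
      V t m ω = freeArm (otherArms (fun t m => V t m ω) t m)} =
      P {ω | chairs (fun t m => V t m ω) t m = none} * (K : ENNReal)⁻¹ := by
  classical
  let S : Finset (ℕ × Fin M) := (Finset.range t ×ˢ Finset.univ) ∪ ({t} ×ˢ Finset.univ.erase m)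
  have hdisj : Disjoint S {(t, m)} := by simp [S]
  have key := hind.indepFun_finset S {(t, m)} hdisj fun i => hm i.1 i.2
  let ext (x : S → Fin K) : ℕ → Fin M → Fin K :=
    fun s n => if hs : (s, n) ∈ S then x ⟨(s, n), hs⟩ else 0
  have hch : ∀ ω, chairs (ext fun i => V i.1.1 i.1.2 ω) t = chairs (fun t m => V t m ω) t := by
    intro ω
    refine chairs_congr fun s hs => funext fun n => ?_
    simp [ext, S, hs]
  have hoth : ∀ ω, otherArms (ext fun i => V i.1.1 i.1.2 ω) t m =
      otherArms (fun t m => V t m ω) t m := by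
    intro ω
    unfold otherArms
    rw [hch]
    refine Finset.image_congr fun n hn => ?_
    have hn : n ≠ m := by simpa using hn
    simp [ext, S, hn]
  let A (k : Fin K) : Set (S → Fin K) :=
    {x | chairs (ext x) t m = none ∧ freeArm (otherArms (ext x) t m) = k}
  let B (k : Fin K) : Set (({(t, m)} : Finset (ℕ × Fin M)) → Fin K) :=
    {x | x ⟨(t, m), Finset.mem_singleton_self _⟩ = k}
  let A' (k : Fin K) : Set Ω := {ω | chairs (fun t m => V t m ω) t m = none ∧
      freeArm (otherArms (fun t m => V t m ω) t m) = k}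
  have hA' : ∀ k, A' k = (fun ω (i : S) => V i.1.1 i.1.2 ω) ⁻¹' A k := by
    intro k; ext ω
    simp only [A', A, Set.mem_ofPred_eq, Set.mem_preimage, hch, hoth]
  have hmeas : Measurable fun ω (i : S) => V i.1.1 i.1.2 ω :=
    measurable_pi_lambda _ fun i => hm _ _
  have hA'm : ∀ k, MeasurableSet (A' k) := fun k => by
    rw [hA']; exact hmeas (Set.toFinite _).measurableSet
  have hprod : ∀ k, P (A' k ∩ {ω | V t m ω = k}) = P (A' k) * (K : ENNReal)⁻¹ := by
    intro k
    have := key.measure_inter_preimage_eq_mul (A k) (B k) (Set.toFinite _).measurableSet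
      (Set.toFinite _).measurableSet
    rw [← hA' k] at this
    rw [← hu t m k]
    exact this
  have h1 : {ω | chairs (fun t m => V t m ω) t m = none ∧
      V t m ω = freeArm (otherArms (fun t m => V t m ω) t m)} =
      ⋃ k, A' k ∩ {ω | V t m ω = k} := by
    ext ω
    simp only [A', Set.mem_ofPred_eq, Set.mem_iUnion, Set.mem_inter_iff]
    constructor
    · rintro ⟨h, h'⟩; exact ⟨_, ⟨h, rfl⟩, h'⟩
    · rintro ⟨k, ⟨h, h'⟩, h''⟩; exact ⟨h, h''.trans h'.symm⟩
  have h2 : {ω | chairs (fun t m => V t m ω) t m = none} = ⋃ k, A' k := by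
    ext ω
    simp [A']
  have hd : Pairwise (Function.onFun Disjoint A') := by
    intro k k' hkk'
    rw [Function.onFun, Set.disjoint_left]
    rintro ω ⟨-, h⟩ ⟨-, h'⟩
    exact hkk' (h.symm.trans h')
  have hVm : ∀ k, MeasurableSet {ω | V t m ω = k} := fun k => hm t m (measurableSet_singleton k)
  rw [h1, h2, measure_iUnion (fun k k' hkk' => (hd hkk').mono Set.inter_subset_left
    Set.inter_subset_left) fun k => (hA'm k).inter (hVm k),
    measure_iUnion hd hA'm, ← ENNReal.tsum_mul_right]
  exact tsum_congr hprod

omit [NeZero K] in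
/-- An event that depends on finitely many draws only is measurable. -/
theorem measurableSet_of_finite_rounds {s : Set (ℕ → Fin M → Fin K)} (t : ℕ)
    (h : ∀ v v' : ℕ → Fin M → Fin K, (∀ i < t, v i = v' i) → v ∈ s → v' ∈ s) : MeasurableSet s := by
  let r : (ℕ → Fin M → Fin K) → Fin t → Fin M → Fin K := fun v i => v i
  have hr : Measurable r := by fun_prop
  have : s = r ⁻¹' (r '' s) := by
    refine subset_antisymm (Set.subset_preimage_image r s) ?_
    rintro v' ⟨v, hv, hvv'⟩
    exact h v v' (fun i hi => congrFun hvv' ⟨i, hi⟩) hv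
  rw [this]
  exact hr (Set.toFinite _).measurableSet

omit [NeZero K] in
theorem measurableSet_chairs_none (t : ℕ) (m : Fin M) :
    MeasurableSet {v : ℕ → Fin M → Fin K | chairs v t m = none} :=
  measurableSet_of_finite_rounds t fun v v' h hv => by
    rw [Set.mem_ofPred_eq] at hv ⊢
    rwa [← chairs_congr h]

theorem prob_chairs_none_le (hMK : M ≤ K) (hm : ∀ t m, Measurable (V t m))
    (hu : ∀ t m k, P {ω | V t m ω = k} = (K : ENNReal)⁻¹)
    (hind : iIndepFun (fun (i : ℕ × Fin M) (ω : Ω) => V i.1 i.2 ω) P) (t : ℕ) (m : Fin M) :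
    P.real {ω | chairs (fun t m => V t m ω) t m = none} ≤ (1 - (K : ℝ)⁻¹) ^ t := by
  induction t with
  | zero => simp [chairs]
  | succ t ih =>
    have h1 := chairs_none_inter hm hu hind t m
    set A := {ω | chairs (fun t m => V t m ω) t m = none}
    set B := {ω | chairs (fun t m => V t m ω) t m = none ∧
      V t m ω = freeArm (otherArms (fun t m => V t m ω) t m)}
    have hBA : B ⊆ A := fun ω h => h.1
    have hsub : {ω | chairs (fun t m => V t m ω) (t + 1) m = none} ⊆ A \ B := by
      intro ω hω
      have := chairs_succ_eq_none hMK hω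
      exact ⟨this.1, fun h => this.2 h.2⟩
    have hB : P.real B = P.real A * (K : ℝ)⁻¹ := by
      simp [measureReal_def, h1, ENNReal.toReal_mul]
    have hK : (0 : ℝ) ≤ 1 - (K : ℝ)⁻¹ := by
      have : (1 : ℝ) ≤ K := by exact_mod_cast NeZero.one_le
      have := inv_le_one_of_one_le₀ this
      linarith
    have hBm : MeasurableSet B := by
      have hVm : Measurable fun ω t m => V t m ω :=
        measurable_pi_lambda _ fun t => measurable_pi_lambda _ fun m => hm t m
      refine hVm (measurableSet_of_finite_rounds (t + 1) (s := {v | chairs v t m = none ∧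
        v t m = freeArm (otherArms v t m)}) fun v v' h hv => ?_)
      have h1 : chairs v t = chairs v' t := chairs_congr fun s hs => h s (by omega)
      simp only [Set.mem_ofPred_eq, otherArms, h1, h t (by omega)] at hv ⊢
      exact hv
    calc _ ≤ P.real (A \ B) := measureReal_mono hsub
      _ = P.real A - P.real B := measureReal_sdiff hBA hBm
      _ = P.real A * (1 - (K : ℝ)⁻¹) := by rw [hB]; ring
      _ ≤ (1 - (K : ℝ)⁻¹) ^ t * (1 - (K : ℝ)⁻¹) := by gcongr
      _ = _ := by rw [pow_succ]

/-- The set of draws for which some player has not found a free arm. -/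
def chairsFail (M K t : ℕ) : Set (ℕ → Fin M → Fin K) := {v | ∃ m, chairs v t m = none}

omit [NeZero K] in
theorem measurableSet_chairsFail (t : ℕ) : MeasurableSet (chairsFail M K t) := by
  have : chairsFail M K t = ⋃ m, {v | chairs v t m = none} := by
    ext v; simp [chairsFail]
  rw [this]
  exact .iUnion fun m => measurableSet_chairs_none t m

theorem prob_chairsFail_le (hMK : M ≤ K) (hm : ∀ t m, Measurable (V t m))
    (hu : ∀ t m k, P {ω | V t m ω = k} = (K : ENNReal)⁻¹)
    (hind : iIndepFun (fun (i : ℕ × Fin M) (ω : Ω) => V i.1 i.2 ω) P) {T : ℕ} (hT : 0 < T) :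
    P.real {ω | (fun t m => V t m ω) ∈ chairsFail M K (chairRounds K T)} ≤ M / (K ^ 2 * T) := by
  have hK : (0 : ℝ) < K := by exact_mod_cast NeZero.pos K
  have hT' : (0 : ℝ) < T := by exact_mod_cast hT
  set N := chairRounds K T
  have h1 : {ω | (fun t m => V t m ω) ∈ chairsFail M K N} =
      ⋃ m, {ω | chairs (fun t m => V t m ω) N m = none} := by
    ext ω; simp [chairsFail]
  -- From `1 - 1/K ≤ exp (-1/K)`; the number of rounds is chosen so that `N / K ≥ ln (K²T)`.
  have h2 : (1 - (K : ℝ)⁻¹) ^ N ≤ 1 / (K ^ 2 * T) := by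
    have hKi : (K : ℝ)⁻¹ ≤ 1 := inv_le_one_of_one_le₀ (by exact_mod_cast NeZero.one_le)
    have hN : (K : ℝ) * Real.log (K ^ 2 * T) ≤ N := by
      have := Nat.le_ceil ((K : ℝ) * Real.log (K / (1 / ((K : ℝ) * T))))
      have he : (K : ℝ) / (1 / ((K : ℝ) * T)) = K ^ 2 * T := by field_simp
      calc _ = (K : ℝ) * Real.log (K / (1 / ((K : ℝ) * T))) := by rw [he]
        _ ≤ N := this
    calc (1 - (K : ℝ)⁻¹) ^ N ≤ (Real.exp (-(K : ℝ)⁻¹)) ^ N := by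
          refine pow_le_pow_left₀ (by linarith) ?_ _
          have := Real.add_one_le_exp (-(K : ℝ)⁻¹)
          linarith
      _ = Real.exp (-(N / K)) := by rw [← Real.exp_nat_mul]; congr 1; ring
      _ ≤ Real.exp (-Real.log (K ^ 2 * T)) := by
          gcongr
          rw [le_div_iff₀ hK]; linarith
      _ = 1 / (K ^ 2 * T) := by
          rw [Real.exp_neg, Real.exp_log (by positivity), one_div]
  rw [h1]
  calc _ ≤ ∑ m : Fin M, P.real {ω | chairs (fun t m => V t m ω) N m = none} :=
        measureReal_iUnion_fintype_le _
    _ ≤ ∑ _m : Fin M, 1 / ((K : ℝ) ^ 2 * T) := Finset.sum_le_sum fun m _ =>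
        (prob_chairs_none_le hMK hm hu hind N m).trans h2
    _ = _ := by simp; ring

end ChairsProbability

/-! ### The plans of the leader as functions of the rewards -/

section Plans

variable {n K : ℕ} [NeZero K]

/-- The first round of the exploration in an epoch that starts in round `t`. -/
def exploreStart (t : ℕ) (d : Plan n K) : ℕ :=
  t + (n * sizeBits (n + 1) K + n * ((d.2.1.length + 2) * armBits K))

/-- The first round after epoch `p`, whose exploration starts in round `s`. -/
def epochEnd (c p s : ℕ) (d : Plan n K) : ℕ :=
  s + d.2.1.length * 2 ^ p ^ c + n * (K * meanBits c p)

/-- The first round of the exploration and the plan of epoch `q + 1`, if the first epoch starts in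
round `t` and all epochs are explored. -/
noncomputable def planAt (tie : TieBreak K) (c T : ℕ) (h : n + 1 ≤ K) (t : ℕ)
    (z : ℕ → Fin (n + 1) → Fin K → ℝ) : ℕ → ℕ × Plan n K
  | 0 =>
      let d := epochPlan tie c T h 1 Finset.univ fun _ _ => 0
      (exploreStart t d, d)
  | q + 1 =>
      let S := planAt tie c T h t z q
      let d := epochPlan tie c T h (q + 2) S.2.1 (blockEstimates z S.1 c (q + 1) S.2.2.1)
      (exploreStart (epochEnd c (q + 1) S.1 S.2) d, d)

theorem blockObs_eq_ofFn (z : ℕ → Fin (n + 1) → Fin K → ℝ) (s c p : ℕ)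
    (C : List (Matching (n + 1) K)) (i : Fin (n + 1)) :
    blockObs z s c p C i = List.ofFn fun j : Fin (exploreArms c p C i).length =>
      (z (s + j) i ((exploreArms c p C i)[j]), false) := by
  refine List.ext_getElem (by simp [blockObs, length_exploreArms]) fun j h1 h2 => ?_
  have hj : j < (exploreArms c p C i).length := by simpa using h2
  simp [blockObs, hj]

/-- The rounds in which player `i` explores arm `k`. -/
def blockRounds (s c p : ℕ) (C : List (Matching (n + 1) K)) (i : Fin (n + 1)) (k : Fin K) :
    Finset ℕ :=
  (Finset.univ.filter fun j : Fin (exploreArms c p C i).length =>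
    (exploreArms c p C i)[j] = k).map ⟨fun j => s + j.val, fun a b h => Fin.ext (by simpa using h)⟩

omit [NeZero K] in
theorem sum_ite_getElem_eq_count (l : List (Fin K)) (k : Fin K) :
    (∑ j : Fin l.length, if l[j] = k then 1 else 0) = l.count k := by
  induction l with
  | nil => rfl
  | cons a l ih =>
    refine (Fin.sum_univ_succ (n := l.length) _).trans ?_
    rw [List.count_cons, ← ih, add_comm]
    by_cases ha : a = k <;> simp [ha]

omit [NeZero K] in
theorem card_blockRounds (s c p : ℕ) (C : List (Matching (n + 1) K)) (i : Fin (n + 1)) (k : Fin K) :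
    (blockRounds s c p C i k).card = (exploreArms c p C i).count k := by
  rw [blockRounds, Finset.card_map, Finset.card_filter, sum_ite_getElem_eq_count]

theorem blockMean_eq (z : ℕ → Fin (n + 1) → Fin K → ℝ) (s c p : ℕ)
    (C : List (Matching (n + 1) K)) (i : Fin (n + 1)) (k : Fin K) :
    blockMean z s c p C i k = (∑ t ∈ blockRounds s c p C i k, z t i k) /
      (blockRounds s c p C i k).card := by
  rw [blockMean, blockObs_eq_ofFn, empiricalMean_ofFn, card_blockRounds]
  split_ifs with h
  · simp [h]
  · congr 1
    rw [blockRounds, Finset.sum_map, Finset.sum_filter]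
    refine Finset.sum_congr rfl fun j _ => ?_
    split_ifs with h
    · simp only [h]; rfl
    · rfl

omit [NeZero K] in
-- An edge may lie on several candidates, which only adds samples; hence an inequality.
theorem two_pow_le_card_blockRounds (s c p : ℕ) {C : List (Matching (n + 1) K)} {i : Fin (n + 1)}
    {k : Fin K} (h : ∃ π ∈ C, π i = k) : 2 ^ p ^ c ≤ (blockRounds s c p C i k).card := by
  obtain ⟨π, hπ, rfl⟩ := h
  rw [card_blockRounds, exploreArms, List.count_flatMap]
  refine le_trans ?_ (List.single_le_sum (by simp) _ (List.mem_map_of_mem hπ))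
  simp

omit [NeZero K] in
theorem mem_blockRounds {s c p : ℕ} {C : List (Matching (n + 1) K)} {i : Fin (n + 1)}
    {k : Fin K} {t : ℕ} (h : t ∈ blockRounds s c p C i k) :
    s ≤ t ∧ t < s + C.length * 2 ^ p ^ c := by
  obtain ⟨j, -, rfl⟩ := Finset.mem_map.1 h
  have := j.isLt.trans_eq (length_exploreArms c p C i)
  change s ≤ s + j.val ∧ s + j.val < _
  omega

theorem blockMean_congr {z z' : ℕ → Fin (n + 1) → Fin K → ℝ} {s c p : ℕ}
    {C : List (Matching (n + 1) K)}
    (h : ∀ t, s ≤ t → t < s + C.length * 2 ^ p ^ c → z t = z' t) (i : Fin (n + 1)) (k : Fin K) :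
    blockMean z s c p C i k = blockMean z' s c p C i k := by
  rw [blockMean_eq, blockMean_eq]
  congr 1
  refine Finset.sum_congr rfl fun t ht => ?_
  have := mem_blockRounds ht
  rw [h t this.1 this.2]

theorem measurable_blockMean (s c p : ℕ) (C : List (Matching (n + 1) K)) (i : Fin (n + 1))
    (k : Fin K) : Measurable fun z => blockMean z s c p C i k := by
  simp only [blockMean_eq]
  fun_prop

theorem blockEstimates_congr {z z' : ℕ → Fin (n + 1) → Fin K → ℝ} {s c p : ℕ}
    {C : List (Matching (n + 1) K)}
    (h : ∀ t, s ≤ t → t < s + C.length * 2 ^ p ^ c → z t = z' t) :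
    blockEstimates z s c p C = blockEstimates z' s c p C := by
  funext i k
  refine Fin.cases ?_ (fun i => ?_) i
  · exact blockMean_congr h 0 k
  · simp only [blockEstimates, Fin.cons_succ, blockMean_congr h]

theorem measurable_blockEstimates (s c p : ℕ) (C : List (Matching (n + 1) K)) :
    Measurable fun z => blockEstimates z s c p C := by
  refine measurable_pi_lambda _ fun i => measurable_pi_lambda _ fun k => ?_
  refine Fin.cases ?_ (fun i => ?_) i
  · exact measurable_blockMean s c p C 0 k
  · simp only [blockEstimates, Fin.cons_succ]
    exact ((measurable_of_countable _).comp ((measurable_truncate _).comp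
      (measurable_blockMean s c p C i.succ k))).div_const _

variable (tie : TieBreak K) (c T : ℕ) (h : n + 1 ≤ K) (t : ℕ)

theorem measurableSet_planAt (q : ℕ) (S : ℕ × Plan n K) :
    MeasurableSet {z | planAt tie c T h t z q = S} := by
  induction q generalizing S with
  | zero => simp only [planAt]; exact .const _
  | succ q ih =>
    have : {z | planAt tie c T h t z (q + 1) = S} = ⋃ S' : ℕ × Plan n K,
        {z | planAt tie c T h t z q = S'} ∩ ⋃ d : Plan n K,
          {_z | (exploreStart (epochEnd c (q + 1) S'.1 S'.2) d, d) = S} ∩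
          {z | epochPlan tie c T h (q + 2) S'.2.1
            (blockEstimates z S'.1 c (q + 1) S'.2.2.1) = d} := by
      ext z
      simp only [Set.mem_ofPred_eq, Set.mem_iUnion, Set.mem_inter_iff, planAt]
      constructor
      · intro hz
        exact ⟨_, rfl, _, hz, rfl⟩
      · rintro ⟨_, rfl, _, hz, rfl⟩
        exact hz
    rw [this]
    exact .iUnion fun S' => (ih S').inter (.iUnion fun d => .inter (.const _)
      (measurable_blockEstimates _ _ _ _ (measurableSet_epochPlan tie c T h _ _ d)))

/-- The start of an exploration behaves like a stopping time: the plan, this round included, is read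
off from the rewards before it. -/
theorem planAt_congr {z z' : ℕ → Fin (n + 1) → Fin K → ℝ} (q : ℕ)
    (hz : ∀ s < (planAt tie c T h t z q).1, z s = z' s) :
    planAt tie c T h t z q = planAt tie c T h t z' q := by
  induction q with
  | zero => rfl
  | succ q ih =>
    have hle : ∀ d : Plan n K, (planAt tie c T h t z q).1 +
        (planAt tie c T h t z q).2.2.1.length * 2 ^ (q + 1) ^ c ≤
        exploreStart (epochEnd c (q + 1) (planAt tie c T h t z q).1 (planAt tie c T h t z q).2)
          d := by
      intro d; unfold exploreStart epochEnd; omega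
    have h1 := ih fun s hs => hz s (hs.trans_le
      ((Nat.le_add_right _ _).trans (hle _)))
    simp only [planAt]
    rw [← h1, blockEstimates_congr fun s _ hs => hz s (hs.trans_le (hle _))]

/-- Some mean of the exploration of epoch `q + 1` is not within `ε` of the true mean. -/
def badEpoch (μ : Fin (n + 1) → Fin K → ℝ) (q : ℕ) : Set (ℕ → Fin (n + 1) → Fin K → ℝ) :=
  {z | ∃ i k, (∃ π ∈ (planAt tie c T h t z q).2.2.1, π i = k) ∧
    epsilon c (n + 1) K T (q + 1) < |blockMean z (planAt tie c T h t z q).1 c (q + 1)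
      (planAt tie c T h t z q).2.2.1 i k - μ i k|}

theorem measurableSet_badEpoch (μ : Fin (n + 1) → Fin K → ℝ) (q : ℕ) :
    MeasurableSet (badEpoch tie c T h t μ q) := by
  have : badEpoch tie c T h t μ q = ⋃ i, ⋃ k, ⋃ S : ℕ × Plan n K,
      {z | planAt tie c T h t z q = S} ∩ ({_z | ∃ π ∈ S.2.2.1, π i = k} ∩
        {z | epsilon c (n + 1) K T (q + 1) < |blockMean z S.1 c (q + 1) S.2.2.1 i k - μ i k|}) := by
    ext z
    simp only [badEpoch, Set.mem_ofPred_eq, Set.mem_iUnion, Set.mem_inter_iff]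
    refine exists_congr fun i => exists_congr fun k => ?_
    constructor
    · intro hz; exact ⟨_, rfl, hz⟩
    · rintro ⟨_, rfl, hz⟩; exact hz
  rw [this]
  refine .iUnion fun i => .iUnion fun k => .iUnion fun S =>
    (measurableSet_planAt tie c T h t q S).inter (.inter (.const _) ?_)
  exact measurableSet_lt measurable_const
    (((measurable_blockMean _ _ _ _ _ _).sub_const _).abs)

omit [NeZero K] in
theorem epsilon_eq (c M K T p : ℕ) : epsilon c M K T p =
    √(Real.log (2 * (M : ℝ) ^ 2 * K * (T : ℝ) ^ 2) / 2 ^ (1 + p ^ c)) := by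
  rw [epsilon]
  congr 3
  rw [one_div, div_inv_eq_mul]; ring

variable {Ω : Type*} [MeasurableSpace Ω] {P : Measure Ω} [IsProbabilityMeasure P]
  {μ : Fin (n + 1) → Fin K → ℝ} {Z : Ω → ℕ → Fin (n + 1) → Fin K → ℝ}

/-- For a fixed start and fixed candidates the number of samples is deterministic and at least `2 ^
p ^ c`. The hypothesis on `ε` then turns Hoeffding's `2 exp (-2 · 2 ^ p ^ c · ε²)` into `1/x`, which
plays the part of `δ`. -/
theorem prob_blockMean_le (hZ : IndepRows P μ Z) {p s : ℕ} {C : List (Matching (n + 1) K)}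
    {i : Fin (n + 1)} {k : Fin K} (hex : ∃ π ∈ C, π i = k) {x ε : ℝ} (hx : 0 < x) (hε : 0 ≤ ε)
    (hεx : Real.log (2 * x) = 2 * 2 ^ p ^ c * ε ^ 2) :
    P {ω | ε < |blockMean (Z ω) s c p C i k - μ i k|} ≤ ENNReal.ofReal (1 / x) := by
  have hcard := two_pow_le_card_blockRounds s c p hex
  have hne : (blockRounds s c p C i k).Nonempty :=
    Finset.card_pos.1 (lt_of_lt_of_le (Nat.pos_of_neZero _) hcard)
  have hcard' : (2 : ℝ) ^ p ^ c ≤ (blockRounds s c p C i k).card := by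
    exact_mod_cast hcard
  have h1 := hZ.hoeffding i k _ hne hε
  simp only [← blockMean_eq] at h1
  rw [← ENNReal.ofReal_toReal (measure_ne_top P _)]
  refine ENNReal.ofReal_le_ofReal (h1.trans ?_)
  calc _ ≤ 2 * Real.exp (-Real.log (2 * x)) := by rw [hεx]; gcongr
    _ = 1 / x := by
        rw [Real.exp_neg, Real.exp_log (by positivity)]; field_simp

omit [IsProbabilityMeasure P] in
-- That the plan equals `S` is decided before round `S.1`; the means use only rounds from `S.1` on.
theorem indepFun_planAt_blockMean (hZ : IndepRows P μ Z) (q p : ℕ) (S : ℕ × Plan n K)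
    (i : Fin (n + 1)) (k : Fin K) {B : Set ℝ} (hB : MeasurableSet B) :
    P ({ω | planAt tie c T h t (Z ω) q = S} ∩ {ω | blockMean (Z ω) S.1 c p S.2.2.1 i k ∈ B}) =
      P {ω | planAt tie c T h t (Z ω) q = S} *
        P {ω | blockMean (Z ω) S.1 c p S.2.2.1 i k ∈ B} := by
  classical
  have hmeas := measurableSet_planAt tie c T h t q S
  have hind := hZ.indepFun_past_future S.1 (S.2.2.1.length * 2 ^ p ^ c)
    (f := Set.indicator {z | planAt tie c T h t z q = S} fun _ => (1 : ℝ))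
    (measurable_const.indicator hmeas)
    (fun z z' hzz' => by
      have : z ∈ {z | planAt tie c T h t z q = S} ↔ z' ∈ {z | planAt tie c T h t z q = S} := by
        simp only [Set.mem_ofPred_eq]
        constructor
        · intro hz
          rw [← planAt_congr tie c T h t q (z := z) (by rw [hz]; exact hzz'), hz]
        · intro hz
          rw [← planAt_congr tie c T h t q (z := z') (z' := z)
              (by rw [hz]; exact fun s hs => (hzz' s hs).symm), hz]
      by_cases hz : z ∈ {z | planAt tie c T h t z q = S}
      · rw [Set.indicator_of_mem hz, Set.indicator_of_mem (this.1 hz)]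
      · rw [Set.indicator_of_notMem hz, Set.indicator_of_notMem (mt this.2 hz)])
    (g := fun z => blockMean z S.1 c p S.2.2.1 i k)
    (measurable_blockMean _ _ _ _ _ _) (fun z z' hzz' => blockMean_congr hzz' i k)
  have := hind.measure_inter_preimage_eq_mul {1} B (measurableSet_singleton _) hB
  have e1 : (fun ω => Set.indicator {z | planAt tie c T h t z q = S} (fun _ => (1 : ℝ)) (Z ω)) ⁻¹'
      {1} = {ω | planAt tie c T h t (Z ω) q = S} := by
    ext ω
    simp [Set.indicator_apply]
  rw [e1] at this
  exact this

/-- The random plan is removed by summing over its countably many values: each contributes at most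
its probability times `1/x`. -/
theorem prob_planAt_blockMean_le (hZ : IndepRows P μ Z) (q p : ℕ) (i : Fin (n + 1)) (k : Fin K)
    {x ε : ℝ} (hx : 0 < x) (hε : 0 ≤ ε) (hεx : Real.log (2 * x) = 2 * 2 ^ p ^ c * ε ^ 2) :
    P {ω | (∃ π ∈ (planAt tie c T h t (Z ω) q).2.2.1, π i = k) ∧
      ε < |blockMean (Z ω) (planAt tie c T h t (Z ω) q).1 c p
        (planAt tie c T h t (Z ω) q).2.2.1 i k - μ i k|} ≤ ENNReal.ofReal (1 / x) := by
  let A (S : ℕ × Plan n K) : Set Ω := {ω | planAt tie c T h t (Z ω) q = S}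
  let B (S : ℕ × Plan n K) : Set Ω := {ω | (∃ π ∈ S.2.2.1, π i = k) ∧
    ε < |blockMean (Z ω) S.1 c p S.2.2.1 i k - μ i k|}
  have hA : ∀ S, MeasurableSet (A S) := fun S =>
    hZ.measurable (measurableSet_planAt tie c T h t q S)
  have hprod : ∀ S, P (A S ∩ B S) ≤ P (A S) * ENNReal.ofReal (1 / x) := by
    intro S
    by_cases hex : ∃ π ∈ S.2.2.1, π i = k
    swap
    · simp [B, hex]
    have hBS : B S = {ω | blockMean (Z ω) S.1 c p S.2.2.1 i k ∈ {r | ε < |r - μ i k|}} := by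
      ext ω; simp only [B, hex, true_and, Set.mem_ofPred_eq]
    rw [hBS, indepFun_planAt_blockMean tie c T h t hZ q p S i k
      (measurableSet_lt measurable_const (by fun_prop))]
    simp only [Set.mem_ofPred_eq]
    exact mul_le_mul_right (prob_blockMean_le c hZ hex hx hε hεx) _
  calc _ ≤ P (⋃ S, A S ∩ B S) := measure_mono fun ω hω => by
        simp only [A, B, Set.mem_iUnion, Set.mem_inter_iff, Set.mem_ofPred_eq] at hω ⊢
        exact ⟨_, rfl, hω⟩
    _ ≤ ∑' S, P (A S ∩ B S) := measure_iUnion_le _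
    _ ≤ ∑' S, P (A S) * ENNReal.ofReal (1 / x) := ENNReal.tsum_le_tsum hprod
    _ = P (⋃ S, A S) * ENNReal.ofReal (1 / x) := by
        rw [ENNReal.tsum_mul_right, measure_iUnion _ hA]
        intro S S' hSS'
        rw [Function.onFun, Set.disjoint_left]
        exact fun ω hω hω' => hSS' (hω.symm.trans hω')
    _ ≤ 1 * ENNReal.ofReal (1 / x) := by gcongr; exact prob_le_one
    _ = _ := one_mul _

theorem prob_badEpoch_le (hZ : IndepRows P μ Z) (hT : 0 < T) (q : ℕ) :
    P.real {ω | Z ω ∈ badEpoch tie c T h t μ q} ≤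
      ((n + 1 : ℕ) * K) * (1 / (((n + 1 : ℕ) : ℝ) ^ 2 * K * (T : ℝ) ^ 2)) := by
  have hK1 : (1 : ℝ) ≤ K := by exact_mod_cast NeZero.one_le
  have hT1 : (1 : ℝ) ≤ T := by exact_mod_cast hT
  have hM1 : (1 : ℝ) ≤ (n + 1 : ℕ) := by push_cast; linarith [(Nat.cast_nonneg n : (0 : ℝ) ≤ n)]
  have he := epsilon_eq c (n + 1) K T (q + 1)
  rw [show 2 * ((n + 1 : ℕ) : ℝ) ^ 2 * K * (T : ℝ) ^ 2 =
    2 * (((n + 1 : ℕ) : ℝ) ^ 2 * K * (T : ℝ) ^ 2) by ring] at he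
  have hx1 : 1 ≤ ((n + 1 : ℕ) : ℝ) ^ 2 * K * (T : ℝ) ^ 2 :=
    one_le_mul_of_one_le_of_one_le (one_le_mul_of_one_le_of_one_le (one_le_pow₀ hM1) hK1)
      (one_le_pow₀ hT1)
  generalize ((n + 1 : ℕ) : ℝ) ^ 2 * K * (T : ℝ) ^ 2 = x at *
  have hL : 0 ≤ Real.log (2 * x) := Real.log_nonneg (by linarith)
  have hεx : Real.log (2 * x) = 2 * 2 ^ (q + 1) ^ c * epsilon c (n + 1) K T (q + 1) ^ 2 := by
    rw [he, Real.sq_sqrt (div_nonneg hL (by positivity)), pow_add]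
    field_simp
  have hunion : {ω | Z ω ∈ badEpoch tie c T h t μ q} = ⋃ i, ⋃ k,
      {ω | (∃ π ∈ (planAt tie c T h t (Z ω) q).2.2.1, π i = k) ∧
      epsilon c (n + 1) K T (q + 1) < |blockMean (Z ω) (planAt tie c T h t (Z ω) q).1 c (q + 1)
        (planAt tie c T h t (Z ω) q).2.2.1 i k - μ i k|} := by
    ext ω; simp only [badEpoch, Set.mem_ofPred_eq, Set.mem_iUnion]
  rw [hunion]
  calc _ ≤ ∑ i : Fin (n + 1), ∑ k : Fin K, 1 / x :=
        (measureReal_iUnion_fintype_le _).trans (Finset.sum_le_sum fun i _ =>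
          (measureReal_iUnion_fintype_le _).trans (Finset.sum_le_sum fun k _ =>
            ENNReal.toReal_le_of_le_ofReal (by positivity)
              (prob_planAt_blockMean_le tie c T h t hZ q (q + 1) i k (by linarith)
                (Real.sqrt_nonneg _) hεx)))
    _ = _ := by simp [mul_assoc]

end Plans

/-! ### The elimination rule -/

section Matchings

variable {M K : ℕ}

theorem utility_le_maxUtility (μ : Fin M → Fin K → ℝ) (π : Matching M K) :
    utility μ π ≤ maxUtility μ :=
  le_ciSup (Set.finite_range _).bddAbove π

theorem gap_nonneg (μ : Fin M → Fin K → ℝ) (π : Matching M K) : 0 ≤ gap μ π :=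
  sub_nonneg.2 (utility_le_maxUtility μ π)

theorem utility_nonneg {μ : Fin M → Fin K → ℝ} (hμ : ∀ i k, μ i k ∈ Set.Icc (0 : ℝ) 1)
    (π : Matching M K) : 0 ≤ utility μ π := Finset.sum_nonneg fun i _ => (hμ i _).1

theorem utility_le {μ : Fin M → Fin K → ℝ} (hμ : ∀ i k, μ i k ∈ Set.Icc (0 : ℝ) 1)
    (π : Matching M K) : utility μ π ≤ M :=
  (Finset.sum_le_sum fun i _ => (hμ i _).2).trans (by simp)

theorem minGap_le {μ : Fin M → Fin K → ℝ} {π : Matching M K} (h : 0 < gap μ π) :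
    minGap μ ≤ gap μ π :=
  csInf_le ⟨0, by rintro x ⟨σ, hσ, rfl⟩; exact hσ.le⟩ ⟨π, h, rfl⟩

/-- Composing the standard matching with a transposition of arms. It makes the constrained maximum
through every edge well defined. -/
theorem exists_matching_through (h : M ≤ K) (i : Fin M) (k : Fin K) :
    ∃ π : Matching M K, π i = k :=
  ⟨(Fin.castLEEmb h).trans (Equiv.swap (Fin.castLE h i) k).toEmbedding, by simp⟩

theorem argmaxMatching_spec {tie : TieBreak K} (htie : tie.Valid) (h : M ≤ K)
    (w : Fin M → Fin K → ℝ) {p : Matching M K → Prop} (hp : ∃ π, p π) :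
    p (argmaxMatching tie h w p) ∧ ∀ σ, p σ → utility w σ ≤ utility w (argmaxMatching tie h w p) := by
  classical
  obtain ⟨π, hπ, hmax⟩ := (Set.toFinite {π | p π}).exists_maximalFor (utility w) _ hp
  have hmem := htie M h (Finset.univ.filter fun π => p π ∧ ∀ σ, p σ → utility w σ ≤ utility w π)
    ⟨π, Finset.mem_filter.2 ⟨Finset.mem_univ _, hπ, fun σ hσ => by
      rcases le_total (utility w σ) (utility w π) with h' | h'
      · exact h'
      · exact hmax hσ h'⟩⟩
  have := (Finset.mem_filter.1 hmem).2
  unfold argmaxMatching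
  convert this

end Matchings

/-! ### Consequences of accurate estimates -/

section Elimination

variable {n K : ℕ} {μ : Fin (n + 1) → Fin K → ℝ} {π₀ : Matching (n + 1) K}

/-- The estimates `w` are accurate up to `r` for comparisons with the matching `π₀`. -/
def Accurate (μ : Fin (n + 1) → Fin K → ℝ) (π₀ : Matching (n + 1) K)
    (w : Fin (n + 1) → Fin K → ℝ) (r : ℝ) : Prop :=
  ∃ r₁ r₂, r₁ + r₂ ≤ r ∧ (∀ σ : Matching (n + 1) K, utility w σ ≤ utility μ σ + r₁) ∧
    utility μ π₀ - r₂ ≤ utility w π₀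

variable {tie : TieBreak K} {c T : ℕ} {h : n + 1 ≤ K} {p : ℕ}
  {E : Finset (Fin (n + 1) × Fin K)} {w : Fin (n + 1) → Fin K → ℝ}

theorem mem_epochPlan_edges {e : Fin (n + 1) × Fin K} :
    e ∈ (epochPlan tie c T h p E w).1 ↔ e ∈ E ∧
      utility w (argmaxMatching tie h w fun _ => True) -
        utility w (argmaxMatching tie h w fun π => π e.1 = e.2) ≤
      4 * ((n + 1 : ℕ) : ℝ) * epsilon c (n + 1) K T p := by
  simp only [epochPlan, planOf, Finset.mem_filter, utility, Finset.sum_sub_distrib]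

theorem mem_epochPlan_matchings {π : Matching (n + 1) K} :
    π ∈ (epochPlan tie c T h p E w).2.1 ↔ ∃ e ∈ (epochPlan tie c T h p E w).1,
      (argmaxMatching tie h w fun π => π e.1 = e.2) = π := by
  simp [epochPlan, planOf]

theorem nodup_epochPlan : (epochPlan tie c T h p E w).2.1.Nodup := Finset.nodup_toList _

variable (htie : tie.Valid) (hacc : Accurate μ π₀ w (4 * ((n + 1 : ℕ) : ℝ) * epsilon c (n + 1) K T p))
  (hπ₀ : utility μ π₀ = maxUtility μ)
include htie hacc hπ₀

/-- The estimated maximizer beats `π₀` in estimate; returning to true utilities costs `r₁` for it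
and `r₂` for `π₀`. -/
theorem gap_best_le :
    gap μ (epochPlan tie c T h p E w).2.2 ≤ 4 * ((n + 1 : ℕ) : ℝ) * epsilon c (n + 1) K T p := by
  obtain ⟨r₁, r₂, hr, h1, h2⟩ := hacc
  have h3 := (argmaxMatching_spec htie h w (p := fun _ => True) ⟨π₀, trivial⟩).2 π₀ trivial
  have h4 := h1 (argmaxMatching tie h w fun _ => True)
  have : gap μ (epochPlan tie c T h p E w).2.2 =
    maxUtility μ - utility μ (argmaxMatching tie h w fun _ => True) := rfl
  rw [this]
  linarith

/-- The best matching through an optimal edge has an estimate at least that of `π₀`, and no estimate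
exceeds `U⋆ + r₁`. The difference is within the threshold, so optimal edges are never removed. -/
theorem optimal_edge_mem {i : Fin (n + 1)} (hE : (i, π₀ i) ∈ E) :
    (i, π₀ i) ∈ (epochPlan tie c T h p E w).1 := by
  obtain ⟨r₁, r₂, hr, h1, h2⟩ := hacc
  rw [mem_epochPlan_edges]
  refine ⟨hE, ?_⟩
  have h3 := (argmaxMatching_spec htie h w (p := fun π => π i = π₀ i) ⟨π₀, rfl⟩).2 π₀ rfl
  have h4 := h1 (argmaxMatching tie h w fun _ => True)
  have h5 := utility_le_maxUtility μ (argmaxMatching tie h w fun _ => True)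
  linarith

/-- One threshold `4Mε` comes from surviving the elimination, another from the inaccuracy of the
estimates. -/
theorem gap_assoc_le {e : Fin (n + 1) × Fin K} (he : e ∈ (epochPlan tie c T h p E w).1) :
    gap μ (argmaxMatching tie h w fun π => π e.1 = e.2) ≤
      8 * ((n + 1 : ℕ) : ℝ) * epsilon c (n + 1) K T p := by
  obtain ⟨r₁, r₂, hr, h1, h2⟩ := hacc
  have h3 := (argmaxMatching_spec htie h w (p := fun _ => True) ⟨π₀, trivial⟩).2 π₀ trivial
  have h4 := h1 (argmaxMatching tie h w fun π => π e.1 = e.2)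
  have h5 := (mem_epochPlan_edges.1 he).2
  unfold gap
  linarith

omit htie hacc hπ₀ in
theorem eq_of_gap_eq_zero
    (huniq : ∀ π : Matching (n + 1) K, utility μ π = maxUtility μ → π = π₀)
    {π : Matching (n + 1) K} (hπ : ¬ 0 < gap μ π) : π = π₀ :=
  huniq π (by have := gap_nonneg μ π; unfold gap at *; linarith)

variable (hE : ∀ i, (i, π₀ i) ∈ E)
include hE

theorem optimal_explored (i : Fin (n + 1)) :
    ∃ π ∈ (epochPlan tie c T h p E w).2.1, π i = π₀ i :=
  ⟨_, mem_epochPlan_matchings.2 ⟨_, optimal_edge_mem htie hacc hπ₀ (hE i), rfl⟩,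
    (argmaxMatching_spec htie h w (p := fun π => π i = π₀ i) ⟨π₀, rfl⟩).1⟩

/-- Every optimal edge is covered by some candidate, so a lone candidate contains them all;
exploitation never settles on a wrong matching. -/
theorem eq_of_epochPlan_singleton {π : Matching (n + 1) K}
    (hπ : (epochPlan tie c T h p E w).2.1 = [π]) : π = π₀ := by
  ext i
  obtain ⟨σ, hσ, hi⟩ := optimal_explored (h := h) htie hacc hπ₀ hE i
  rw [hπ, List.mem_singleton] at hσ
  rw [← hσ, hi]

/-- If there are several candidate matchings, then the epoch is early. -/
theorem exists_suboptimal
    (huniq : ∀ π : Matching (n + 1) K, utility μ π = maxUtility μ → π = π₀)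
    (hlen : (epochPlan tie c T h p E w).2.1.length ≠ 1) :
    ∃ π : Matching (n + 1) K, 0 < gap μ π ∧
      gap μ π ≤ 8 * ((n + 1 : ℕ) : ℝ) * epsilon c (n + 1) K T p := by
  -- If no suboptimal matching were that close, then all candidates would be `π₀`; the list is
  -- nonempty and without repetitions, so it would have length one.
  by_contra! hall
  refine hlen ?_
  have h1 : ∀ π ∈ (epochPlan tie c T h p E w).2.1, π = π₀ := by
    intro π hπ
    refine eq_of_gap_eq_zero huniq fun hpos => ?_
    obtain ⟨e, he, rfl⟩ := mem_epochPlan_matchings.1 hπ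
    exact (hall _ hpos).not_ge (gap_assoc_le htie hacc hπ₀ he)
  obtain ⟨σ, hσ, -⟩ := optimal_explored (h := h) htie hacc hπ₀ hE 0
  have h2 : (epochPlan tie c T h p E w).2.1.toFinset = {π₀} := by
    ext π
    rw [List.mem_toFinset, Finset.mem_singleton]
    exact ⟨h1 π, fun hπ => by rw [hπ, ← h1 σ hσ]; exact hσ⟩
  rw [← List.toFinset_card_of_nodup nodup_epochPlan, h2, Finset.card_singleton]

omit hE in
open scoped Classical in
/-- The regret of exploring each candidate matching once. -/
theorem sum_gap_le {g : Fin (n + 1) → Fin K → ℝ}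
    (hg : ∀ i k, ∀ π ∈ suboptimalThrough μ i k, g i k ≤ gap μ π) (hε : 0 ≤ epsilon c (n + 1) K T p) :
    ((epochPlan tie c T h p E w).2.1.map (gap μ)).sum ≤
      ∑ i, ∑ k, if (suboptimalThrough μ i k).Nonempty ∧
          g i k ≤ 8 * ((n + 1 : ℕ) : ℝ) * epsilon c (n + 1) K T p then
        8 * ((n + 1 : ℕ) : ℝ) * epsilon c (n + 1) K T p else 0 := by
  set a : Fin (n + 1) × Fin K → Matching (n + 1) K :=
    fun e => argmaxMatching tie h w fun π => π e.1 = e.2 with ha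
  set x := 8 * ((n + 1 : ℕ) : ℝ) * epsilon c (n + 1) K T p with hx
  have hx0 : 0 ≤ x := by positivity
  have h1 : ((epochPlan tie c T h p E w).2.1.map (gap μ)).sum =
      ∑ π ∈ (epochPlan tie c T h p E w).1.image a, gap μ π := by
    have : (epochPlan tie c T h p E w).2.1 =
      ((epochPlan tie c T h p E w).1.image a).toList := by
      simp only [epochPlan, planOf, a]
    rw [this, Finset.sum_map_toList]
  rw [h1, ← Fintype.sum_prod_type']
  -- Several edges may share a matching, so passing from candidates to edges can only increase the
  -- sum. A positive term at `e` forces `g e.1 e.2` below `8Mε`, which is how an edge ceases to be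
  -- charged in late epochs.
  calc _ ≤ ∑ e ∈ (epochPlan tie c T h p E w).1, gap μ (a e) :=
        Finset.sum_image_le_of_nonneg fun π _ => gap_nonneg μ π
    _ ≤ ∑ e ∈ (epochPlan tie c T h p E w).1,
        if (suboptimalThrough μ e.1 e.2).Nonempty ∧ g e.1 e.2 ≤ x then x else 0 := by
        refine Finset.sum_le_sum fun e he => ?_
        have hle := gap_assoc_le htie hacc hπ₀ he
        by_cases hpos : 0 < gap μ (a e)
        · have hmem : a e ∈ suboptimalThrough μ e.1 e.2 :=
            ⟨(argmaxMatching_spec htie h w (p := fun π => π e.1 = e.2)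
              (exists_matching_through h e.1 e.2)).1, sub_pos.1 hpos⟩
          rw [if_pos ⟨⟨_, hmem⟩, (hg _ _ _ hmem).trans hle⟩]
          exact hle
        · refine (not_lt.1 hpos).trans ?_
          split_ifs <;> simp [hx0]
    _ ≤ _ := Finset.sum_le_sum_of_subset_of_nonneg (Finset.subset_univ _) fun e _ _ => by
        split_ifs <;> simp [hx0]

end Elimination

/-! ### Accuracy of the estimates -/

section Accuracy

theorem truncate_le (b : ℕ) {x : ℝ} (h0 : 0 ≤ x) : (truncate b x : ℝ) / 2 ^ b ≤ x := by
  rw [div_le_iff₀ (by positivity)]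
  have h1 : (truncate b x : ℝ) ≤ (⌊2 ^ b * x⌋₊ : ℕ) := by
    rw [truncate]
    exact Nat.cast_le.2 (min_le_left _ _)
  have := Nat.floor_le (a := 2 ^ b * x) (by positivity)
  linarith

theorem le_truncate (b : ℕ) {x : ℝ} (h1 : x ≤ 1) : x - 1 / 2 ^ b ≤ (truncate b x : ℝ) / 2 ^ b := by
  rw [le_div_iff₀ (by positivity), sub_mul, one_div, inv_mul_cancel₀ (by positivity)]
  rw [truncate, Nat.cast_min]
  refine le_min ?_ ?_
  · have := Nat.sub_one_lt_floor (2 ^ b * x)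
    linarith
  · rw [Nat.cast_sub Nat.one_le_two_pow]
    push_cast
    have : x * 2 ^ b ≤ 1 * 2 ^ b := by gcongr
    linarith

variable {n K : ℕ} [NeZero K] {μ : Fin (n + 1) → Fin K → ℝ} {π₀ : Matching (n + 1) K}

theorem blockMean_mem {z : ℕ → Fin (n + 1) → Fin K → ℝ} (hz : ∀ t i k, z t i k ∈ Set.Icc (0 : ℝ) 1)
    (s c p : ℕ) (C : List (Matching (n + 1) K)) (i : Fin (n + 1)) (k : Fin K) :
    blockMean z s c p C i k ∈ Set.Icc (0 : ℝ) 1 := by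
  rw [blockMean_eq]
  refine ⟨div_nonneg (Finset.sum_nonneg fun t _ => (hz t i k).1) (by positivity),
    div_le_one_of_le₀ ?_ (by positivity)⟩
  calc _ ≤ ∑ _t ∈ blockRounds s c p C i k, (1 : ℝ) := Finset.sum_le_sum fun t _ => (hz t i k).2
    _ = _ := by simp

theorem blockMean_eq_zero (z : ℕ → Fin (n + 1) → Fin K → ℝ) (s c p : ℕ)
    {C : List (Matching (n + 1) K)} {i : Fin (n + 1)} {k : Fin K} (h : ¬ ∃ π ∈ C, π i = k) :
    blockMean z s c p C i k = 0 := by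
  have : (blockRounds s c p C i k).card = 0 := by
    rw [card_blockRounds, List.count_eq_zero, exploreArms, List.mem_flatMap]
    rintro ⟨π, hπ, hk⟩
    exact h ⟨π, hπ, (List.eq_of_mem_replicate hk).symm⟩
  rw [blockMean_eq, this]
  simp

/-- Unexplored edges are estimated by zero, which cannot exceed their means. So overestimation is
bounded for every matching, while underestimation is controlled only for `π₀`, all of whose edges
are explored; this is why `Accurate` is one-sided. Truncation lowers values too, so it enters only
through `π₀`, once per follower. -/
theorem accurate_blockEstimates {z : ℕ → Fin (n + 1) → Fin K → ℝ}
    (hz : ∀ t i k, z t i k ∈ Set.Icc (0 : ℝ) 1) (hμ : ∀ i k, μ i k ∈ Set.Icc (0 : ℝ) 1)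
    {s c p : ℕ} {C : List (Matching (n + 1) K)} {ε : ℝ} (hε : 0 ≤ ε)
    (hgood : ∀ i k, (∃ π ∈ C, π i = k) → |blockMean z s c p C i k - μ i k| ≤ ε)
    (hC : ∀ i, ∃ π ∈ C, π i = π₀ i) :
    Accurate μ π₀ (blockEstimates z s c p C)
      (2 * ((n + 1 : ℕ) : ℝ) * ε + n * (1 / 2 ^ meanBits c p)) := by
  have hmean : ∀ i k, blockMean z s c p C i k ≤ μ i k + ε := by
    intro i k
    by_cases hex : ∃ π ∈ C, π i = k
    · have := (abs_le.1 (hgood i k hex)).2; linarith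
    · rw [blockMean_eq_zero z s c p hex]; have := (hμ i k).1; linarith
  refine ⟨(n + 1 : ℕ) * ε, (n + 1 : ℕ) * ε + n * (1 / 2 ^ meanBits c p), by linarith, ?_, ?_⟩
  · intro σ
    have : utility μ σ + ((n + 1 : ℕ) : ℝ) * ε = ∑ i, (μ i (σ i) + ε) := by
      simp [utility, Finset.sum_add_distrib]
    rw [this]
    refine Finset.sum_le_sum fun i _ => ?_
    refine Fin.cases ?_ (fun i => ?_) i
    · exact hmean 0 _
    · simp only [blockEstimates, Fin.cons_succ]
      exact (truncate_le _ (blockMean_mem hz s c p C _ _).1).trans (hmean _ _)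
  · have hlow : ∀ i, μ i (π₀ i) - ε ≤ blockMean z s c p C i (π₀ i) := by
      intro i
      have := (abs_le.1 (hgood i _ (hC i))).1; linarith
    unfold utility
    rw [Fin.sum_univ_succ, Fin.sum_univ_succ (fun i => blockEstimates z s c p C i (π₀ i))]
    have h0 : μ 0 (π₀ 0) - ε ≤ blockEstimates z s c p C 0 (π₀ 0) := hlow 0
    have h1 : ∑ i : Fin n, (μ i.succ (π₀ i.succ) - ε - 1 / 2 ^ meanBits c p) ≤
        ∑ i : Fin n, blockEstimates z s c p C i.succ (π₀ i.succ) := by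
      refine Finset.sum_le_sum fun i _ => ?_
      simp only [blockEstimates, Fin.cons_succ]
      have := le_truncate (meanBits c p) (blockMean_mem hz s c p C i.succ (π₀ i.succ)).2
      have := hlow i.succ
      linarith
    simp only [Finset.sum_sub_distrib, Finset.sum_const, Finset.card_univ, Fintype.card_fin,
      nsmul_eq_mul] at h1
    push_cast
    linarith

/-- The logarithmic factor of the bound. -/
noncomputable def logFactor (M K T : ℕ) : ℝ := Real.log (2 * (M : ℝ) ^ 2 * K * (T : ℝ) ^ 2)

theorem le_logFactor {M K T : ℕ} (hM : 1 ≤ M) (hK : 2 ≤ K) (hT : 0 < T) : 1 ≤ logFactor M K T := by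
  have hM' : (1 : ℝ) ≤ M := by exact_mod_cast hM
  have hK' : (2 : ℝ) ≤ K := by exact_mod_cast hK
  have hT' : (1 : ℝ) ≤ T := by exact_mod_cast hT
  rw [logFactor, Real.le_log_iff_exp_le (by positivity)]
  calc Real.exp 1 ≤ 2 * 1 ^ 2 * 2 * 1 ^ 2 := by have := Real.exp_one_lt_d9; linarith
    _ ≤ _ := by gcongr

theorem two_le_logFactor {M K T : ℕ} (hM : 2 ≤ M) (hK : 2 ≤ K) (hT : 0 < T) :
    2 ≤ logFactor M K T := by
  have hM' : (2 : ℝ) ≤ M := by exact_mod_cast hM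
  have hK' : (2 : ℝ) ≤ K := by exact_mod_cast hK
  have hT' : (1 : ℝ) ≤ T := by exact_mod_cast hT
  rw [logFactor, Real.le_log_iff_exp_le (by positivity)]
  calc Real.exp 2 = Real.exp 1 ^ 2 := by rw [← Real.exp_nat_mul]; norm_num
    _ ≤ 4 ^ 2 := by have := Real.exp_one_lt_d9; gcongr; linarith
    _ = 2 * 2 ^ 2 * 2 * 1 ^ 2 := by norm_num
    _ ≤ _ := by gcongr

theorem epsilon_one (M K T p : ℕ) : epsilon 1 M K T p = √(logFactor M K T / 2 ^ (1 + p)) := by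
  rw [epsilon_eq, pow_one, logFactor]

/-- The data of epoch `p` must meet the threshold of epoch `p + 1`. As `ε_p = √2 ε_{p+1}` and `2√2 ≤
3`, sampling uses up three quarters of it, and the last quarter pays for truncation, since `2 ^
(-⌈(p + 1)/2⌉) ≤ ε_{p+1}`. -/
theorem epsilon_step {n K T : ℕ} (hK : 2 ≤ K) (hT : 0 < T) (p : ℕ) :
    2 * ((n + 1 : ℕ) : ℝ) * epsilon 1 (n + 1) K T p + n * (1 / 2 ^ meanBits 1 p) ≤
      4 * ((n + 1 : ℕ) : ℝ) * epsilon 1 (n + 1) K T (p + 1) := by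
  have hL := le_logFactor (M := n + 1) (by omega) hK hT
  have h1 : 2 * epsilon 1 (n + 1) K T p ≤ 3 * epsilon 1 (n + 1) K T (p + 1) := by
    rw [epsilon_one, epsilon_one]
    refine abs_le_of_sq_le_sq' ?_ (by positivity) |>.2
    rw [mul_pow, mul_pow, Real.sq_sqrt (by positivity), Real.sq_sqrt (by positivity), ← add_assoc,
      pow_succ 2 (1 + p)]
    have : 0 ≤ logFactor (n + 1) K T / 2 ^ (1 + p) := by positivity
    rw [← div_div]
    linarith
  have h2 : (n : ℝ) * (1 / 2 ^ meanBits 1 p) ≤ n * epsilon 1 (n + 1) K T (p + 1) := by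
    -- The truncation estimate needs `logFactor ≥ 2`, which is derived from `M ≥ 2`; a single player
    -- truncates nothing.
    rcases Nat.eq_zero_or_pos n with rfl | hn
    · simp
    gcongr
    have hL2 := two_le_logFactor (M := n + 1) (by omega) hK hT
    rw [epsilon_one]
    refine Real.le_sqrt_of_sq_le ?_
    rw [div_pow, one_pow, ← pow_mul]
    have hb : p + 1 ≤ meanBits 1 p * 2 := by simp only [meanBits, pow_one]; omega
    calc (1 : ℝ) / 2 ^ (meanBits 1 p * 2) ≤ 1 / 2 ^ (p + 1) := by
          gcongr
          norm_num
      _ = 2 / 2 ^ (1 + (p + 1)) := by rw [pow_add 2 1 (p + 1)]; field_simp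
      _ ≤ _ := by gcongr
  have h3 : 0 ≤ epsilon 1 (n + 1) K T (p + 1) := Real.sqrt_nonneg _
  have h4 := mul_le_mul_of_nonneg_left h1 (by positivity : (0 : ℝ) ≤ ((n + 1 : ℕ) : ℝ))
  push_cast at h4 ⊢
  nlinarith

omit [NeZero K] in
-- Zero estimates are good enough for the first epoch: utilities lie in `[0, M]` and `ε_1 ≥ 1/2`.
theorem accurate_zero {T : ℕ} (hK : 2 ≤ K) (hT : 0 < T) (hμ : ∀ i k, μ i k ∈ Set.Icc (0 : ℝ) 1) :
    Accurate μ π₀ (fun _ _ => 0) (4 * ((n + 1 : ℕ) : ℝ) * epsilon 1 (n + 1) K T 1) := by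
  have hL := le_logFactor (M := n + 1) (by omega) hK hT
  refine ⟨0, (n + 1 : ℕ), ?_, fun σ => ?_, ?_⟩
  · have : 1 / 2 ≤ epsilon 1 (n + 1) K T 1 := by
      rw [epsilon_one]
      refine Real.le_sqrt_of_sq_le ?_
      norm_num
      linarith
    have := mul_le_mul_of_nonneg_left this (by positivity : (0 : ℝ) ≤ 4 * ((n + 1 : ℕ) : ℝ))
    have hn : (0 : ℝ) ≤ (n + 1 : ℕ) := by positivity
    linarith
  · have := utility_nonneg hμ σ
    simpa [utility] using this
  · have := utility_le hμ π₀
    have h0 : utility (fun _ _ => (0 : ℝ)) π₀ = 0 := by simp [utility]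
    rw [h0]
    linarith

end Accuracy

/-! ### Regret on the good event -/

section RoundRegret

variable {M K : ℕ}

/-- The expected regret of a round in which the players pull the arms `a`. -/
noncomputable def roundRegret (μ : Fin M → Fin K → ℝ) (a : Fin M → Fin K) : ℝ :=
  maxUtility μ - ∑ m, reward μ a m

/-- Relabelling the players of a matching. -/
def relabelMatching (ρ : Fin M ≃ Fin M) : Matching M K ≃ Matching M K :=
  Equiv.embeddingCongr ρ.symm (Equiv.refl _)

theorem relabelMatching_apply (ρ : Fin M ≃ Fin M) (π : Matching M K) (m : Fin M) :
    relabelMatching ρ π m = π (ρ m) := rfl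

theorem utility_relabel (μ : Fin M → Fin K → ℝ) (ρ : Fin M ≃ Fin M) (π : Matching M K) :
    utility (fun i => μ (ρ.symm i)) π = utility μ (relabelMatching ρ π) := by
  simp only [utility, relabelMatching_apply]
  rw [← Equiv.sum_comp ρ]
  simp

theorem maxUtility_relabel (μ : Fin M → Fin K → ℝ) (ρ : Fin M ≃ Fin M) :
    maxUtility (fun i => μ (ρ.symm i)) = maxUtility μ :=
  (relabelMatching ρ).surjective.iSup_congr _ fun π => (utility_relabel μ ρ π).symm

theorem gap_relabel (μ : Fin M → Fin K → ℝ) (ρ : Fin M ≃ Fin M) (π : Matching M K) :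
    gap (fun i => μ (ρ.symm i)) π = gap μ (relabelMatching ρ π) := by
  rw [gap, gap, maxUtility_relabel, utility_relabel]

theorem minGap_relabel (μ : Fin M → Fin K → ℝ) (ρ : Fin M ≃ Fin M) :
    minGap (fun i => μ (ρ.symm i)) = minGap μ := by
  unfold minGap
  congr 1
  ext x
  simp only [Set.mem_ofPred_eq, gap_relabel]
  exact (relabelMatching ρ).exists_congr_left.trans (by simp)

theorem suboptimalThrough_relabel (μ : Fin M → Fin K → ℝ) (ρ : Fin M ≃ Fin M) (i : Fin M)
    (k : Fin K) (π : Matching M K) :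
    π ∈ suboptimalThrough (fun i => μ (ρ.symm i)) i k ↔
      relabelMatching ρ π ∈ suboptimalThrough μ (ρ.symm i) k := by
  simp [suboptimalThrough, maxUtility_relabel, utility_relabel, relabelMatching_apply]

theorem roundRegret_relabel (μ : Fin M → Fin K → ℝ) (ρ : Fin M ≃ Fin M) (a : Fin M → Fin K) :
    roundRegret μ (fun m => a (ρ m)) = roundRegret (fun i => μ (ρ.symm i)) a := by
  rw [roundRegret, roundRegret, maxUtility_relabel]
  simp only [reward_comp]
  rw [Equiv.sum_comp ρ]

theorem roundRegret_matching (μ : Fin M → Fin K → ℝ) (π : Matching M K) :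
    roundRegret μ π = gap μ π := by
  simp [roundRegret, gap, utility, reward, collision_of_injective π.injective]

theorem maxUtility_le [NeZero K] {μ : Fin M → Fin K → ℝ} (h : M ≤ K)
    (hμ : ∀ i k, μ i k ∈ Set.Icc (0 : ℝ) 1) : maxUtility μ ≤ M := by
  have : Nonempty (Matching M K) := ⟨Fin.castLEEmb h⟩
  exact ciSup_le fun π => utility_le hμ π

theorem roundRegret_le [NeZero K] {μ : Fin M → Fin K → ℝ} (h : M ≤ K)
    (hμ : ∀ i k, μ i k ∈ Set.Icc (0 : ℝ) 1) (a : Fin M → Fin K) : roundRegret μ a ≤ M := by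
  have h1 := maxUtility_le h hμ
  have h2 : 0 ≤ ∑ m, reward μ a m := Finset.sum_nonneg fun m _ => (reward_mem hμ a m).1
  unfold roundRegret
  linarith

/-- At most two players lose their rewards if one of them sends a bit to the other. -/
theorem roundRegret_update_le {μ : Fin M → Fin K → ℝ} (hμ : ∀ i k, μ i k ∈ Set.Icc (0 : ℝ) 1)
    (π : Matching M K) (i i' : Fin M) :
    roundRegret μ (Function.update π i (π i')) ≤ gap μ π + 2 := by
  have h1 : ∀ j, μ j (π j) - (if j = i then 1 else 0) - (if j = i' then 1 else 0) ≤
      reward μ (Function.update π i (π i')) j := by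
    intro j
    have h0 := (reward_mem hμ (Function.update π i (π i')) j).1
    have h1 := (hμ j (π j)).2
    by_cases hi : j = i
    · rw [if_pos hi]; split_ifs <;> linarith
    by_cases hi' : j = i'
    · rw [if_pos hi', if_neg hi]; linarith
    have hc : collision (Function.update π i (π i')) j = false := by
      simp only [collision, decide_eq_false_iff_not]
      rintro ⟨m, hm, he⟩
      rw [Function.update_of_ne hi] at he
      by_cases hmi : m = i
      · rw [hmi, Function.update_self] at he
        exact hi' (π.injective he).symm
      · rw [Function.update_of_ne hmi] at he
        exact hm (π.injective he)
    simp [reward, hc, hi, hi']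
  have h2 := Finset.sum_le_sum fun j (_ : j ∈ Finset.univ) => h1 j
  simp only [Finset.sum_sub_distrib, Finset.sum_ite_eq', Finset.mem_univ, if_true] at h2
  unfold roundRegret gap utility
  linarith

theorem minGap_pos {μ : Fin M → Fin K → ℝ} (hΔ : ∃ π : Matching M K, 0 < gap μ π) :
    0 < minGap μ := by
  have hne : {x : ℝ | ∃ π : Matching M K, 0 < gap μ π ∧ x = gap μ π}.Nonempty := by
    obtain ⟨π, hπ⟩ := hΔ
    exact ⟨_, π, hπ, rfl⟩
  have hfin : {x : ℝ | ∃ π : Matching M K, 0 < gap μ π ∧ x = gap μ π}.Finite :=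
    (Set.finite_range (gap μ)).subset (by rintro x ⟨π, -, rfl⟩; exact ⟨π, rfl⟩)
  obtain ⟨π, hπ, he⟩ := hne.csInf_mem hfin
  rw [minGap, he]
  exact hπ

end RoundRegret

/-! ### Splitting sums over rounds into phases -/

section Sums

/-- The horizon may fall inside the phase; since `b` is nonnegative, the full phase may be charged
anyway. -/
theorem sum_Ico_le_add {r b : ℕ → ℝ} {t N : ℕ} (T : ℕ) (hb : ∀ j, 0 ≤ b j)
    (h : ∀ j < N, r (t + j) ≤ b j) :
    ∑ s ∈ Finset.Ico t T, r s ≤ ∑ j ∈ Finset.range N, b j + ∑ s ∈ Finset.Ico (t + N) T, r s := by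
  induction N with
  | zero => simp
  | succ N ih =>
    refine (ih fun j hj => h j (by omega)).trans ?_
    rw [Finset.sum_range_succ, add_assoc]
    gcongr
    rcases lt_or_ge (t + N) T with hlt | hge
    · rw [Finset.sum_eq_sum_Ico_succ_bot hlt, ← add_assoc t N 1]
      gcongr
      exact h N (by omega)
    · rw [Finset.Ico_eq_empty (by omega), Finset.Ico_eq_empty (by omega)]
      simpa using hb N

theorem sum_getD_eq_sum (l : List ℝ) : ∑ j ∈ Finset.range l.length, l.getD j 0 = l.sum := by
  induction l with
  | nil => simp
  | cons a l ih =>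
    rw [List.length_cons, Finset.sum_range_succ', List.sum_cons, add_comm]
    simpa using ih

theorem sum_map_flatMap_replicate {α : Type*} (N : ℕ) (f : α → ℝ) (l : List α) :
    ((l.flatMap fun a => List.replicate N a).map f).sum = N * (l.map f).sum := by
  induction l with
  | nil => simp
  | cons a l ih => simp [ih, mul_add]

end Sums

/-! ### The cost of an epoch -/

section EpochCosts

variable {n K T : ℕ}

/-- An upper bound on the number of epochs with communication. -/
noncomputable def epochBound {M K : ℕ} (μ : Fin M → Fin K → ℝ) (T : ℕ) : ℝ :=
  Real.logb 2 (64 * (M : ℝ) ^ 2 * logFactor M K T / minGap μ ^ 2)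

/-- Bound on the regret of the messages of the leader in epoch `q + 1`. -/
noncomputable def announceCost (n K T : ℕ) (Λ : ℝ) (q : ℕ) : ℝ :=
  if (q + 1 : ℝ) ≤ Λ then
    (n * sizeBits (n + 1) K + n * (((n + 1) * K + 2) * armBits K) : ℕ) *
      (2 + 4 * ((n + 1 : ℕ) : ℝ) * epsilon 1 (n + 1) K T q) else 0

/-- Bound on the regret of the messages of the followers in epoch `q + 1`. -/
noncomputable def reportCost (n K T : ℕ) (Λ : ℝ) (q : ℕ) : ℝ :=
  if (q + 2 : ℝ) ≤ Λ then
    (n * (K * meanBits 1 (q + 1)) : ℕ) *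
      (2 + 4 * ((n + 1 : ℕ) : ℝ) * epsilon 1 (n + 1) K T (q + 1)) else 0

open scoped Classical in
/-- Bound on the regret of the exploration in epoch `q + 1`. -/
noncomputable def exploreCost (n K T : ℕ) (F : Fin (n + 1) → Fin K → Prop)
    (g : Fin (n + 1) → Fin K → ℝ) (q : ℕ) : ℝ :=
  ∑ i, ∑ k, if F i k ∧ g i k ≤ 8 * ((n + 1 : ℕ) : ℝ) * epsilon 1 (n + 1) K T (q + 1) then
    2 ^ (q + 1) * (8 * ((n + 1 : ℕ) : ℝ) * epsilon 1 (n + 1) K T (q + 1)) else 0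

theorem epsilon_nonneg (c M K T p : ℕ) : 0 ≤ epsilon c M K T p := Real.sqrt_nonneg _

theorem announceCost_nonneg (n K T : ℕ) (Λ : ℝ) (q : ℕ) : 0 ≤ announceCost n K T Λ q := by
  have := epsilon_nonneg 1 (n + 1) K T q
  unfold announceCost
  split_ifs <;> positivity

theorem reportCost_nonneg (n K T : ℕ) (Λ : ℝ) (q : ℕ) : 0 ≤ reportCost n K T Λ q := by
  have := epsilon_nonneg 1 (n + 1) K T (q + 1)
  unfold reportCost
  split_ifs <;> positivity

theorem exploreCost_nonneg (n K T : ℕ) (F : Fin (n + 1) → Fin K → Prop)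
    (g : Fin (n + 1) → Fin K → ℝ) (q : ℕ) : 0 ≤ exploreCost n K T F g q := by
  have := epsilon_nonneg 1 (n + 1) K T (q + 1)
  refine Finset.sum_nonneg fun i _ => Finset.sum_nonneg fun k _ => ?_
  split_ifs <;> positivity

/-- Squaring `Δ ≤ 8Mε_p` gives `2 ^ (p + 1) ≤ 64M²L/Δ²`. -/
theorem add_one_le_epochBound {μ : Fin (n + 1) → Fin K → ℝ} {p : ℕ} (hL : 0 ≤ logFactor (n + 1) K T)
    {π : Matching (n + 1) K} (hπ : 0 < gap μ π)
    (hle : gap μ π ≤ 8 * ((n + 1 : ℕ) : ℝ) * epsilon 1 (n + 1) K T p) :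
    (p + 1 : ℝ) ≤ epochBound μ T := by
  have hΔ := minGap_pos ⟨π, hπ⟩
  have h1 := (minGap_le hπ).trans hle
  have h2 : (2 : ℝ) ^ (1 + p) ≤
      64 * ((n + 1 : ℕ) : ℝ) ^ 2 * logFactor (n + 1) K T / minGap μ ^ 2 := by
    rw [le_div_iff₀ (by positivity)]
    have h3 : minGap μ ^ 2 ≤ 64 * ((n + 1 : ℕ) : ℝ) ^ 2 * (logFactor (n + 1) K T / 2 ^ (1 + p)) := by
      calc minGap μ ^ 2 ≤ (8 * ((n + 1 : ℕ) : ℝ) * epsilon 1 (n + 1) K T p) ^ 2 := by gcongr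
        _ = _ := by rw [epsilon_one, mul_pow, Real.sq_sqrt (by positivity)]; ring
    rw [← mul_div_assoc, le_div_iff₀ (by positivity)] at h3
    linarith
  rw [epochBound, Real.le_logb_iff_rpow_le (by norm_num) (lt_of_lt_of_le (by positivity) h2)]
  refine le_trans (le_of_eq ?_) h2
  rw [add_comm (p : ℝ) 1, ← Nat.cast_one, ← Nat.cast_add, Real.rpow_natCast]

end EpochCosts

/-! ### Induction over the epochs -/

section GoodEvent

variable {n K : ℕ} [NeZero K] {μ₀ : Fin (n + 1) → Fin K → ℝ} {ρ : Fin (n + 1) ≃ Fin (n + 1)}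
  {π₀ : Matching (n + 1) K} {tie : TieBreak K} {T t₀ : ℕ} {prog : Prog K Unit}
  {v : ℕ → Fin (n + 1) → Fin K} {y : ℕ → Fin (n + 1) → Fin K → ℝ}

/-- The regret from the beginning of an epoch on. -/
theorem sum_roundRegret_epochs_le (htie : tie.Valid) (hK : n + 1 ≤ K) (hK2 : 2 ≤ K) (hT : 0 < T)
    {μ : Fin (n + 1) → Fin K → ℝ} (hμρ : μ = fun i => μ₀ (ρ.symm i))
    (hμ : ∀ i k, μ i k ∈ Set.Icc (0 : ℝ) 1)
    (hπ₀ : utility μ π₀ = maxUtility μ)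
    (huniq : ∀ π : Matching (n + 1) K, utility μ π = maxUtility μ → π = π₀)
    {g : Fin (n + 1) → Fin K → ℝ}
    (hg : ∀ i k, ∀ π ∈ suboptimalThrough μ i k, g i k ≤ gap μ π)
    (hy : ∀ t i k, y t i k ∈ Set.Icc (0 : ℝ) 1)
    (hgood : ∀ q < T, (fun t i => y t (ρ.symm i)) ∉ badEpoch tie 1 T hK t₀ μ q)
    (fuel : ℕ) : ∀ (q t : ℕ) (E : Finset (Fin (n + 1) × Fin K)) (w : Fin (n + 1) → Fin K → ℝ)
    (comm : Matching (n + 1) K), q + fuel = T → q ≤ t →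
    (∀ m, remaining prog v y t m = epochProg tie 1 T hK fuel (q + 1) E w comm (ρ m)) →
    planAt tie 1 T hK t₀ (fun t i => y t (ρ.symm i)) q =
      (exploreStart t (epochPlan tie 1 T hK (q + 1) E w), epochPlan tie 1 T hK (q + 1) E w) →
    (∀ i, (i, π₀ i) ∈ E) →
    Accurate μ π₀ w (4 * ((n + 1 : ℕ) : ℝ) * epsilon 1 (n + 1) K T (q + 1)) →
    gap μ comm ≤ 4 * ((n + 1 : ℕ) : ℝ) * epsilon 1 (n + 1) K T q →
    (q + 1 : ℝ) ≤ epochBound μ T →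
    ∑ s ∈ Finset.Ico t T, roundRegret μ₀ (armsPulled prog v y s) ≤
      ∑ j ∈ Finset.Ico q T, (announceCost n K T (epochBound μ T) j +
        exploreCost n K T (fun i k => (suboptimalThrough μ i k).Nonempty) g j +
        reportCost n K T (epochBound μ T) j) := by
  have hL : 0 ≤ logFactor (n + 1) K T :=
    zero_le_one.trans (le_logFactor (M := n + 1) (by omega) hK2 hT)
  have hr : ∀ s (a : Fin (n + 1) → Fin K), armsPulled prog v y s = (fun m => a (ρ m)) →
      roundRegret μ₀ (armsPulled prog v y s) = roundRegret μ a := by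
    intro s a ha
    rw [ha, roundRegret_relabel, hμρ]
  have hcost : ∀ j, 0 ≤ announceCost n K T (epochBound μ T) j +
        exploreCost n K T (fun i k => (suboptimalThrough μ i k).Nonempty) g j +
        reportCost n K T (epochBound μ T) j := fun j =>
    add_nonneg (add_nonneg (announceCost_nonneg _ _ _ _ _) (exploreCost_nonneg _ _ _ _ _ _))
      (reportCost_nonneg _ _ _ _ _)
  -- When the fuel is exhausted, `q = T`, and `q ≤ t` shows that no round before the horizon is
  -- left.
  induction fuel with
  | zero =>
    intro q t E w comm hq hqt _ _ _ _ _ _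
    rw [Finset.Ico_eq_empty (by omega), Finset.Ico_eq_empty (by omega)]
    simp
  | succ fuel ih =>
    intro q t E w comm hq hqt hrem hplan hE hacc hcomm hΛ
    set d := epochPlan tie 1 T hK (q + 1) E w with hd
    have hlen : d.2.1.length ≤ (n + 1) * K := length_epochPlan_le ..
    have hε := epsilon_nonneg 1 (n + 1) K T q
    have hε1 := epsilon_nonneg 1 (n + 1) K T (q + 1)
    set N₁ := n * sizeBits (n + 1) K + n * ((d.2.1.length + 2) * armBits K) with hN₁
    have hQ : ∀ i : Fin n, epochProg tie 1 T hK (fuel + 1) (q + 1) E w comm i.succ =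
        followerEpochs 1 T (i.val + 2) (n + 1) (fuel + 1) (q + 1) (comm i.succ) := fun i => rfl
    -- The announcements of epoch `q + 1` still use the communication arms chosen before it, hence
    -- `ε_q` in their cost; the reports use the new ones, hence `ε_{q+1}`.
    have hbound1 : ∀ lead : Prog K Unit,
        (epochProg tie 1 T hK (fuel + 1) (q + 1) E w comm 0 =
          Prog.bind (Prog.pullSeq (sizeSignal d comm)) fun _ =>
          Prog.bind (Prog.pullSeq (planSignal d comm)) fun _ => lead) →
        ∑ s ∈ Finset.Ico t T, roundRegret μ₀ (armsPulled prog v y s) ≤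
          announceCost n K T (epochBound μ T) q +
            ∑ s ∈ Finset.Ico (t + N₁) T, roundRegret μ₀ (armsPulled prog v y s) := by
      intro lead hlead
      obtain ⟨ha, -⟩ := epoch_announce ρ comm.injective hlen hlead hQ hrem
      refine (sum_Ico_le_add (N := N₁) (b := fun _ => 2 + 4 * ((n + 1 : ℕ) : ℝ) *
        epsilon 1 (n + 1) K T q) T (fun _ => by positivity) fun j hj => ?_).trans ?_
      · obtain ⟨a, i', rfl, hj⟩ := ha j hj
        rw [hr _ _ hj]
        have := roundRegret_update_le hμ comm 0 i'
        linarith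
      · gcongr
        rw [Finset.sum_const, Finset.card_range, nsmul_eq_mul, announceCost, if_pos hΛ, hN₁]
        gcongr
    rw [Finset.sum_eq_sum_Ico_succ_bot (by omega : q < T)]
    by_cases hone : d.2.1.length = 1
    · obtain ⟨π, hπ⟩ := List.length_eq_one_iff.1 hone
      have hlead := leaderEpochs_exploit tie 1 T hK fuel (q + 1) E w comm hd.symm hπ
      refine (hbound1 _ hlead).trans ?_
      obtain ⟨-, hrem'⟩ := epoch_announce ρ comm.injective hlen hlead hQ hrem
      have hπ' : π = π₀ := eq_of_epochPlan_singleton htie hacc hπ₀ hE hπ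
      have hzero : ∑ s ∈ Finset.Ico (t + N₁) T, roundRegret μ₀ (armsPulled prog v y s) ≤ 0 := by
        refine Finset.sum_nonpos fun s hs => ?_
        rw [Finset.mem_Ico] at hs
        have := epoch_exploit ρ hπ hrem' (j := s - (t + N₁)) (by omega)
        rw [← hN₁, show t + N₁ + (s - (t + N₁)) = s by omega] at this
        rw [hr _ _ this, roundRegret_matching, gap, hπ', hπ₀, sub_self]
      have h1 : 0 ≤ ∑ j ∈ Finset.Ico (q + 1) T, (announceCost n K T (epochBound μ T) j +
          exploreCost n K T (fun i k => (suboptimalThrough μ i k).Nonempty) g j +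
          reportCost n K T (epochBound μ T) j) := Finset.sum_nonneg fun j _ => hcost j
      have h2 := exploreCost_nonneg n K T (fun i k => (suboptimalThrough μ i k).Nonempty) g q
      have h3 := reportCost_nonneg n K T (epochBound μ T) q
      linarith
    · have hlead := leaderEpochs_explore tie 1 T hK fuel (q + 1) E w comm hd.symm hone
      refine (hbound1 _ hlead).trans ?_
      obtain ⟨-, hrem'⟩ := epoch_announce ρ comm.injective hlen hlead hQ hrem
      obtain ⟨he, hf, hrem''⟩ := epoch_explore ρ hK tie hone hrem'
      rw [← hN₁] at he hf hrem''
      set N₂ := d.2.1.length * 2 ^ (q + 1) ^ 1 with hN₂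
      set N₃ := n * (K * meanBits 1 (q + 1)) with hN₃
      -- As the exploration goes on, some positive gap is at most `8Mε_{q+1}`. The resulting `q + 2
      -- ≤ Λ` licenses both the report of this epoch and the announcements of the next.
      obtain ⟨σ, hσ, hgapσ⟩ := exists_suboptimal htie hacc hπ₀ hE huniq hone
      have hΛ' : (((q + 1 : ℕ) : ℝ) + 1) ≤ epochBound μ T := add_one_le_epochBound hL hσ hgapσ
      have hbest : gap μ d.2.2 ≤ 4 * ((n + 1 : ℕ) : ℝ) * epsilon 1 (n + 1) K T (q + 1) :=
        gap_best_le htie hacc hπ₀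
      have hbound2 : ∑ s ∈ Finset.Ico (t + N₁) T, roundRegret μ₀ (armsPulled prog v y s) ≤
          exploreCost n K T (fun i k => (suboptimalThrough μ i k).Nonempty) g q +
            ∑ s ∈ Finset.Ico (t + N₁ + N₂) T, roundRegret μ₀ (armsPulled prog v y s) := by
        set l := d.2.1.flatMap fun π => List.replicate (2 ^ (q + 1) ^ 1) π with hl
        have hll : l.length = N₂ := by simp [hl, hN₂, List.length_flatMap]
        refine (sum_Ico_le_add (N := N₂) (b := fun j => (l.map (gap μ)).getD j 0) T
          (fun j => ?_) fun j hj => ?_).trans ?_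
        · rw [List.getD_eq_getElem?_getD, List.getElem?_map]
          rcases l[j]? with _ | π
          · simp
          · simpa using gap_nonneg μ π
        · obtain ⟨hj', ha⟩ := he j hj
          rw [hr _ _ ha, roundRegret_matching]
          simp [hj']
        · gcongr
          have h1 := sum_getD_eq_sum (l.map (gap μ))
          rw [List.length_map, hll] at h1
          rw [h1, hl, sum_map_flatMap_replicate]
          have h2 := sum_gap_le (h := hK) (E := E) htie hacc hπ₀ hg hε1
          refine (mul_le_mul_of_nonneg_left h2 (by positivity)).trans (le_of_eq ?_)
          rw [exploreCost, Finset.mul_sum]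
          refine Finset.sum_congr rfl fun i _ => ?_
          rw [Finset.mul_sum]
          refine Finset.sum_congr rfl fun k _ => ?_
          rw [mul_ite, mul_zero, pow_one, Nat.cast_pow, Nat.cast_ofNat]
      have hbound3 : ∑ s ∈ Finset.Ico (t + N₁ + N₂) T, roundRegret μ₀ (armsPulled prog v y s) ≤
          reportCost n K T (epochBound μ T) q +
            ∑ s ∈ Finset.Ico (t + N₁ + N₂ + N₃) T, roundRegret μ₀ (armsPulled prog v y s) := by
        refine (sum_Ico_le_add (N := N₃) (b := fun _ => 2 + 4 * ((n + 1 : ℕ) : ℝ) *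
          epsilon 1 (n + 1) K T (q + 1)) T (fun _ => by positivity) fun j hj => ?_).trans ?_
        · obtain ⟨a, i, i', rfl, hj⟩ := hf j hj
          rw [hr _ _ hj]
          have := roundRegret_update_le hμ d.2.2 i i'
          linarith
        · gcongr
          rw [Finset.sum_const, Finset.card_range, nsmul_eq_mul, reportCost,
            if_pos (by push_cast at hΛ'; linarith)]
      -- The exploration is nonempty, so the epoch takes at least one round and `q ≤ t` persists.
      obtain ⟨τ, hτ, -⟩ := optimal_explored (h := hK) htie hacc hπ₀ hE 0
      have hpos : 0 < N₂ := Nat.mul_pos (List.length_pos_of_mem hτ) (by positivity)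
      have hE' : ∀ i, (i, π₀ i) ∈ d.1 := fun i => optimal_edge_mem htie hacc hπ₀ (hE i)
      have hgq := hgood q (by omega)
      rw [badEpoch, Set.mem_ofPred_eq, hplan] at hgq
      push Not at hgq
      have hacc' := accurate_blockEstimates (μ := μ) (π₀ := π₀) (s := t + N₁)
        (fun t i k => hy t (ρ.symm i) k) hμ hε1 hgq
        (fun i => optimal_explored (h := hK) htie hacc hπ₀ hE i)
      have hih := ih (q + 1) (t + N₁ + N₂ + N₃) d.1
        (blockEstimates (fun t i => y t (ρ.symm i)) (t + N₁) 1 (q + 1) d.2.1) d.2.2 (by omega)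
        (by omega) hrem'' (by rw [planAt, hplan]; rfl) hE'
        (by
          obtain ⟨r₁, r₂, h0, h1, h2⟩ := hacc'
          exact ⟨r₁, r₂, h0.trans (epsilon_step hK2 hT (q + 1)), h1, h2⟩) hbest hΛ'
      linarith

end GoodEvent

/-! ### Bounds on the costs -/

section Analysis

/-- The ratio `⌈lg K⌉ / lg K` is largest at `K = 5`, about `1.292`. Up to four bits the claim is
checked at the smallest `K` with that many bits, as `2 ^ (10 b) ≤ K ^ 13`; from `b = 5` on, `b ≤ 1.3
(b - 1)`. -/
theorem armBits_le {K : ℕ} (hK : 2 ≤ K) : (armBits K : ℝ) ≤ 1.3 * Real.logb 2 K := by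
  have hb : 0 < armBits K := Nat.clog_pos (by norm_num) hK
  have hlt : 2 ^ (armBits K - 1) < K := Nat.pow_pred_clog_lt_self (by norm_num) (by omega)
  have hK0 : (0 : ℝ) < K := by positivity
  have key : ∀ {a c : ℕ}, 2 ^ a ≤ K ^ c → (a : ℝ) ≤ c * Real.logb 2 K := by
    intro a c h
    rw [← Real.logb_pow, Real.le_logb_iff_rpow_le (by norm_num) (by positivity),
      Real.rpow_natCast]
    exact_mod_cast h
  have hsmall : ∀ b, armBits K = b → 2 ^ (10 * b) ≤ K ^ 13 →
      (armBits K : ℝ) ≤ 1.3 * Real.logb 2 K := by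
    rintro b rfl h
    have := key h
    push_cast at this
    linarith
  rcases (by omega : armBits K = 1 ∨ armBits K = 2 ∨ armBits K = 3 ∨ armBits K = 4 ∨
    5 ≤ armBits K) with h | h | h | h | h
  · exact hsmall 1 h ((by norm_num : 2 ^ (10 * 1) ≤ 2 ^ 13).trans (Nat.pow_le_pow_left hK 13))
  · rw [h] at hlt
    exact hsmall 2 h ((by norm_num : 2 ^ (10 * 2) ≤ 3 ^ 13).trans (Nat.pow_le_pow_left hlt 13))
  · rw [h] at hlt
    exact hsmall 3 h ((by norm_num : 2 ^ (10 * 3) ≤ 5 ^ 13).trans (Nat.pow_le_pow_left hlt 13))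
  · rw [h] at hlt
    exact hsmall 4 h ((by norm_num : 2 ^ (10 * 4) ≤ 9 ^ 13).trans (Nat.pow_le_pow_left hlt 13))
  · have h1 := key (a := armBits K - 1) (c := 1) (by simpa using hlt.le)
    rw [Nat.cast_sub (by omega)] at h1
    have h2 : (5 : ℝ) ≤ armBits K := by exact_mod_cast h
    push_cast at h1
    linarith

theorem sizeBits_le {M K : ℕ} (hMK : M ≤ K) (hK : 2 ≤ K) : sizeBits M K ≤ 3 * armBits K := by
  have hb : 0 < armBits K := Nat.clog_pos (by norm_num) hK
  have hle : K ≤ 2 ^ armBits K := Nat.le_pow_clog (by norm_num) K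
  refine Nat.clog_le_of_le_pow ?_
  have h2 : 2 ≤ 2 ^ armBits K := Nat.le_self_pow hb.ne' 2
  rw [mul_comm 3, pow_mul]
  have h1 : M * K ≤ 2 ^ armBits K * 2 ^ armBits K := Nat.mul_le_mul (hMK.trans hle) hle
  generalize 2 ^ armBits K = x at *
  nlinarith

/-- The size costs at most as many bits as three arms, and two communication arms are sent, hence
`MK + 5` arms per follower. The factor `1.5` absorbs this and the rounding of `lg K`; for `M = K =
2` it is nearly sharp, `11.7` against `12`. -/
theorem announceRounds_le {n K : ℕ} (hn : 0 < n) (hK : n + 1 ≤ K) :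
    ((n * sizeBits (n + 1) K + n * (((n + 1) * K + 2) * armBits K) : ℕ) : ℝ) ≤
      1.5 * ((n + 1 : ℕ) : ℝ) ^ 2 * K * Real.logb 2 K := by
  have h1 := sizeBits_le hK (by omega)
  have h2 := armBits_le (K := K) (by omega)
  have h3 : n * sizeBits (n + 1) K + n * (((n + 1) * K + 2) * armBits K) ≤
      n * ((n + 1) * K + 5) * armBits K := by nlinarith
  have h4 : ((n * sizeBits (n + 1) K + n * (((n + 1) * K + 2) * armBits K) : ℕ) : ℝ) ≤
      (n * ((n + 1) * K + 5)) * armBits K := by exact_mod_cast h3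
  have hlog : 0 ≤ Real.logb 2 K :=
    Real.logb_nonneg (by norm_num) (by exact_mod_cast (by omega : 1 ≤ K))
  have h5 : (n * ((n + 1) * K + 5) : ℝ) * 1.3 ≤ 1.5 * ((n + 1 : ℕ) : ℝ) ^ 2 * K := by
    -- Substituting the constraints makes the difference a polynomial in natural numbers to which
    -- `positivity` applies.
    obtain ⟨a, rfl⟩ := Nat.exists_eq_add_of_le' hn
    obtain ⟨k, rfl⟩ := Nat.exists_eq_add_of_le hK
    rw [← sub_nonneg]
    push_cast
    ring_nf
    positivity
  calc _ ≤ (n * ((n + 1) * K + 5) : ℝ) * armBits K := h4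
    _ ≤ (n * ((n + 1) * K + 5) : ℝ) * (1.3 * Real.logb 2 K) := by gcongr
    _ = (n * ((n + 1) * K + 5) : ℝ) * 1.3 * Real.logb 2 K := by ring
    _ ≤ _ := by gcongr

theorem sqrt_half_le : √(1 / 2 : ℝ) ≤ 0.7072 := by
  rw [Real.sqrt_le_left (by norm_num)]
  norm_num

theorem epsilon_eq_mul_pow {M K T : ℕ} (p : ℕ) :
    epsilon 1 M K T p = √(logFactor M K T) * √(1 / 2) ^ (1 + p) := by
  rw [epsilon_one, div_eq_mul_inv, ← inv_pow, Real.sqrt_mul' _ (by positivity)]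
  congr 1
  rw [Real.sqrt_eq_iff_mul_self_eq (by positivity) (by positivity), ← mul_pow,
    Real.mul_self_sqrt (by norm_num), one_div]

/-- The full series is `√2 + 1 < 2.42`. The induction carries the tail along as `2.42 · √(1/2) ^ N`.
-/
theorem sum_pow_le (N : ℕ) : ∑ j ∈ Finset.range N, √(1 / 2 : ℝ) ^ (1 + j) ≤ 2.42 := by
  have hx := sqrt_half_le
  have hx0 := Real.sqrt_nonneg (1 / 2 : ℝ)
  suffices h : ∑ j ∈ Finset.range N, √(1 / 2 : ℝ) ^ (1 + j) + 2.42 * √(1 / 2 : ℝ) ^ N ≤ 2.42 by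
    have : 0 ≤ √(1 / 2 : ℝ) ^ N := by positivity
    linarith
  induction N with
  | zero => simp
  | succ N ih =>
    have : 0 ≤ √(1 / 2 : ℝ) ^ N := by positivity
    rw [Finset.sum_range_succ, pow_succ, pow_add _ 1 N, pow_one]
    nlinarith

/-- The exact tail is `√(1/2) ^ N` times an affine function of `N`, about `0.854 N + 4.62`; the
slightly larger `0.86 N + 4.7` is stable under the induction step. -/
theorem sum_mul_pow_le (N : ℕ) :
    ∑ j ∈ Finset.range N, ((j : ℝ) + 3) / 2 * √(1 / 2 : ℝ) ^ (2 + j) ≤ 4.7 := by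
  have hx := sqrt_half_le
  have hx0 := Real.sqrt_nonneg (1 / 2 : ℝ)
  have hsq : √(1 / 2 : ℝ) ^ 2 = 1 / 2 := Real.sq_sqrt (by norm_num)
  suffices h : ∑ j ∈ Finset.range N, ((j : ℝ) + 3) / 2 * √(1 / 2 : ℝ) ^ (2 + j) +
      (0.86 * N + 4.7) * √(1 / 2 : ℝ) ^ N ≤ 4.7 by
    have : 0 ≤ (0.86 * N + 4.7) * √(1 / 2 : ℝ) ^ N := by positivity
    linarith
  induction N with
  | zero => simp
  | succ N ih =>
    have h0 : 0 ≤ √(1 / 2 : ℝ) ^ N := by positivity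
    rw [Finset.sum_range_succ, pow_succ, pow_add _ 2 N, hsq]
    have hstep : ((N : ℝ) + 3) / 2 * (1 / 2) + (0.86 * ((N + 1 : ℕ) : ℝ) + 4.7) * √(1 / 2) ≤
        0.86 * N + 4.7 := by
      have h1 : (0.86 * ((N + 1 : ℕ) : ℝ) + 4.7) * √(1 / 2) ≤
          (0.86 * ((N + 1 : ℕ) : ℝ) + 4.7) * 0.7072 := by gcongr
      have h2 : (0 : ℝ) ≤ N := by positivity
      push_cast at h1 ⊢
      linarith
    have := mul_le_mul_of_nonneg_right hstep h0
    linarith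

variable {n K T : ℕ}

/-- At most `Λ` epochs of `1.5 M²K lg K` rounds each: the two lost rewards give `3`, and the gaps
give `4 · 1.5 · 2.42 = 14.52`. -/
theorem sum_announceCost_le (hK : n + 1 ≤ K) (Λ : ℝ) (hΛ : 1 ≤ Λ) :
    ∑ j ∈ Finset.range T, announceCost n K T Λ j ≤
      3 * ((n + 1 : ℕ) : ℝ) ^ 2 * K * Real.logb 2 K * Λ +
      14.52 * ((n + 1 : ℕ) : ℝ) ^ 3 * K * Real.logb 2 K * √(logFactor (n + 1) K T) := by
  have hlog : 0 ≤ Real.logb 2 K :=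
    Real.logb_nonneg (by norm_num) (by exact_mod_cast (by omega : 1 ≤ K))
  rcases Nat.eq_zero_or_pos n with rfl | hn
  · have : ∀ j, announceCost 0 K T Λ j = 0 := fun j => by simp [announceCost]
    simp only [this, Finset.sum_const_zero]
    positivity
  have hN := announceRounds_le hn hK
  set N : ℝ := ((n * sizeBits (n + 1) K + n * (((n + 1) * K + 2) * armBits K) : ℕ) : ℝ) with hNdef
  have hN0 : 0 ≤ N := by positivity
  set M : ℝ := ((n + 1 : ℕ) : ℝ) with hM
  have hM0 : 0 ≤ M := by positivity
  have hcount : ∑ j ∈ Finset.range T, (if (j + 1 : ℝ) ≤ Λ then (1 : ℝ) else 0) ≤ Λ := by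
    rw [← Finset.sum_filter, Finset.sum_const, nsmul_eq_mul, mul_one]
    refine le_trans ?_ (Nat.floor_le (by linarith : 0 ≤ Λ))
    rw [Nat.cast_le]
    refine (Finset.card_le_card (t := Finset.range ⌊Λ⌋₊) fun j hj => ?_).trans (by simp)
    rw [Finset.mem_filter] at hj
    rw [Finset.mem_range]
    exact Nat.lt_of_succ_le (Nat.le_floor (by push_cast; exact hj.2))
  calc ∑ j ∈ Finset.range T, announceCost n K T Λ j
      ≤ ∑ j ∈ Finset.range T, (2 * N * (if (j + 1 : ℝ) ≤ Λ then (1 : ℝ) else 0) +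
        4 * N * M * √(logFactor (n + 1) K T) * √(1 / 2) ^ (1 + j)) := by
        refine Finset.sum_le_sum fun j _ => ?_
        rw [announceCost, ← hNdef, epsilon_eq_mul_pow, ← hM]
        split_ifs
        · exact le_of_eq (by ring)
        · positivity
    _ = 2 * N * ∑ j ∈ Finset.range T, (if (j + 1 : ℝ) ≤ Λ then (1 : ℝ) else 0) +
        4 * N * M * √(logFactor (n + 1) K T) * ∑ j ∈ Finset.range T, √(1 / 2) ^ (1 + j) := by
        rw [Finset.sum_add_distrib, Finset.mul_sum, Finset.mul_sum]
    _ ≤ 2 * (1.5 * M ^ 2 * K * Real.logb 2 K) * Λ + 4 * (1.5 * M ^ 2 * K * Real.logb 2 K) * M *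
        √(logFactor (n + 1) K T) * 2.42 := by
        gcongr
        exact sum_pow_le T
    _ = _ := by ring

/-- At most `J = ⌊Λ⌋ - 1` terms occur, and `J (J + 5) / 2 ≤ (J + 1)²`. -/
theorem sum_range_ite_le (T : ℕ) {Λ : ℝ} (hΛ : 1 ≤ Λ) :
    ∑ j ∈ Finset.range T, (if (j + 2 : ℝ) ≤ Λ then (j + 3 : ℝ) else 0) ≤ Λ ^ 2 := by
  set J := ⌊Λ⌋₊ - 1 with hJ
  have hfl : 1 ≤ ⌊Λ⌋₊ := Nat.le_floor (by simpa using hΛ)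
  have hsum : ∀ J : ℕ, ∑ j ∈ Finset.range J, (j + 3 : ℝ) ≤ (J + 1 : ℝ) ^ 2 := by
    intro J
    have : ∑ j ∈ Finset.range J, (j + 3 : ℝ) = J * (J + 5) / 2 := by
      induction J with
      | zero => simp
      | succ J ih => rw [Finset.sum_range_succ, ih]; push_cast; ring
    rw [this]
    nlinarith [sq_nonneg ((J : ℝ) - 1 / 2)]
  calc _ = ∑ j ∈ (Finset.range T).filter fun j : ℕ => (j + 2 : ℝ) ≤ Λ, (j + 3 : ℝ) :=
        (Finset.sum_filter _ _).symm
    _ ≤ ∑ j ∈ Finset.range J, (j + 3 : ℝ) := by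
        refine Finset.sum_le_sum_of_subset_of_nonneg (fun j hj => ?_) fun _ _ _ => by positivity
        rw [Finset.mem_filter] at hj
        rw [Finset.mem_range]
        have : j + 2 ≤ ⌊Λ⌋₊ := Nat.le_floor (by push_cast; exact hj.2)
        omega
    _ ≤ (J + 1 : ℝ) ^ 2 := hsum J
    _ ≤ Λ ^ 2 := by
        have : ((J + 1 : ℕ) : ℝ) ≤ Λ := by
          rw [hJ, Nat.sub_add_cancel hfl]
          exact Nat.floor_le (by linarith)
        push_cast at this
        gcongr

/-- A mean takes at most `(j + 3)/2` bits and each round loses two rewards, which leads to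
`sum_range_ite_le`. For the gaps, `4n ≤ (n + 1)²` and `lg K ≥ 1` bring the sum into the shape `M³K
lg K √L`. -/
theorem sum_reportCost_le (hK : n + 1 ≤ K) (Λ : ℝ) (hΛ : 1 ≤ Λ) :
    ∑ j ∈ Finset.range T, reportCost n K T Λ j ≤ ((n + 1 : ℕ) : ℝ) * K * Λ ^ 2 +
      4.7 * ((n + 1 : ℕ) : ℝ) ^ 3 * K * Real.logb 2 K * √(logFactor (n + 1) K T) := by
  have hlog : 0 ≤ Real.logb 2 K :=
    Real.logb_nonneg (by norm_num) (by exact_mod_cast (by omega : 1 ≤ K))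
  rcases Nat.eq_zero_or_pos n with rfl | hn
  · have : ∀ j, reportCost 0 K T Λ j = 0 := fun j => by simp [reportCost]
    simp only [this, Finset.sum_const_zero]
    positivity
  have hlog1 : 1 ≤ Real.logb 2 K := by
    rw [Real.le_logb_iff_rpow_le (by norm_num) (by exact_mod_cast (by omega : 0 < K)),
      Real.rpow_one]
    exact_mod_cast (by omega : 2 ≤ K)
  have hbits : ∀ j, ((n * (K * meanBits 1 (j + 1)) : ℕ) : ℝ) ≤ n * K * ((j + 3) / 2) := by
    intro j
    have : meanBits 1 (j + 1) * 2 ≤ j + 3 := by simp only [meanBits, pow_one]; omega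
    have : (meanBits 1 (j + 1) : ℝ) * 2 ≤ j + 3 := by exact_mod_cast this
    push_cast
    rw [mul_assoc]
    gcongr
    linarith
  set S := √(logFactor (n + 1) K T) with hS
  have hS0 : 0 ≤ S := Real.sqrt_nonneg _
  calc ∑ j ∈ Finset.range T, reportCost n K T Λ j
      ≤ ∑ j ∈ Finset.range T, (n * K * (if (j + 2 : ℝ) ≤ Λ then (j + 3 : ℝ) else 0) +
        4 * n * K * ((n + 1 : ℕ) : ℝ) * S * (((j : ℝ) + 3) / 2 * √(1 / 2) ^ (2 + j))) := by
        refine Finset.sum_le_sum fun j _ => ?_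
        rw [reportCost]
        split_ifs
        · have h0 := epsilon_nonneg 1 (n + 1) K T (j + 1)
          refine (mul_le_mul_of_nonneg_right (hbits j) (by positivity)).trans (le_of_eq ?_)
          rw [epsilon_eq_mul_pow, ← hS, show 1 + (j + 1) = 2 + j by ring]
          ring
        · positivity
    _ = n * K * ∑ j ∈ Finset.range T, (if (j + 2 : ℝ) ≤ Λ then (j + 3 : ℝ) else 0) +
        4 * n * K * ((n + 1 : ℕ) : ℝ) * S *
          ∑ j ∈ Finset.range T, ((j : ℝ) + 3) / 2 * √(1 / 2) ^ (2 + j) := by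
        rw [Finset.sum_add_distrib, Finset.mul_sum, Finset.mul_sum]
    _ ≤ n * K * Λ ^ 2 + 4 * n * K * ((n + 1 : ℕ) : ℝ) * S * 4.7 := by
        gcongr
        · exact sum_range_ite_le T hΛ
        · exact sum_mul_pow_le T
    _ ≤ _ := by
        have h4 : 4 * (n : ℝ) ≤ ((n + 1 : ℕ) : ℝ) ^ 2 := by
          push_cast; nlinarith [sq_nonneg ((n : ℝ) - 1)]
        have h5 : (n : ℝ) ≤ ((n + 1 : ℕ) : ℝ) := by push_cast; linarith
        have h6 : 4 * (n : ℝ) * K * ((n + 1 : ℕ) : ℝ) * S * 4.7 ≤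
            4.7 * ((n + 1 : ℕ) : ℝ) ^ 3 * K * Real.logb 2 K * S := by
          calc _ = 4 * (n : ℝ) * (4.7 * ((n + 1 : ℕ) : ℝ) * K * 1 * S) := by ring
            _ ≤ ((n + 1 : ℕ) : ℝ) ^ 2 * (4.7 * ((n + 1 : ℕ) : ℝ) * K * Real.logb 2 K * S) := by
                gcongr
            _ = _ := by ring
        have h7 : (n : ℝ) * K * Λ ^ 2 ≤ ((n + 1 : ℕ) : ℝ) * K * Λ ^ 2 := by gcongr
        linarith

/-- A geometric sum is controlled by its largest term, and that one is bounded through `G`; `2.42`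
exceeds `1/(√2 - 1)`. -/
theorem sum_ite_pow_le (N : ℕ) {G : ℝ} (hG : 0 ≤ G) :
    ∑ j ∈ Finset.range N, (if √2 ^ (j + 2) ≤ G then √2 ^ j else 0) ≤ 2.42 * G := by
  have hs : 1.4142 ≤ √2 := Real.le_sqrt_of_sq_le (by norm_num)
  have h1 : ∀ N, ∑ j ∈ Finset.range N, (if √2 ^ (j + 2) ≤ G then √2 ^ j else 0) ≤
      2.42 * √2 ^ N := by
    intro N
    induction N with
    | zero => norm_num
    | succ N ih =>
      rw [Finset.sum_range_succ, pow_succ √2 N]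
      have h0 : 0 ≤ √2 ^ N := by positivity
      have : (if √2 ^ (N + 2) ≤ G then √2 ^ N else 0) ≤ √2 ^ N := by split_ifs <;> simp [h0]
      nlinarith
  induction N with
  | zero => simpa using by positivity
  | succ N ih =>
    by_cases h : √2 ^ (N + 2) ≤ G
    · refine (h1 (N + 1)).trans ?_
      gcongr
      refine le_trans ?_ h
      gcongr
      · linarith
      · omega
    · rw [Finset.sum_range_succ, if_neg h, add_zero]
      exact ih

open scoped Classical in
-- In epoch `p` an edge is charged `2 ^ p · 8Mε_p`, which is `8M√L · √2 ^ (p - 1)`, and only while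
-- `√2 ^ (p + 1) ≤ 8M√L / g`. The growing geometric sum is cut off there, which yields `64M²L / g`.
theorem sum_exploreCost_le (hL : 0 ≤ logFactor (n + 1) K T) {F : Fin (n + 1) → Fin K → Prop}
    {g : Fin (n + 1) → Fin K → ℝ} (hg : ∀ i k, F i k → 0 < g i k) :
    ∑ j ∈ Finset.range T, exploreCost n K T F g j ≤
      2.42 * ∑ i, ∑ k, if F i k then
        64 * ((n + 1 : ℕ) : ℝ) ^ 2 * logFactor (n + 1) K T / g i k else 0 := by
  unfold exploreCost
  rw [Finset.sum_comm, Finset.mul_sum]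
  refine Finset.sum_le_sum fun i _ => ?_
  rw [Finset.sum_comm, Finset.mul_sum]
  refine Finset.sum_le_sum fun k _ => ?_
  by_cases hF : F i k
  swap
  · simp [hF]
  simp only [hF, true_and, if_true]
  set S := √(logFactor (n + 1) K T) with hS
  have hS0 : 0 ≤ S := Real.sqrt_nonneg _
  have hS2 : S ^ 2 = logFactor (n + 1) K T := Real.sq_sqrt hL
  set M : ℝ := ((n + 1 : ℕ) : ℝ) with hM
  have hM0 : 0 ≤ M := by positivity
  have hgp := hg i k hF
  have hhalf : √2 * √(1 / 2 : ℝ) = 1 := by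
    rw [← Real.sqrt_mul (by norm_num)]; norm_num
  have hinv : ∀ p : ℕ, √2 ^ p * √(1 / 2 : ℝ) ^ p = 1 := fun p => by rw [← mul_pow, hhalf, one_pow]
  have hcond : ∀ j : ℕ, (g i k ≤ 8 * M * epsilon 1 (n + 1) K T (j + 1)) →
      √2 ^ (j + 2) ≤ 8 * M * S / g i k := by
    intro j h
    rw [epsilon_eq_mul_pow, ← hS, show 1 + (j + 1) = j + 2 by ring] at h
    rw [le_div_iff₀ hgp]
    calc √2 ^ (j + 2) * g i k ≤ √2 ^ (j + 2) * (8 * M * (S * √(1 / 2) ^ (j + 2))) := by gcongr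
      _ = 8 * M * S * (√2 ^ (j + 2) * √(1 / 2) ^ (j + 2)) := by ring
      _ = _ := by rw [hinv, mul_one]
  have hterm : ∀ j : ℕ, (2 : ℝ) ^ (j + 1) * (8 * M * epsilon 1 (n + 1) K T (j + 1)) =
      8 * M * S * √2 ^ j := by
    intro j
    rw [epsilon_eq_mul_pow, ← hS, show 1 + (j + 1) = j + 2 by ring]
    have h2 : (2 : ℝ) ^ (j + 1) = √2 ^ j * √2 ^ (j + 2) := by
      rw [← pow_add, show j + (j + 2) = 2 * (j + 1) by ring, pow_mul, Real.sq_sqrt (by norm_num)]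
    rw [h2]
    calc _ = 8 * M * S * √2 ^ j * (√2 ^ (j + 2) * √(1 / 2) ^ (j + 2)) := by ring
      _ = _ := by rw [hinv, mul_one]
  calc _ ≤ ∑ j ∈ Finset.range T,
        8 * M * S * (if √2 ^ (j + 2) ≤ 8 * M * S / g i k then √2 ^ j else 0) := by
        refine Finset.sum_le_sum fun j _ => ?_
        by_cases h : g i k ≤ 8 * M * epsilon 1 (n + 1) K T (j + 1)
        · rw [if_pos h, if_pos (hcond j h), hterm]
        · rw [if_neg h]
          split_ifs <;> positivity
    _ ≤ 8 * M * S * (2.42 * (8 * M * S / g i k)) := by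
        rw [← Finset.mul_sum]
        gcongr
        exact sum_ite_pow_le T (by positivity)
    _ = 2.42 * (64 * M ^ 2 * S ^ 2 / g i k) := by ring
    _ = _ := by rw [hS2]

/-- The sum `14.52 + 4.7` of the constants of the two kinds of messages. -/
theorem le_message_constant : 19.22 ≤ (4 * √2 - 2) / (3 - 2 * √2) := by
  have hs : 1.4142 ≤ √2 := Real.le_sqrt_of_sq_le (by norm_num)
  have hs' : √2 ≤ 1.4143 := by rw [Real.sqrt_le_left (by norm_num)]; norm_num
  rw [le_div_iff₀ (by linarith)]
  linarith

theorem le_explore_constant : 2.42 ≤ (2 * √2 - 1) / (√2 - 1) := by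
  have hs : 1.4142 ≤ √2 := Real.le_sqrt_of_sq_le (by norm_num)
  have hs' : √2 ≤ 1.4143 := by rw [Real.sqrt_le_left (by norm_num)]; norm_num
  rw [le_div_iff₀ (by linarith)]
  linarith

end Analysis

/-! ### The regret of M-ETC-Elim -/

section Total

variable {n K : ℕ} [NeZero K]

/-- After a successful initialization the players are ranked. -/
theorem exists_remaining_eq_epochProg (hK : n + 1 ≤ K) (tie : TieBreak K) (c T : ℕ)
    {v : ℕ → Fin (n + 1) → Fin K} (hv : v ∉ chairsFail (n + 1) K (chairRounds K T)) :
    ∃ ρ : Fin (n + 1) ≃ Fin (n + 1), ∀ (y : ℕ → Fin (n + 1) → Fin K → ℝ) (m : Fin (n + 1)),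
      remaining (metcElim K tie c T) v y (chairRounds K T + (2 * K - 2)) m =
        epochProg tie c T hK T 1 Finset.univ (fun _ _ => 0) (Fin.castLE hK) (ρ m) := by
  have hv' : ∀ m, ∃ k, chairs v (chairRounds K T) m = some k := by
    intro m
    rw [← Option.ne_none_iff_exists']
    exact fun h => hv ⟨m, h⟩
  choose k hk using hv'
  have hinj : Function.Injective k := fun m m' h =>
    chairs_injective v (chairRounds K T) (hk m) (by rw [hk m', h])
  obtain ⟨ρ, hρ⟩ := exists_rank_equiv hinj
  refine ⟨ρ, fun y m => remaining_hopping hK tie c T hinj hρ (fun m => ?_) m⟩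
  rw [metcElim_eq, remaining_musicalChairs, hk m]
  rfl

omit [NeZero K] in
theorem half_le_epsilon_zero {T : ℕ} (hK : 2 ≤ K) (hT : 0 < T) :
    1 / 2 ≤ epsilon 1 (n + 1) K T 0 := by
  have hL := le_logFactor (M := n + 1) (by omega) hK hT
  rw [epsilon_one]
  refine Real.le_sqrt_of_sq_le ?_
  norm_num
  linarith

/-- Nothing is known about the initial communication arms, but every gap is at most `M` and `ε_0 ≥
1/2`. -/
theorem gap_le_epsilon_zero {T : ℕ} (h : n + 1 ≤ K) (hK : 2 ≤ K) (hT : 0 < T)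
    {μ : Fin (n + 1) → Fin K → ℝ} (hμ : ∀ i k, μ i k ∈ Set.Icc (0 : ℝ) 1)
    (π : Matching (n + 1) K) :
    gap μ π ≤ 4 * ((n + 1 : ℕ) : ℝ) * epsilon 1 (n + 1) K T 0 := by
  have h1 := roundRegret_le h hμ π
  rw [roundRegret_matching] at h1
  have h2 := mul_le_mul_of_nonneg_left (half_le_epsilon_zero (n := n) hK hT)
    (by positivity : (0 : ℝ) ≤ 4 * ((n + 1 : ℕ) : ℝ))
  have h3 : (0 : ℝ) ≤ ((n + 1 : ℕ) : ℝ) := by positivity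
  linarith

theorem one_le_epochBound {T : ℕ} (h : n + 1 ≤ K) (hK : 2 ≤ K) (hT : 0 < T)
    {μ : Fin (n + 1) → Fin K → ℝ} (hμ : ∀ i k, μ i k ∈ Set.Icc (0 : ℝ) 1)
    (hΔ : ∃ π : Matching (n + 1) K, 0 < gap μ π) : 1 ≤ epochBound μ T := by
  obtain ⟨π, hπ⟩ := hΔ
  have h1 := gap_le_epsilon_zero h hK hT hμ π
  have h2 := mul_nonneg (by positivity : (0 : ℝ) ≤ ((n + 1 : ℕ) : ℝ))
    (epsilon_nonneg 1 (n + 1) K T 0)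
  have := add_one_le_epochBound (zero_le_one.trans (le_logFactor (M := n + 1) (by omega) hK hT))
    hπ (by linarith : gap μ π ≤ 8 * ((n + 1 : ℕ) : ℝ) * epsilon 1 (n + 1) K T 0)
  simpa using this

omit [NeZero K] in
theorem epochBound_relabel {M : ℕ} (μ : Fin M → Fin K → ℝ) (ρ : Fin M ≃ Fin M) (T : ℕ) :
    epochBound (fun i => μ (ρ.symm i)) T = epochBound μ T := by
  rw [epochBound, epochBound, minGap_relabel]

/-- Rounding up costs one round and hopping `2K - 2`; the factor `e²` in the logarithm supplies
`2K`. -/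
theorem initialization_le {T : ℕ} (hT : 0 < T) :
    ((chairRounds K T + (2 * K - 2) : ℕ) : ℝ) ≤
      K * Real.log (Real.exp 1 ^ 2 * (K : ℝ) ^ 2 * T) := by
  have hK1 : (1 : ℝ) ≤ K := by exact_mod_cast NeZero.one_le
  have hT1 : (1 : ℝ) ≤ T := by exact_mod_cast hT
  have he : (K : ℝ) / (1 / ((K : ℝ) * T)) = K ^ 2 * T := by field_simp
  have hlog : Real.log (Real.exp 1 ^ 2 * (K : ℝ) ^ 2 * T) = 2 + Real.log (K ^ 2 * T) := by
    rw [mul_assoc, Real.log_mul (by positivity) (by positivity), Real.log_pow, Real.log_exp]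
    norm_num
  have h0 : 0 ≤ Real.log ((K : ℝ) ^ 2 * T) :=
    Real.log_nonneg (one_le_mul_of_one_le_of_one_le (one_le_pow₀ hK1) hT1)
  have h1 : (chairRounds K T : ℝ) ≤ K * Real.log ((K : ℝ) ^ 2 * T) + 1 := by
    rw [chairRounds, he]
    exact (Nat.ceil_lt_add_one (by positivity)).le
  have h2 : 1 ≤ K := NeZero.one_le
  rw [hlog, Nat.cast_add, Nat.cast_sub (by omega)]
  push_cast
  linarith

/-- The bound on the regret, without the constant term. -/
noncomputable def regretBound {M : ℕ} (μ : Fin M → Fin K → ℝ) (best : Fin M → Fin K → Matching M K)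
    (T : ℕ) : ℝ :=
  M * K * Real.log (Real.exp 1 ^ 2 * (K : ℝ) ^ 2 * T)
    + 3 * (M : ℝ) ^ 2 * K * Real.logb 2 K * epochBound μ T
    + M * K * epochBound μ T ^ 2
    + (4 * √2 - 2) / (3 - 2 * √2) * (M : ℝ) ^ 3 * K * Real.logb 2 K * √(logFactor M K T)
    + (2 * √2 - 1) / (√2 - 1) * ∑ m : Fin M, ∑ k : Fin K,
        open scoped Classical in
        if (suboptimalThrough μ m k).Nonempty then
          64 * (M : ℝ) ^ 2 * logFactor M K T / gap μ (best m k) else 0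

theorem regretBound_nonneg {T : ℕ} (h : n + 1 ≤ K) (hK : 2 ≤ K) (hT : 0 < T)
    {μ : Fin (n + 1) → Fin K → ℝ} (hμ : ∀ i k, μ i k ∈ Set.Icc (0 : ℝ) 1)
    (hΔ : ∃ π : Matching (n + 1) K, 0 < gap μ π)
    (best : Fin (n + 1) → Fin K → Matching (n + 1) K) : 0 ≤ regretBound μ best T := by
  have h1 := initialization_le (K := K) hT
  have hL := zero_le_one.trans (le_logFactor (M := n + 1) (by omega) hK hT)
  have h2 := zero_le_one.trans (one_le_epochBound h hK hT hμ hΔ)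
  have h3 : 0 ≤ Real.logb 2 K :=
    Real.logb_nonneg (by norm_num) (by exact_mod_cast (by omega : 1 ≤ K))
  have h4 := le_message_constant
  have h5 := le_explore_constant
  have h6 : 0 ≤ (K : ℝ) * Real.log (Real.exp 1 ^ 2 * (K : ℝ) ^ 2 * T) :=
    le_trans (by positivity) h1
  unfold regretBound
  have h7 := mul_nonneg (by positivity : (0 : ℝ) ≤ ((n + 1 : ℕ) : ℝ)) h6
  rw [← mul_assoc] at h7
  have h8 : (0 : ℝ) ≤ (4 * √2 - 2) / (3 - 2 * √2) := by linarith
  have h9 : (0 : ℝ) ≤ (2 * √2 - 1) / (√2 - 1) := by linarith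
  refine add_nonneg (add_nonneg (add_nonneg (add_nonneg h7 (by positivity)) (by positivity))
    (by positivity)) (mul_nonneg h9 (Finset.sum_nonneg fun m _ => Finset.sum_nonneg fun k _ => ?_))
  have := gap_nonneg μ (best m k)
  split_ifs <;> positivity

variable {μ : Fin (n + 1) → Fin K → ℝ} {tie : TieBreak K} {T : ℕ}
  {best : Fin (n + 1) → Fin K → Matching (n + 1) K}

theorem sum_roundRegret_le (h : n + 1 ≤ K) (hK : 2 ≤ K) (hT : 0 < T) (htie : tie.Valid)
    (hμ : ∀ i k, μ i k ∈ Set.Icc (0 : ℝ) 1)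
    (huniq : ∃! π : Matching (n + 1) K, utility μ π = maxUtility μ)
    (hΔ : ∃ π : Matching (n + 1) K, 0 < gap μ π)
    (hbest : ∀ m k, (suboptimalThrough μ m k).Nonempty →
      best m k ∈ suboptimalThrough μ m k ∧
        ∀ π ∈ suboptimalThrough μ m k, utility μ π ≤ utility μ (best m k))
    {prog : Prog K Unit} {v : ℕ → Fin (n + 1) → Fin K} {y : ℕ → Fin (n + 1) → Fin K → ℝ}
    (hy : ∀ t i k, y t i k ∈ Set.Icc (0 : ℝ) 1) {ρ : Fin (n + 1) ≃ Fin (n + 1)}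
    (hrem : ∀ m, remaining prog v y (chairRounds K T + (2 * K - 2)) m =
        epochProg tie 1 T h T 1 Finset.univ (fun _ _ => 0) (Fin.castLE h) (ρ m))
    (hgood : ∀ q < T, (fun t i => y t (ρ.symm i)) ∉
      badEpoch tie 1 T h (chairRounds K T + (2 * K - 2)) (fun i => μ (ρ.symm i)) q) :
    ∑ t ∈ Finset.range T, roundRegret μ (armsPulled prog v y t) ≤ regretBound μ best T := by
  set t₀ := chairRounds K T + (2 * K - 2) with ht₀
  set μ' : Fin (n + 1) → Fin K → ℝ := fun i => μ (ρ.symm i) with hμ'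
  -- The least gap of a suboptimal matching through the edge, by the choice of `best`, with players
  -- indexed by rank.
  set g : Fin (n + 1) → Fin K → ℝ := fun i k => gap μ (best (ρ.symm i) k) with hgdef
  have hmem : ∀ i k π, π ∈ suboptimalThrough μ' i k ↔
      relabelMatching ρ π ∈ suboptimalThrough μ (ρ.symm i) k :=
    fun i k π => suboptimalThrough_relabel μ ρ i k π
  have hne : ∀ i k, (suboptimalThrough μ' i k).Nonempty ↔
      (suboptimalThrough μ (ρ.symm i) k).Nonempty := by
    intro i k
    constructor
    · rintro ⟨π, hπ⟩
      exact ⟨_, (hmem i k π).1 hπ⟩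
    · rintro ⟨π, hπ⟩
      exact ⟨(relabelMatching ρ).symm π, (hmem i k _).2 (by simpa using hπ)⟩
  have hg : ∀ i k, ∀ π ∈ suboptimalThrough μ' i k, g i k ≤ gap μ' π := by
    intro i k π hπ
    have h1 := (hmem i k π).1 hπ
    have h2 := (hbest _ _ ⟨_, h1⟩).2 _ h1
    rw [hμ', gap_relabel, hgdef]
    unfold gap
    linarith
  have hgpos : ∀ i k, (suboptimalThrough μ' i k).Nonempty → 0 < g i k := fun i k hF =>
    sub_pos.2 (hbest _ _ ((hne i k).1 hF)).1.2
  obtain ⟨π₀, hπ₀, hu⟩ := huniq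
  have hπ₀' : utility μ' ((relabelMatching ρ).symm π₀) = maxUtility μ' := by
    rw [hμ', utility_relabel, maxUtility_relabel, Equiv.apply_symm_apply, hπ₀]
  have hu' : ∀ π : Matching (n + 1) K, utility μ' π = maxUtility μ' →
      π = (relabelMatching ρ).symm π₀ := by
    intro π hπ
    rw [hμ', utility_relabel, maxUtility_relabel] at hπ
    rw [← hu _ hπ, Equiv.symm_apply_apply]
  have hμm : ∀ i k, μ' i k ∈ Set.Icc (0 : ℝ) 1 := fun i k => hμ _ k
  have hΛ := one_le_epochBound h hK hT hμ hΔ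
  have hΛ' : epochBound μ' T = epochBound μ T := epochBound_relabel μ ρ T
  have hL := zero_le_one.trans (le_logFactor (M := n + 1) (by omega) hK hT)
  have hepochs := sum_roundRegret_epochs_le (π₀ := (relabelMatching ρ).symm π₀) (t₀ := t₀) htie h
    hK hT hμ' hμm hπ₀' hu' hg hy hgood T 0 t₀ Finset.univ (fun _ _ => 0) (Fin.castLEEmb h)
    (zero_add T) (Nat.zero_le _) hrem rfl (fun _ => Finset.mem_univ _) (accurate_zero hK hT hμm)
    (gap_le_epsilon_zero h hK hT hμm _) (by simpa [hΛ'] using hΛ)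
  rw [hΛ', Nat.Ico_zero_eq_range, Finset.sum_add_distrib, Finset.sum_add_distrib] at hepochs
  have hinit := sum_Ico_le_add (r := fun s => roundRegret μ (armsPulled prog v y s))
    (b := fun _ => ((n + 1 : ℕ) : ℝ)) (t := 0) (N := t₀) T (fun _ => by positivity)
    fun j _ => roundRegret_le h hμ _
  rw [Nat.Ico_zero_eq_range, zero_add, Finset.sum_const, Finset.card_range, nsmul_eq_mul] at hinit
  have h1 := mul_le_mul_of_nonneg_left (initialization_le (K := K) hT)
    (by positivity : (0 : ℝ) ≤ ((n + 1 : ℕ) : ℝ))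
  have h2 := sum_announceCost_le (T := T) h (epochBound μ T) hΛ
  have h3 := sum_reportCost_le (T := T) h (epochBound μ T) hΛ
  have h4 := sum_exploreCost_le (T := T) hL hgpos
  have h5 : (∑ i, ∑ k, open scoped Classical in if (suboptimalThrough μ' i k).Nonempty then
        64 * ((n + 1 : ℕ) : ℝ) ^ 2 * logFactor (n + 1) K T / g i k else 0) =
      ∑ m, ∑ k, open scoped Classical in if (suboptimalThrough μ m k).Nonempty then
        64 * ((n + 1 : ℕ) : ℝ) ^ 2 * logFactor (n + 1) K T / gap μ (best m k) else 0 := by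
    refine Eq.trans ?_ (Equiv.sum_comp ρ.symm _)
    refine Finset.sum_congr rfl fun i _ => Finset.sum_congr rfl fun k _ => ?_
    by_cases hF : (suboptimalThrough μ' i k).Nonempty
    · rw [if_pos hF, if_pos ((hne i k).1 hF)]
    · rw [if_neg hF, if_neg fun h' => hF ((hne i k).2 h')]
  rw [h5] at h4
  have h6 : (0 : ℝ) ≤ ∑ m, ∑ k, open scoped Classical in
      if (suboptimalThrough μ m k).Nonempty then
        64 * ((n + 1 : ℕ) : ℝ) ^ 2 * logFactor (n + 1) K T / gap μ (best m k) else 0 := by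
    refine Finset.sum_nonneg fun m _ => Finset.sum_nonneg fun k _ => ?_
    have := gap_nonneg μ (best m k)
    split_ifs <;> positivity
  have h7 := mul_le_mul_of_nonneg_right le_explore_constant h6
  have hlog : 0 ≤ Real.logb 2 K :=
    Real.logb_nonneg (by norm_num) (by exact_mod_cast (by omega : 1 ≤ K))
  have h8 := mul_le_mul_of_nonneg_right le_message_constant (by positivity :
    0 ≤ ((n + 1 : ℕ) : ℝ) ^ 3 * K * Real.logb 2 K * √(logFactor (n + 1) K T))
  unfold regretBound
  linarith

end Total

/-! ### Taking expectations -/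

section Expectation

variable {Ω : Type*} [MeasurableSpace Ω] {P : Measure Ω} [IsProbabilityMeasure P]

omit [IsProbabilityMeasure P] in
theorem mul_maxUtility_sub_meanReward {M K : ℕ} [NeZero K] (prog : Prog K Unit) (T : ℕ)
    (μ : Fin M → Fin K → ℝ) (v : ℕ → Fin M → Fin K) (y : ℕ → Fin M → Fin K → ℝ) :
    T * maxUtility μ - meanReward prog T μ v y =
      ∑ t ∈ Finset.range T, roundRegret μ (armsPulled prog v y t) := by
  simp [roundRegret, meanReward, Finset.sum_sub_distrib]

/-- The regret for fixed draws with a successful initialization. -/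
theorem regret_of_notMem_chairsFail {n K T : ℕ} [NeZero K] {μ : Fin (n + 1) → Fin K → ℝ}
    {tie : TieBreak K} {best : Fin (n + 1) → Fin K → Matching (n + 1) K}
    {Z : Ω → ℕ → Fin (n + 1) → Fin K → ℝ} (hZ : IndepRows P μ Z)
    (h : n + 1 ≤ K) (hK : 2 ≤ K) (hT : 0 < T) (htie : tie.Valid)
    (huniq : ∃! π : Matching (n + 1) K, utility μ π = maxUtility μ)
    (hΔ : ∃ π : Matching (n + 1) K, 0 < gap μ π)
    (hbest : ∀ m k, (suboptimalThrough μ m k).Nonempty →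
      best m k ∈ suboptimalThrough μ m k ∧
        ∀ π ∈ suboptimalThrough μ m k, utility μ π ≤ utility μ (best m k))
    {v : ℕ → Fin (n + 1) → Fin K} (hv : v ∉ chairsFail (n + 1) K (chairRounds K T)) :
    T * maxUtility μ - ∫ ω, totalReward (metcElim K tie 1 T) T v (Z ω) ∂P ≤
      regretBound μ best T + 1 := by
  have hp : MeasProg fun _ : Table (n + 1) K => metcElim K tie 1 T := .metcElim tie 1 T
  obtain ⟨ρ, hρ⟩ := exists_remaining_eq_epochProg h tie 1 T hv
  set prog := metcElim K tie 1 T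
  set t₀ := chairRounds K T + (2 * K - 2)
  have hZρ := hZ.relabel ρ
  have hmeas : ∀ q, MeasurableSet {ω | (fun t i => Z ω t (ρ.symm i)) ∈
      badEpoch tie 1 T h t₀ (fun i => μ (ρ.symm i)) q} := fun q =>
    hZρ.measurable (measurableSet_badEpoch tie 1 T h t₀ _ q)
  set bad : Set Ω := ⋃ q ∈ Finset.range T, {ω | (fun t i => Z ω t (ρ.symm i)) ∈
      badEpoch tie 1 T h t₀ (fun i => μ (ρ.symm i)) q} with hbad
  have hbadm : MeasurableSet bad := Finset.measurableSet_biUnion _ fun q _ => hmeas q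
  have hT0 : (0 : ℝ) < T := by exact_mod_cast hT
  have hK0 : (0 : ℝ) < K := by exact_mod_cast NeZero.pos K
  have hM0 : (0 : ℝ) < ((n + 1 : ℕ) : ℝ) := by positivity
  -- There are `T` epochs of failure probability `MKδ = 1/(MT²)`, and a failure costs at most `TM`:
  -- the product is exactly one.
  have hprob : T * ((n + 1 : ℕ) : ℝ) * P.real bad ≤ 1 := by
    calc T * ((n + 1 : ℕ) : ℝ) * P.real bad
        ≤ T * ((n + 1 : ℕ) : ℝ) * ∑ q ∈ Finset.range T,
          ((n + 1 : ℕ) * K) * (1 / (((n + 1 : ℕ) : ℝ) ^ 2 * K * (T : ℝ) ^ 2)) := by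
          gcongr
          refine (measureReal_biUnion_finset_le _ _).trans (Finset.sum_le_sum fun q _ => ?_)
          exact prob_badEpoch_le tie 1 T h t₀ hZρ hT q
      _ = 1 := by
          rw [Finset.sum_const, Finset.card_range, nsmul_eq_mul]
          field_simp
  have hB := regretBound_nonneg h hK hT hZ.mean_mem hΔ best
  have hpoint : ∀ ω, T * maxUtility μ - meanReward prog T μ v (Z ω) ≤
      regretBound μ best T + bad.indicator (fun _ => T * ((n + 1 : ℕ) : ℝ)) ω := by
    intro ω
    rw [mul_maxUtility_sub_meanReward]
    by_cases hω : ω ∈ bad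
    · rw [Set.indicator_of_mem hω]
      refine le_add_of_nonneg_of_le hB ?_
      refine (Finset.sum_le_sum fun t _ => roundRegret_le h hZ.mean_mem _).trans ?_
      simp [mul_add]
    · rw [Set.indicator_of_notMem hω, add_zero]
      refine sum_roundRegret_le h hK hT htie hZ.mean_mem huniq hΔ hbest (hZ.mem ω) (hρ (Z ω))
        fun q hq hmem => hω ?_
      rw [hbad, Set.mem_iUnion₂]
      exact ⟨q, Finset.mem_range.2 hq, hmem⟩
  have hint := hZ.integrable_meanReward hp T v
  rw [hZ.integral_totalReward hp T v]
  calc T * maxUtility μ - ∫ ω, meanReward prog T μ v (Z ω) ∂P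
      = ∫ ω, (T * maxUtility μ - meanReward prog T μ v (Z ω)) ∂P := by
        rw [integral_sub (integrable_const _) hint]; simp
    _ ≤ ∫ ω, (regretBound μ best T + bad.indicator (fun _ => T * ((n + 1 : ℕ) : ℝ)) ω) ∂P :=
        integral_mono ((integrable_const _).sub hint)
          ((integrable_const _).add ((integrable_const _).indicator hbadm)) hpoint
    _ = regretBound μ best T + T * ((n + 1 : ℕ) : ℝ) * P.real bad := by
        rw [integral_add (integrable_const _) ((integrable_const _).indicator hbadm),
          integral_indicator hbadm]
        simp [mul_comm]
    _ ≤ _ := by linarith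

variable {M K : ℕ} {μ : Fin M → Fin K → ℝ} {Y : ℕ → Fin M → Fin K → Ω → ℝ}
  {V : ℕ → Fin M → Ω → Fin K}

omit [IsProbabilityMeasure P] in
theorem IsBandit.indepRows (h : IsBandit P μ Y V) : IndepRows P μ fun ω t m k => Y t m k ω where
  measurable := by
    have := h.measurable_reward
    fun_prop
  mem ω t m k := h.reward_mem t m k ω
  mean := h.mean
  indep := h.indep_rounds.comp (fun _ z m k => z (m, k)) fun _ => by fun_prop

omit [IsProbabilityMeasure P] in
theorem IsBandit.indepFun (h : IsBandit P μ Y V) :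
    IndepFun (fun ω t m => V t m ω) (fun ω t m k => Y t m k ω) P :=
  h.indep_draws_rewards.comp (φ := fun (z : ℕ × Fin M → Fin K) t m => z (t, m))
    (ψ := fun (z : ℕ × Fin M × Fin K → ℝ) t m k => z (t, m, k)) (by fun_prop) (by fun_prop)

end Expectation

/-- With a single arm all matchings coincide. -/
theorem two_le_of_gap_pos {M K : ℕ} [NeZero K] {μ : Fin M → Fin K → ℝ}
    (huniq : ∃! π : Matching M K, utility μ π = maxUtility μ)
    (hΔ : ∃ π : Matching M K, 0 < gap μ π) : 2 ≤ K := by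
  by_contra hlt
  have hK1 : K = 1 := by have := NeZero.pos K; omega
  subst hK1
  obtain ⟨π₀, hπ₀, -⟩ := huniq
  obtain ⟨π, hπ⟩ := hΔ
  have : π = π₀ := by ext m; simp
  rw [this, gap, hπ₀, sub_self] at hπ
  exact lt_irrefl _ hπ

theorem theorem3 {Ω : Type*} [MeasurableSpace Ω] (P : Measure Ω) [IsProbabilityMeasure P]
    (M K T : ℕ) [NeZero K] (hM : 1 ≤ M) (hMK : M ≤ K) (hT : 0 < T)
    (μ : Fin M → Fin K → ℝ) (Y : ℕ → Fin M → Fin K → Ω → ℝ) (V : ℕ → Fin M → Ω → Fin K)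
    (hYV : IsBandit P μ Y V)
    (tie : TieBreak K) (htie : tie.Valid)
    (huniq : ∃! π : Matching M K, utility μ π = maxUtility μ)
    (hΔ : ∃ π : Matching M K, 0 < gap μ π)
    (best : Fin M → Fin K → Matching M K)
    (hbest : ∀ m k, (suboptimalThrough μ m k).Nonempty →
      best m k ∈ suboptimalThrough μ m k ∧
        ∀ π ∈ suboptimalThrough μ m k, utility μ π ≤ utility μ (best m k)) :
    Integrable (fun ω => totalReward (metcElim K tie 1 T) T
      (fun t m => V t m ω) (fun t m k => Y t m k ω)) P ∧
    regret P μ Y V (metcElim K tie 1 T) T ≤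
      2 + M * K * Real.log (Real.exp 1 ^ 2 * (K : ℝ) ^ 2 * T)
      + 3 * (M : ℝ) ^ 2 * K * Real.logb 2 K *
          Real.logb 2 (64 * (M : ℝ) ^ 2 * Real.log (2 * (M : ℝ) ^ 2 * K * (T : ℝ) ^ 2)
            / minGap μ ^ 2)
      + M * K * (Real.logb 2 (64 * (M : ℝ) ^ 2 * Real.log (2 * (M : ℝ) ^ 2 * K * (T : ℝ) ^ 2)
            / minGap μ ^ 2)) ^ 2
      + (4 * √2 - 2) / (3 - 2 * √2) * (M : ℝ) ^ 3 * K * Real.logb 2 K *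
          √(Real.log (2 * (M : ℝ) ^ 2 * K * (T : ℝ) ^ 2))
      + (2 * √2 - 1) / (√2 - 1) *
          ∑ m : Fin M, ∑ k : Fin K,
            open scoped Classical in
            if (suboptimalThrough μ m k).Nonempty then
              64 * (M : ℝ) ^ 2 * Real.log (2 * (M : ℝ) ^ 2 * K * (T : ℝ) ^ 2)
                / gap μ (best m k)
            else 0 := by
  have hK := two_le_of_gap_pos huniq hΔ
  have hZ := hYV.indepRows
  have hV : Measurable fun ω t m => V t m ω := by
    have := hYV.measurable_draw
    fun_prop
  obtain ⟨n, rfl⟩ := Nat.exists_eq_add_of_le' hM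
  have hp : MeasProg fun _ : Table (n + 1) K => metcElim K tie 1 T := .metcElim tie 1 T
  have hf := measurable_totalReward hp T
  set prog := metcElim K tie 1 T with hprog
  set f : Table (n + 1) K → ℝ := fun x => totalReward prog T x.1 x.2 with hfdef
  set Vω : Ω → ℕ → Fin (n + 1) → Fin K := fun ω t m => V t m ω with hVω
  set Zω : Ω → ℕ → Fin (n + 1) → Fin K → ℝ := fun ω t m k => Y t m k ω with hZω
  have hVZ : Measurable fun ω => (Vω ω, Zω ω) := hV.prodMk hZ.measurable
  have hint : Integrable (fun ω => f (Vω ω, Zω ω)) P :=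
    Integrable.of_mem_Icc 0 (T * (n + 1 : ℕ)) (hf.comp hVZ).aemeasurable
      (.of_forall fun ω => totalReward_mem prog T _ (hZ.mem ω))
  refine ⟨hint, ?_⟩
  have : IsProbabilityMeasure (P.map Vω) := Measure.isProbabilityMeasure_map hV.aemeasurable
  have : IsProbabilityMeasure (P.map Zω) :=
    Measure.isProbabilityMeasure_map hZ.measurable.aemeasurable
  -- The joint law is a product, so the draws can be fixed and integrated last; success of the
  -- initialization and the ranks depend on them alone.
  have hprod : P.map (fun ω => (Vω ω, Zω ω)) = (P.map Vω).prod (P.map Zω) :=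
    (indepFun_iff_map_prod_eq_prod_map_map hV.aemeasurable hZ.measurable.aemeasurable).1
      hYV.indepFun
  have hint' : Integrable f ((P.map Vω).prod (P.map Zω)) := by
    rw [← hprod, integrable_map_measure hf.aestronglyMeasurable hVZ.aemeasurable]
    exact hint
  have hinner : ∀ v, ∫ z, f (v, z) ∂(P.map Zω) = ∫ ω, totalReward prog T v (Zω ω) ∂P := fun v =>
    integral_map hZ.measurable.aemeasurable
      (hf.comp measurable_prodMk_left).aestronglyMeasurable
  have hE : ∫ ω, f (Vω ω, Zω ω) ∂P = ∫ v, ∫ ω, totalReward prog T v (Zω ω) ∂P ∂(P.map Vω) := by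
    rw [← integral_map hVZ.aemeasurable hf.aestronglyMeasurable, hprod, integral_prod _ hint']
    simp only [hinner]
  have hint2 : Integrable (fun v => ∫ ω, totalReward prog T v (Zω ω) ∂P) (P.map Vω) := by
    have := hint'.integral_prod_left
    simpa only [hinner] using this
  set fail := chairsFail (n + 1) K (chairRounds K T) with hfail
  have hfm : MeasurableSet fail := measurableSet_chairsFail _
  have hB := regretBound_nonneg hMK hK hT hZ.mean_mem hΔ best
  have hpoint : ∀ v, T * maxUtility μ - ∫ ω, totalReward prog T v (Zω ω) ∂P ≤
      regretBound μ best T + 1 + fail.indicator (fun _ => (T : ℝ) * (n + 1 : ℕ)) v := by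
    intro v
    by_cases hv : v ∈ fail
    · rw [Set.indicator_of_mem hv]
      have h1 : 0 ≤ ∫ ω, totalReward prog T v (Zω ω) ∂P :=
        integral_nonneg fun ω => (totalReward_mem prog T v (hZ.mem ω)).1
      have h2 : (T : ℝ) * maxUtility μ ≤ T * (n + 1 : ℕ) :=
        mul_le_mul_of_nonneg_left (maxUtility_le hMK hZ.mean_mem) (Nat.cast_nonneg T)
      linarith
    · rw [Set.indicator_of_notMem hv, add_zero]
      exact regret_of_notMem_chairsFail hZ hMK hK hT htie huniq hΔ hbest hv
  -- A failed initialization costs at most `TM` and has probability at most `M/(K²T)`; the product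
  -- is `(M/K)² ≤ 1`.
  have hprob : (T : ℝ) * (n + 1 : ℕ) * (P.map Vω).real fail ≤ 1 := by
    have h1 : (P.map Vω).real fail ≤ ((n + 1 : ℕ) : ℝ) / (K ^ 2 * T) := by
      rw [map_measureReal_apply hV hfm]
      exact prob_chairsFail_le hMK hYV.measurable_draw hYV.uniform_draw hYV.indep_draws hT
    have hT0 : (0 : ℝ) < T := by exact_mod_cast hT
    have hK0 : (0 : ℝ) < K := by exact_mod_cast NeZero.pos K
    have hMK' : ((n + 1 : ℕ) : ℝ) ≤ K := by exact_mod_cast hMK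
    calc _ ≤ (T : ℝ) * (n + 1 : ℕ) * (((n + 1 : ℕ) : ℝ) / (K ^ 2 * T)) := by gcongr
      _ = ((n + 1 : ℕ) : ℝ) ^ 2 / K ^ 2 := by field_simp
      _ ≤ 1 := div_le_one_of_le₀ (by gcongr) (by positivity)
  have hmain : regret P μ Y V prog T ≤ regretBound μ best T + 2 := by
    have hreg : regret P μ Y V prog T = T * maxUtility μ - ∫ ω, f (Vω ω, Zω ω) ∂P := rfl
    rw [hreg, hE]
    calc _ = ∫ v, (T * maxUtility μ - ∫ ω, totalReward prog T v (Zω ω) ∂P) ∂(P.map Vω) := by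
          rw [integral_sub (integrable_const _) hint2]; simp
      _ ≤ ∫ v, (regretBound μ best T + 1 +
            fail.indicator (fun _ => (T : ℝ) * (n + 1 : ℕ)) v) ∂(P.map Vω) :=
          integral_mono ((integrable_const _).sub hint2)
            ((integrable_const _).add ((integrable_const _).indicator hfm)) hpoint
      _ = regretBound μ best T + 1 + T * (n + 1 : ℕ) * (P.map Vω).real fail := by
          rw [integral_add (integrable_const _) ((integrable_const _).indicator hfm),
            integral_indicator hfm]
          simp [mul_comm]
      _ ≤ _ := by linarith
  refine hmain.trans (le_of_eq ?_)
  rw [regretBound, epochBound, logFactor]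
  ring
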